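/- Let $\mathbf U$ be the open unit disk and $\mathbf T$ the unit circle with its normalized arc length measure $\sigma$, and let $1<p<\infty$. For a harmonic mapping $f=g+\bar h$ on $\mathbf U$, with $g,h$ holomorphic on $\mathbf U$, put $$\|f\|_p=\sup_{0<r<1}\Big(\int_{\mathbf T}|f(r\zeta)|^p\,d\sigma(\zeta)\Big)^{1/p},$$ and write $f\in\mathbf h^p$ if $\|f\|_p<\infty$. If $f=g+\bar h\in\mathbf h^p$ and $\operatorname{Re}(g(0)h(0))\le 0$, then $g$ and $h$ have finite radial limits at almost every point of $\mathbf T$ (denoted again by $g$ and $h$), $\int_{\mathbf T}(|g|^2+|h|^2)^{p/2}\,d\sigma<\infty$, and $$\|f\|_p\le \sqrt2\,\max\Big\{\sin\frac{\pi}{2p},\cos\frac{\pi}{2p}\Big\}\Big(\int_{\mathbf T}(|g|^2+|h|^2)^{p/2}\,d\sigma\Big)^{1/p}.$$ The constant is sharp: for every $p\in(1,\infty)$ and every real $C<\sqrt2\max\{\sin\frac{\pi}{2p},\cos\frac{\pi}{2p}\}$ there is $f=g+\bar h\in\mathbf h^p$, with $g,h$ holomorphic on $\mathbf U$ and $\operatorname{Re}(g(0)h(0))\le0$,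 such that $\|f\|_p> C\big(\int_{\mathbf T}(|g|^2+|h|^2)^{p/2}\,d\sigma\big)^{1/p}$. -/

import Mathlib

open Filter Topology MeasureTheory
open scoped ENNReal ComplexConjugate

noncomputable section

/-- The normalized arc length measure `dt / 2π` on the unit circle, in the angular parameter
`t ∈ (0, 2π]`; the point of parameter `t` on the circle of radius `r` is
`circleMap 0 r t = r * exp (i t)`. -/
def circleSigma : Measure ℝ :=
  (ENNReal.ofReal (2 * Real.pi))⁻¹ • volume.restrict (Set.Ioc 0 (2 * Real.pi))

/-- `f` is the harmonic mapping `g + conj h` on the unit disk, with `g` and `h` holomorphic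
there. Values outside the open disk are irrelevant. -/
structure IsHarmonicDecomposition (f g h : ℂ → ℂ) : Prop where
  holo_left : DifferentiableOn ℂ g (Metric.ball 0 1)
  holo_right : DifferentiableOn ℂ h (Metric.ball 0 1)
  eq_on : ∀ z ∈ Metric.ball (0 : ℂ) 1, f z = g z + conj (h z)

/-- The integral mean `M_p(f, r)` of order `p` over the circle of radius `r`. -/
def integralMean (p : ℝ) (f : ℂ → ℂ) (r : ℝ) : ℝ≥0∞ :=
  (∫⁻ t, ‖f (circleMap 0 r t)‖ₑ ^ p ∂circleSigma) ^ (1 / p)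

/-- The Hardy norm `sup_{0 < r < 1} M_p(f, r)`, possibly infinite. -/
def hardyNorm (p : ℝ) (f : ℂ → ℂ) : ℝ≥0∞ :=
  ⨆ r ∈ Set.Ioo (0 : ℝ) 1, integralMean p f r

/-- The class of harmonic mappings of the unit disk with finite Hardy norm of order `p`. -/
def MemHarmonicHardy (p : ℝ) (f : ℂ → ℂ) : Prop :=
  (∃ g h : ℂ → ℂ, IsHarmonicDecomposition f g h) ∧ hardyNorm p f < ∞

/-- `g` has a finite radial limit at the boundary point `exp (i t)`. -/
def HasRadialLimit (g : ℂ → ℂ) (t : ℝ) : Prop :=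
  ∃ a : ℂ, Tendsto (fun r : ℝ => g (circleMap 0 r t)) (𝓝[<] 1) (𝓝 a)

/-- The boundary value of `g` at `exp (i t)`: its radial limit (meaningful where
`HasRadialLimit g t` holds). -/
def boundaryValue (g : ℂ → ℂ) (t : ℝ) : ℂ :=
  limUnder (𝓝[<] (1 : ℝ)) (fun r : ℝ => g (circleMap 0 r t))

/-- `(∫_T (|g|² + |h|²)^(p/2) dσ)^(1/p)`, for the boundary values of `g` and `h`. -/
def boundaryNorm (p : ℝ) (g h : ℂ → ℂ) : ℝ≥0∞ :=
  (∫⁻ t, (‖boundaryValue g t‖ₑ ^ 2 + ‖boundaryValue h t‖ₑ ^ 2) ^ (p / 2) ∂circleSigma) ^ (1 / p)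

/-- The constant `√2 max {sin (π / 2p), cos (π / 2p)}`. -/
def rieszConstant (p : ℝ) : ℝ :=
  √2 * max (Real.sin (Real.pi / (2 * p))) (Real.cos (Real.pi / (2 * p)))

end

/-- The real function `U` is supported from below at `z` by the real part of a holomorphic
function. -/
def HasHolomorphicSupport (U : ℂ → ℝ) (z : ℂ) : Prop :=
  ∃ H : ℂ → ℂ, (∀ᶠ w in 𝓝 z, DifferentiableAt ℂ H w) ∧ (∀ᶠ w in 𝓝 z, (H w).re ≤ U w) ∧
    (H z).re = U z

theorem circleSigma_eq_circleAverage {E : Type*} [NormedAddCommGroup E] [NormedSpace ℝ E]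
    (F : ℂ → E) (r : ℝ) :
    ∫ t, F (circleMap 0 r t) ∂circleSigma = Real.circleAverage F 0 r := by
  rw [Real.circleAverage_def, intervalIntegral.integral_of_le Real.two_pi_pos.le, circleSigma,
    integral_smul_measure, ENNReal.toReal_inv, ENNReal.toReal_ofReal Real.two_pi_pos.le]

instance isProbabilityMeasure_circleSigma : IsProbabilityMeasure circleSigma := by
  constructor
  rw [circleSigma, Measure.smul_apply, Measure.restrict_apply_univ, Real.volume_Ioc, sub_zero,
    smul_eq_mul]
  exact ENNReal.inv_mul_cancel (by simp [Real.pi_pos]) ENNReal.ofReal_ne_top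

theorem exists_polynomial_re_near_of_continuousOn_sphere {U : ℂ → ℝ} {r : ℝ} (hr : 0 < r)
    (hU : ContinuousOn U (Metric.sphere 0 r)) {ε : ℝ} (hε : 0 < ε) :
    ∃ P : Polynomial ℂ, ∀ z ∈ Metric.sphere (0 : ℂ) r, |U z - (P.eval z).re| ≤ ε := by
  have : Fact (0 < (1 : ℝ)) := ⟨one_pos⟩
  have hmem (x : AddCircle (1 : ℝ)) : (r : ℂ) * (AddCircle.toCircle x : ℂ) ∈
      Metric.sphere (0 : ℂ) r := by
    simp [abs_of_pos hr, Circle.norm_coe]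
  let F : C(AddCircle (1 : ℝ), ℂ) :=
    ⟨fun x => (U (r * (AddCircle.toCircle x : ℂ)) : ℂ), by
      refine Complex.continuous_ofReal.comp ?_
      refine hU.comp_continuous ?_ hmem
      exact continuous_const.mul (continuous_subtype_val.comp AddCircle.continuous_toCircle)⟩
  have hF : F ∈ (Submodule.span ℂ (Set.range <| @fourier 1)).topologicalClosure := by
    rw [span_fourier_closure_eq_top]; trivial
  rw [← SetLike.mem_coe, Submodule.topologicalClosure_coe, Metric.mem_closure_iff] at hF
  obtain ⟨T, hT, hFT⟩ := hF ε hε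
  have key : ∃ P Q : Polynomial ℂ, ∀ x, T x = P.eval (r * (AddCircle.toCircle x : ℂ)) +
      conj (Q.eval (r * (AddCircle.toCircle x : ℂ))) := by
    have hrc : (r : ℂ) ≠ 0 := by exact_mod_cast hr.ne'
    refine Submodule.span_induction ?_ ?_ ?_ ?_ hT
    · rintro _ ⟨n, rfl⟩
      rcases Int.eq_nat_or_neg n with ⟨m, rfl | rfl⟩
      · refine ⟨Polynomial.C ((r : ℂ)⁻¹ ^ m) * Polynomial.X ^ m, 0, fun x => ?_⟩
        simp [fourier_apply, AddCircle.toCircle_nsmul, mul_pow, hrc]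
      · refine ⟨0, Polynomial.C ((r : ℂ)⁻¹ ^ m) * Polynomial.X ^ m, fun x => ?_⟩
        have := @fourier_neg 1 m x
        rw [this]
        simp [fourier_apply, AddCircle.toCircle_nsmul, mul_pow, hrc]
    · exact ⟨0, 0, fun x => by simp⟩
    · rintro S S' - - ⟨P, Q, h⟩ ⟨P', Q', h'⟩
      exact ⟨P + P', Q + Q', fun x => by simp [h, h']; ring⟩
    · rintro a S - ⟨P, Q, h⟩
      exact ⟨Polynomial.C a * P, Polynomial.C (conj a) * Q, fun x => by simp [h]; ring⟩
  obtain ⟨P, Q, hPQ⟩ := key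
  refine ⟨P + Q, fun z hz => ?_⟩
  have hz' : ‖z‖ = r := by simpa using hz
  obtain ⟨x, hx⟩ : ∃ x : AddCircle (1 : ℝ), (r : ℂ) * (AddCircle.toCircle x : ℂ) = z := by
    have hrc : (r : ℂ) ≠ 0 := by exact_mod_cast hr.ne'
    have hm : z / r ∈ Submonoid.unitSphere ℂ := by
      simp [Submonoid.unitSphere, hz', abs_of_pos hr, hr.ne']
    obtain ⟨x, hx⟩ := (AddCircle.homeomorphCircle one_ne_zero).surjective (⟨z / r, hm⟩ : Circle)
    refine ⟨x, ?_⟩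
    rw [AddCircle.homeomorphCircle_apply] at hx
    rw [hx]
    change (r : ℂ) * (z / r) = z
    field_simp
  have h1 : ‖F x - T x‖ ≤ ε := by
    rw [← dist_eq_norm]
    exact (ContinuousMap.dist_apply_le_dist x).trans hFT.le
  have h2 : (F x - T x).re = U z - ((P + Q).eval z).re := by
    rw [hPQ, hx]
    simp [F, hx]
  rw [← h2]
  exact (Complex.abs_re_le_norm _).trans h1

theorem HasHolomorphicSupport.sub_re {U : ℂ → ℝ} {z : ℂ} (h : HasHolomorphicSupport U z)
    {P : ℂ → ℂ} (hP : Differentiable ℂ P) :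
    HasHolomorphicSupport (fun w => U w - (P w).re) z := by
  obtain ⟨H, hd, hle, he⟩ := h
  refine ⟨fun w => H w - P w, ?_, ?_, by simp [he]⟩
  · filter_upwards [hd] with w hw using hw.sub (hP w)
  · filter_upwards [hle] with w hw
    simpa using hw

/-- Maximum principle for continuous functions with holomorphic supports off the zeros of a
holomorphic function. -/
theorem nonpos_of_hasHolomorphicSupport {V : ℂ → ℝ} {u : ℂ → ℂ} {r R : ℝ} (hrR : r < R)
    (hV : ContinuousOn V (Metric.closedBall 0 r)) (hu : DifferentiableOn ℂ u (Metric.ball 0 R))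
    (hne : ∃ z ∈ Metric.ball (0 : ℂ) R, u z ≠ 0)
    (hs : ∀ z ∈ Metric.ball (0 : ℂ) r, u z ≠ 0 → HasHolomorphicSupport V z)
    (hb : ∀ z ∈ Metric.sphere (0 : ℂ) r, V z ≤ 0) :
    ∀ z ∈ Metric.closedBall (0 : ℂ) r, V z ≤ 0 := by
  have hsub : Metric.closedBall (0 : ℂ) r ⊆ Metric.ball 0 R := Metric.closedBall_subset_ball hrR
  have huc : ContinuousOn u (Metric.closedBall 0 r) := hu.continuousOn.mono hsub
  have hcpt := isCompact_closedBall (0 : ℂ) r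
  obtain ⟨M, hM⟩ := hcpt.exists_bound_of_continuousOn huc
  have step (n : ℕ) : ∀ z ∈ Metric.closedBall (0 : ℂ) r, ‖u z‖ * Real.exp (n * V z) ≤ M := by
    by_contra! hcon
    obtain ⟨z₁, hz₁, hz₁M⟩ := hcon
    set E : ℂ → ℝ := fun z => ‖u z‖ * Real.exp (n * V z) with hE
    have hEc : ContinuousOn E (Metric.closedBall 0 r) :=
      huc.norm.mul (Real.continuous_exp.comp_continuousOn (continuousOn_const.mul hV))
    obtain ⟨z₂, hz₂, hmax⟩ := hcpt.exists_isMaxOn ⟨z₁, hz₁⟩ hEc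
    set S := Metric.closedBall (0 : ℂ) r ∩ E ⁻¹' {E z₂} with hS
    have hScpt : IsCompact S :=
      hcpt.of_isClosed_subset (hEc.preimage_isClosed_of_isClosed Metric.isClosed_closedBall
        isClosed_singleton) Set.inter_subset_left
    obtain ⟨z, hz, hzmax⟩ := hScpt.exists_isMaxOn ⟨z₂, hz₂, rfl⟩ continuous_norm.continuousOn
    have hEz : E z = E z₂ := hz.2
    have hmax' : ∀ w ∈ Metric.closedBall (0 : ℂ) r, E w ≤ E z := fun w hw => hEz ▸ hmax hw
    have hEM : M < E z := hz₁M.trans_le (hmax' z₁ hz₁)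
    have hM0 : 0 ≤ M := (norm_nonneg _).trans (hM z₁ hz₁)
    have hzb : z ∈ Metric.ball (0 : ℂ) r := by
      rcases (Metric.mem_closedBall.1 hz.1).lt_or_eq with h | h
      · exact h
      · exfalso
        have h1 : Real.exp (n * V z) ≤ 1 := by
          rw [Real.exp_le_one_iff]
          exact mul_nonpos_of_nonneg_of_nonpos n.cast_nonneg (hb z h)
        have : E z ≤ M := by
          calc E z ≤ ‖u z‖ * 1 := mul_le_mul_of_nonneg_left h1 (norm_nonneg _)
            _ ≤ M := by simpa using hM z hz.1
        linarith
    have huz : u z ≠ 0 := by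
      intro h
      simp [hE, h] at hEM
      linarith
    obtain ⟨H, hHd, hHle, hHe⟩ := hs z hzb huz
    have hball : Metric.ball (0 : ℂ) r ∈ 𝓝 z := Metric.isOpen_ball.mem_nhds hzb
    set k : ℂ → ℂ := fun w => u w * Complex.exp (n * H w) with hk
    have hnk (w : ℂ) : ‖k w‖ = ‖u w‖ * Real.exp (n * (H w).re) := by
      simp [hk, Complex.norm_exp]
    have hkd : ∀ᶠ w in 𝓝 z, DifferentiableAt ℂ k w := by
      filter_upwards [hHd, hball] with w hw hwb
      exact ((hu w (hsub (Metric.ball_subset_closedBall hwb))).differentiableAt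
        (Metric.isOpen_ball.mem_nhds (hsub (Metric.ball_subset_closedBall hwb)))).mul
        ((hw.const_mul _).cexp)
    have hkE : ∀ᶠ w in 𝓝 z, ‖k w‖ ≤ E w := by
      filter_upwards [hHle] with w hw
      rw [hnk]
      simp only [hE]
      gcongr
    have hkz : ‖k z‖ = E z := by rw [hnk, hHe]
    have hloc : IsLocalMax (norm ∘ k) z := by
      filter_upwards [hkE, hball] with w hw hwb
      simp only [Function.comp]
      rw [hkz]
      exact hw.trans (hmax' w (Metric.ball_subset_closedBall hwb))
    have hconst := Complex.eventually_eq_of_isLocalMax_norm hkd hloc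
    have hin : ∀ᶠ w in 𝓝 z, ‖w‖ ≤ ‖z‖ := by
      filter_upwards [hconst, hkE, hball] with w hw hw2 hwb
      have hwc := Metric.ball_subset_closedBall hwb
      refine hzmax ⟨hwc, ?_⟩
      refine le_antisymm (hmax hwc) ?_
      rw [← hEz, ← hkz, ← hw]
      exact hw2
    have hlm : IsLocalMax (norm ∘ (fun w : ℂ => w)) z := hin
    have h3 := Complex.eventually_eq_of_isLocalMax_norm
      (Eventually.of_forall fun w => differentiableAt_id) hlm
    have : (𝓝[≠] z).NeBot := inferInstance
    obtain ⟨w, hw1, hw2⟩ := ((h3.filter_mono nhdsWithin_le_nhds).and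
      (self_mem_nhdsWithin : {z}ᶜ ∈ 𝓝[≠] z)).exists
    exact hw2 hw1
  have hoff : ∀ z ∈ Metric.closedBall (0 : ℂ) r, u z ≠ 0 → V z ≤ 0 := by
    intro z hz huz
    by_contra! hpos
    have hupos : 0 < ‖u z‖ := norm_pos_iff.2 huz
    obtain ⟨n, hn⟩ := exists_nat_gt (M / (‖u z‖ * V z))
    have h1 := step n z hz
    have h2 := Real.add_one_le_exp (n * V z)
    rw [div_lt_iff₀ (by positivity)] at hn
    nlinarith
  intro z hz
  rcases (Metric.mem_closedBall.1 hz).lt_or_eq with h | h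
  swap
  · exact hb z h
  by_contra! hpos
  have hball : Metric.ball (0 : ℂ) r ∈ 𝓝 z := Metric.isOpen_ball.mem_nhds h
  have hVc : ContinuousAt V z := hV.continuousAt (mem_of_superset hball Metric.ball_subset_closedBall)
  have hz0 : u =ᶠ[𝓝 z] 0 := by
    filter_upwards [hball, hVc.eventually (lt_mem_nhds hpos)] with w hw hwpos
    by_contra hne0
    exact absurd (hoff w (Metric.ball_subset_closedBall hw) hne0) (not_le.2 hwpos)
  have han : AnalyticOnNhd ℂ u (Metric.ball 0 R) := hu.analyticOnNhd Metric.isOpen_ball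
  obtain ⟨w, hw, hwne⟩ := hne
  exact hwne (han.eqOn_zero_of_preconnected_of_eventuallyEq_zero
    (convex_ball _ _).isPreconnected (hsub hz) hz0 hw)

theorem integrable_circleMap_of_continuousOn {E : Type*} [NormedAddCommGroup E]
    {U : ℂ → E} {r : ℝ} (hr : 0 ≤ r)
    (hU : ContinuousOn U (Metric.sphere 0 r)) :
    Integrable (fun t => U (circleMap 0 r t)) circleSigma := by
  have hc : Continuous fun t => U (circleMap 0 r t) :=
    hU.comp_continuous (continuous_circleMap 0 r) fun t => circleMap_mem_sphere 0 hr t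
  refine Integrable.smul_measure ?_ (by simp [Real.pi_pos])
  exact hc.integrableOn_Ioc

/-- Monotonicity of the circular means of a function with holomorphic supports. -/
theorem integral_circleMap_mono_of_hasHolomorphicSupport {U : ℂ → ℝ} {u : ℂ → ℂ} {s r R : ℝ}
    (hs0 : 0 ≤ s) (hsr : s ≤ r) (hrR : r < R)
    (hU : ContinuousOn U (Metric.closedBall 0 r)) (hu : DifferentiableOn ℂ u (Metric.ball 0 R))
    (hne : ∃ z ∈ Metric.ball (0 : ℂ) R, u z ≠ 0)
    (hs : ∀ z ∈ Metric.ball (0 : ℂ) r, u z ≠ 0 → HasHolomorphicSupport U z) :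
    ∫ t, U (circleMap 0 s t) ∂circleSigma ≤ ∫ t, U (circleMap 0 r t) ∂circleSigma := by
  rcases (hs0.trans hsr).eq_or_lt with h0 | hr
  · rw [show s = r by linarith]
  refine le_of_forall_pos_le_add fun ε hε => ?_
  obtain ⟨P, hP⟩ := exists_polynomial_re_near_of_continuousOn_sphere hr
    (hU.mono Metric.sphere_subset_closedBall) (half_pos hε)
  have hPd : Differentiable ℂ fun z => P.eval z := P.differentiable
  have hle : ∀ z ∈ Metric.closedBall (0 : ℂ) r, U z - (P.eval z + (ε / 2 : ℝ)).re ≤ 0 := by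
    refine nonpos_of_hasHolomorphicSupport hrR ?_ hu hne
      (fun z hz hz0 => (hs z hz hz0).sub_re (hPd.add_const _)) ?_
    · exact hU.sub (Complex.continuous_re.comp (hPd.continuous.add continuous_const)).continuousOn
    · intro z hz
      have := (abs_le.1 (hP z hz)).2
      simp only [Complex.add_re, Complex.ofReal_re]
      linarith
  have hint (ρ : ℝ) (hρ : 0 ≤ ρ) :
      Integrable (fun t => (P.eval (circleMap 0 ρ t)).re) circleSigma :=
    integrable_circleMap_of_continuousOn (U := fun z => (P.eval z).re) hρ
      (Complex.continuous_re.comp hPd.continuous).continuousOn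
  have hmean (ρ : ℝ) (hρ : 0 ≤ ρ) :
      ∫ t, (P.eval (circleMap 0 ρ t)).re ∂circleSigma = (P.eval 0).re := by
    have h1 : Integrable (fun t => P.eval (circleMap 0 ρ t)) circleSigma :=
      integrable_circleMap_of_continuousOn (U := fun z => P.eval z) hρ hPd.continuous.continuousOn
    have h2 := integral_re h1
    simp only [RCLike.re_eq_complex_re] at h2
    rw [h2, circleSigma_eq_circleAverage (fun z => P.eval z)]
    congr 1
    exact DiffContOnCl.circleAverage hPd.diffContOnCl
  have hsub : Metric.sphere (0 : ℂ) s ⊆ Metric.closedBall 0 r :=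
    Metric.sphere_subset_closedBall.trans (Metric.closedBall_subset_closedBall hsr)
  calc ∫ t, U (circleMap 0 s t) ∂circleSigma
      ≤ ∫ t, ((P.eval (circleMap 0 s t)).re + ε / 2) ∂circleSigma := by
        refine integral_mono (integrable_circleMap_of_continuousOn hs0 (hU.mono hsub))
          ((hint s hs0).add (integrable_const _)) fun t => ?_
        have := hle _ (hsub (circleMap_mem_sphere 0 hs0 t))
        simp only [Complex.add_re, Complex.ofReal_re] at this
        simp only
        linarith
    _ = ∫ t, ((P.eval (circleMap 0 r t)).re + ε / 2) ∂circleSigma := by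
        rw [integral_add (hint s hs0) (integrable_const _),
          integral_add (hint r hr.le) (integrable_const _), hmean s hs0, hmean r hr.le]
    _ ≤ ∫ t, (U (circleMap 0 r t) + ε) ∂circleSigma := by
        refine integral_mono ((hint r hr.le).add (integrable_const _))
          ((integrable_circleMap_of_continuousOn hr.le
            (hU.mono Metric.sphere_subset_closedBall)).add (integrable_const _)) fun t => ?_
        have := (abs_le.1 (hP _ (circleMap_mem_sphere 0 hr.le t))).1
        simp only
        linarith
    _ = ∫ t, U (circleMap 0 r t) ∂circleSigma + ε := by
        rw [integral_add (integrable_circleMap_of_continuousOn hr.le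
            (hU.mono Metric.sphere_subset_closedBall)) (integrable_const _)]
        simp

theorem hasDerivAt_cos_rpow_mul_sin_div {p x : ℝ} (hc : 0 < Real.cos x)
    (hs : Real.sin (p * x) ≠ 0) :
    HasDerivAt (fun y => Real.cos y ^ (p - 1) * Real.sin y / Real.sin (p * y))
      (Real.cos x ^ (p - 2) * (p / 2 * Real.sin ((p - 2) * x) - (p - 2) / 2 * Real.sin (p * x)) /
        Real.sin (p * x) ^ 2) x := by
  have h1 := (Real.hasDerivAt_cos x).rpow_const (p := p - 1) (Or.inl hc.ne')
  have h2 : HasDerivAt (fun y => Real.sin (p * y)) (Real.cos (p * x) * p) x := by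
    simpa using ((hasDerivAt_id x).const_mul p).sin
  convert! (h1.mul (Real.hasDerivAt_sin x)).div h2 hs using 1
  have e1 : Real.cos x ^ (p - 1) = Real.cos x ^ (p - 2) * Real.cos x := by
    rw [← Real.rpow_add_one hc.ne']; ring_nf
  have e2 : (p - 1 - 1 : ℝ) = p - 2 := by ring
  have e3 : Real.sin ((p - 2) * x) =
      Real.sin (p * x) * (2 * Real.cos x ^ 2 - 1) - Real.cos (p * x) * (2 * Real.sin x * Real.cos x) := by
    rw [sub_mul, Real.sin_sub, Real.cos_two_mul, Real.sin_two_mul]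
  congr 1
  simp only [Pi.mul_apply]
  rw [e1, e2, e3]
  linear_combination (Real.cos x ^ (p - 2) * (p - 1) * Real.sin (p * x)) *
    Real.sin_sq_add_cos_sq x

theorem hasDerivAt_sin_rpow_mul_cos_div {p x : ℝ} (hc : 0 < Real.sin x)
    (hs : Real.sin (p * x) ≠ 0) :
    HasDerivAt (fun y => Real.sin y ^ (p - 1) * Real.cos y / Real.sin (p * y))
      (-(Real.sin x ^ (p - 2) * (p / 2 * Real.sin ((2 - p) * x) +
        (2 - p) / 2 * Real.sin (p * x))) / Real.sin (p * x) ^ 2) x := by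
  have h1 := (Real.hasDerivAt_sin x).rpow_const (p := p - 1) (Or.inl hc.ne')
  have h2 : HasDerivAt (fun y => Real.sin (p * y)) (Real.cos (p * x) * p) x := by
    simpa using ((hasDerivAt_id x).const_mul p).sin
  convert! (h1.mul (Real.hasDerivAt_cos x)).div h2 hs using 1
  have e1 : Real.sin x ^ (p - 1) = Real.sin x ^ (p - 2) * Real.sin x := by
    rw [← Real.rpow_add_one hc.ne']; ring_nf
  have e2 : (p - 1 - 1 : ℝ) = p - 2 := by ring
  have e3 : Real.sin ((2 - p) * x) =
      (2 * Real.sin x * Real.cos x) * Real.cos (p * x) - (2 * Real.cos x ^ 2 - 1) * Real.sin (p * x) := by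
    rw [sub_mul, Real.sin_sub, Real.cos_two_mul, Real.sin_two_mul]
  congr 1
  simp only [Pi.mul_apply]
  rw [e1, e2, e3]
  linear_combination (Real.sin x ^ (p - 2) * Real.sin (p * x)) *
    Real.sin_sq_add_cos_sq x

/-- A function with a single sign change of its derivative from `+` to `-` is maximal there. -/
theorem le_of_deriv_sign_change {E E' : ℝ → ℝ} {a b x₀ : ℝ} (hx₀ : x₀ ∈ Set.Icc a b)
    (hc : ContinuousOn E (Set.Icc a b)) (hd : ∀ x ∈ Set.Ioo a b, HasDerivAt E (E' x) x)
    (h1 : ∀ x ∈ Set.Ioo a x₀, 0 ≤ E' x) (h2 : ∀ x ∈ Set.Ioo x₀ b, E' x ≤ 0) :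
    ∀ x ∈ Set.Icc a b, E x ≤ E x₀ := by
  intro x hx
  rcases le_total x x₀ with h | h
  · have : MonotoneOn E (Set.Icc a x₀) := by
      refine monotoneOn_of_deriv_nonneg (convex_Icc _ _)
        (hc.mono (Set.Icc_subset_Icc_right hx₀.2)) ?_ ?_ <;> rw [interior_Icc]
      · exact fun y hy => (hd y ⟨hy.1, hy.2.trans_le hx₀.2⟩).differentiableAt.differentiableWithinAt
      · intro y hy
        rw [(hd y ⟨hy.1, hy.2.trans_le hx₀.2⟩).deriv]
        exact h1 y hy
    exact this ⟨hx.1, h⟩ ⟨hx₀.1, le_rfl⟩ h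
  · have : AntitoneOn E (Set.Icc x₀ b) := by
      refine antitoneOn_of_deriv_nonpos (convex_Icc _ _)
        (hc.mono (Set.Icc_subset_Icc_left hx₀.1)) ?_ ?_ <;> rw [interior_Icc]
      · exact fun y hy => (hd y ⟨hx₀.1.trans_lt hy.1, hy.2⟩).differentiableAt.differentiableWithinAt
      · intro y hy
        rw [(hd y ⟨hx₀.1.trans_lt hy.1, hy.2⟩).deriv]
        exact h2 y hy
    exact this ⟨le_rfl, hx₀.2⟩ ⟨h, hx.2⟩ h

theorem cos_rpow_sub_le {p : ℝ} (hp : 2 ≤ p) {x : ℝ} (hx : x ∈ Set.Icc 0 (Real.pi / p)) :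
    Real.cos x ^ p - Real.sin (Real.pi / (2 * p)) * Real.cos (Real.pi / (2 * p)) ^ (p - 1) *
      Real.cos (p * x) ≤ Real.cos (Real.pi / (2 * p)) ^ p := by
  have hp0 : 0 < p := by linarith
  have hpi := Real.pi_pos
  set x₀ := Real.pi / (2 * p) with hx₀
  have hpx₀ : p * x₀ = Real.pi / 2 := by rw [hx₀]; field_simp
  have hx₀pos : 0 < x₀ := by positivity
  have hx₀lt : x₀ < Real.pi / p := by
    rw [hx₀, div_lt_div_iff₀ (by positivity) hp0]; nlinarith
  have hpp : Real.pi / p ≤ Real.pi / 2 := by gcongr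
  set D := Real.sin x₀ * Real.cos x₀ ^ (p - 1) with hD
  have hlt {y : ℝ} (hy : y ∈ Set.Ioo 0 (Real.pi / p)) : p * y < Real.pi := by
    have := hy.2
    rw [lt_div_iff₀ hp0] at this
    linarith
  have hcos {y : ℝ} (hy : y ∈ Set.Ioo 0 (Real.pi / p)) : 0 < Real.cos y :=
    Real.cos_pos_of_mem_Ioo ⟨by linarith [hy.1], hy.2.trans_le hpp⟩
  have hsin {y : ℝ} (hy : y ∈ Set.Ioo 0 (Real.pi / p)) : 0 < Real.sin (p * y) :=
    Real.sin_pos_of_pos_of_lt_pi (mul_pos hp0 hy.1) (hlt hy)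
  set N : ℝ → ℝ := fun y => Real.cos y ^ (p - 1) * Real.sin y / Real.sin (p * y) with hN
  have hNmono : MonotoneOn N (Set.Ioo 0 (Real.pi / p)) := by
    have hdN {y : ℝ} (hy : y ∈ Set.Ioo 0 (Real.pi / p)) :=
      hasDerivAt_cos_rpow_mul_sin_div (p := p) (hcos hy) (hsin hy).ne'
    refine monotoneOn_of_deriv_nonneg (convex_Ioo _ _)
      (fun y hy => (hdN hy).continuousAt.continuousWithinAt) ?_ ?_ <;> rw [interior_Ioo]
    · exact fun y hy => (hdN hy).differentiableAt.differentiableWithinAt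
    · intro y hy
      rw [(hdN hy).deriv]
      have hconc := (And.right strictConcaveOn_sin_Icc.concaveOn)
        (⟨le_rfl, hpi.le⟩ : (0 : ℝ) ∈ Set.Icc 0 Real.pi)
        (⟨(mul_pos hp0 hy.1).le, (hlt hy).le⟩ : p * y ∈ Set.Icc 0 Real.pi)
        (show 0 ≤ 2 / p by positivity)
        (show 0 ≤ (p - 2) / p from div_nonneg (by linarith) hp0.le)
        (by field_simp; ring)
      simp only [smul_eq_mul, mul_zero, Real.sin_zero, zero_add] at hconc
      have e : (p - 2) / p * (p * y) = (p - 2) * y := by field_simp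
      rw [e, div_mul_eq_mul_div, div_le_iff₀ hp0] at hconc
      have := (hcos hy).le
      refine div_nonneg (mul_nonneg (Real.rpow_nonneg this _) ?_) (sq_nonneg _)
      linarith
  have hNx₀ : N x₀ = D := by
    simp only [hN, hpx₀, Real.sin_pi_div_two, div_one, hD]; ring
  set E : ℝ → ℝ := fun y => Real.cos y ^ p - D * Real.cos (p * y) with hE
  have hEd : ∀ y ∈ Set.Ioo 0 (Real.pi / p), HasDerivAt E (p * Real.sin (p * y) * (D - N y)) y := by
    intro y hy
    have h2 : HasDerivAt (fun y => Real.cos (p * y)) (-Real.sin (p * y) * p) y := by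
      simpa using ((hasDerivAt_id y).const_mul p).cos
    convert! ((Real.hasDerivAt_cos y).rpow_const (p := p) (Or.inl (hcos hy).ne')).sub
      (h2.const_mul D) using 1
    have := (hsin hy).ne'
    simp only [hN]
    field_simp
    ring
  have hEc : ContinuousOn E (Set.Icc 0 (Real.pi / p)) := by
    refine Continuous.continuousOn ?_
    exact (Real.continuous_cos.rpow_const fun _ => Or.inr hp0.le).sub
      (continuous_const.mul (Real.continuous_cos.comp (continuous_const.mul continuous_id)))
  have hmem : x₀ ∈ Set.Ioo 0 (Real.pi / p) := ⟨hx₀pos, hx₀lt⟩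
  have := le_of_deriv_sign_change (Set.Ioo_subset_Icc_self hmem) hEc hEd ?_ ?_ x hx
  · simpa [hE, hpx₀] using this
  · intro y hy
    have hy' : y ∈ Set.Ioo 0 (Real.pi / p) := ⟨hy.1, hy.2.trans hx₀lt⟩
    have := hNmono hy' hmem hy.2.le
    have := hsin hy'
    rw [hNx₀] at *
    exact mul_nonneg (by positivity) (by linarith)
  · intro y hy
    have hy' : y ∈ Set.Ioo 0 (Real.pi / p) := ⟨hx₀pos.trans hy.1, hy.2⟩
    have := hNmono hmem hy' hy.1.le
    have := hsin hy'
    rw [hNx₀] at *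
    exact mul_nonpos_of_nonneg_of_nonpos (by positivity) (by linarith)

theorem sin_rpow_add_le {p : ℝ} (hp1 : 1 < p) (hp : p < 2) {x : ℝ}
    (hx : x ∈ Set.Icc 0 (Real.pi / 2)) :
    Real.sin x ^ p + Real.cos (Real.pi / (2 * p)) * Real.sin (Real.pi / (2 * p)) ^ (p - 1) *
      Real.cos (p * x) ≤ Real.sin (Real.pi / (2 * p)) ^ p := by
  have hp0 : 0 < p := by linarith
  have hpi := Real.pi_pos
  set x₀ := Real.pi / (2 * p) with hx₀
  have hpx₀ : p * x₀ = Real.pi / 2 := by rw [hx₀]; field_simp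
  have hx₀pos : 0 < x₀ := by positivity
  have hx₀lt : x₀ < Real.pi / 2 := by
    rw [hx₀, div_lt_div_iff₀ (by positivity) two_pos]; nlinarith
  set D := Real.cos x₀ * Real.sin x₀ ^ (p - 1) with hD
  have hlt {y : ℝ} (hy : y ∈ Set.Ioo 0 (Real.pi / 2)) : p * y < Real.pi := by
    have := hy.2
    have := hy.1
    nlinarith
  have hcos {y : ℝ} (hy : y ∈ Set.Ioo 0 (Real.pi / 2)) : 0 < Real.sin y :=
    Real.sin_pos_of_pos_of_lt_pi hy.1 (by linarith [hy.2])
  have hsin {y : ℝ} (hy : y ∈ Set.Ioo 0 (Real.pi / 2)) : 0 < Real.sin (p * y) :=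
    Real.sin_pos_of_pos_of_lt_pi (mul_pos hp0 hy.1) (hlt hy)
  set N : ℝ → ℝ := fun y => Real.sin y ^ (p - 1) * Real.cos y / Real.sin (p * y) with hN
  have hNmono : AntitoneOn N (Set.Ioo 0 (Real.pi / 2)) := by
    have hdN {y : ℝ} (hy : y ∈ Set.Ioo 0 (Real.pi / 2)) :=
      hasDerivAt_sin_rpow_mul_cos_div (p := p) (hcos hy) (hsin hy).ne'
    refine antitoneOn_of_deriv_nonpos (convex_Ioo _ _)
      (fun y hy => (hdN hy).continuousAt.continuousWithinAt) ?_ ?_ <;> rw [interior_Ioo]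
    · exact fun y hy => (hdN hy).differentiableAt.differentiableWithinAt
    · intro y hy
      rw [(hdN hy).deriv]
      have h1 := (hcos hy).le
      have h2 := (hsin hy).le
      have h3 : 0 ≤ Real.sin ((2 - p) * y) :=
        Real.sin_nonneg_of_nonneg_of_le_pi (mul_nonneg (by linarith) hy.1.le)
          (by nlinarith [hy.1, hy.2])
      have h4 : 0 ≤ 2 - p := by linarith
      rw [neg_div]
      refine neg_nonpos.2 (div_nonneg (mul_nonneg (Real.rpow_nonneg h1 _) ?_) (sq_nonneg _))
      positivity
  have hNx₀ : N x₀ = D := by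
    simp only [hN, hpx₀, Real.sin_pi_div_two, div_one, hD]; ring
  set E : ℝ → ℝ := fun y => Real.sin y ^ p + D * Real.cos (p * y) with hE
  have hEd : ∀ y ∈ Set.Ioo 0 (Real.pi / 2), HasDerivAt E (p * Real.sin (p * y) * (N y - D)) y := by
    intro y hy
    have h2 : HasDerivAt (fun y => Real.cos (p * y)) (-Real.sin (p * y) * p) y := by
      simpa using ((hasDerivAt_id y).const_mul p).cos
    convert! ((Real.hasDerivAt_sin y).rpow_const (p := p) (Or.inl (hcos hy).ne')).add
      (h2.const_mul D) using 1
    have := (hsin hy).ne'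
    simp only [hN]
    field_simp
    ring
  have hEc : ContinuousOn E (Set.Icc 0 (Real.pi / 2)) := by
    refine Continuous.continuousOn ?_
    exact (Real.continuous_sin.rpow_const fun _ => Or.inr hp0.le).add
      (continuous_const.mul (Real.continuous_cos.comp (continuous_const.mul continuous_id)))
  have hmem : x₀ ∈ Set.Ioo 0 (Real.pi / 2) := ⟨hx₀pos, hx₀lt⟩
  have := le_of_deriv_sign_change (Set.Ioo_subset_Icc_self hmem) hEc hEd ?_ ?_ x hx
  · simpa [hE, hpx₀] using this
  · intro y hy
    have hy' : y ∈ Set.Ioo 0 (Real.pi / 2) := ⟨hy.1, hy.2.trans hx₀lt⟩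
    have := hNmono hy' hmem hy.2.le
    have := hsin hy'
    rw [hNx₀] at *
    exact mul_nonneg (by positivity) (by linarith)
  · intro y hy
    have hy' : y ∈ Set.Ioo 0 (Real.pi / 2) := ⟨hx₀pos.trans hy.1, hy.2⟩
    have := hNmono hmem hy' hy.1.le
    have := hsin hy'
    rw [hNx₀] at *
    exact mul_nonpos_of_nonneg_of_nonpos (by positivity) (by linarith)

theorem two_mul_sq_rpow_half {x p : ℝ} (hx : 0 ≤ x) :
    (2 * x ^ 2) ^ (p / 2) = 2 ^ (p / 2) * x ^ p := by
  rw [Real.mul_rpow two_pos.le (sq_nonneg x), ← Real.rpow_natCast x 2, ← Real.rpow_mul hx]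
  congr 2
  push_cast; ring

theorem two_rpow_half_sub_one_le {p : ℝ} (hp : 2 ≤ p) :
    (2 : ℝ) ^ (p / 2 - 1) ≤ 2 ^ (p / 2) * Real.cos (Real.pi / (2 * p)) ^ p := by
  have hpi := Real.pi_pos
  have hp0 : 0 < p := by linarith
  have hc : 0 ≤ Real.cos (Real.pi / (2 * p)) := by
    refine Real.cos_nonneg_of_mem_Icc ⟨by linarith [show 0 < Real.pi / (2 * p) by positivity], ?_⟩
    gcongr; linarith
  rw [← two_mul_sq_rpow_half hc]
  have e1 : 2 * Real.cos (Real.pi / (2 * p)) ^ 2 = 1 + Real.cos (Real.pi / p) := by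
    have := Real.cos_two_mul (Real.pi / (2 * p))
    rw [show 2 * (Real.pi / (2 * p)) = Real.pi / p by field_simp] at this
    linarith
  have h1 := Real.one_sub_mul_le_cos (x := Real.pi / p) (by positivity) (by gcongr)
  rw [show 2 / Real.pi * (Real.pi / p) = 2 / p by field_simp] at h1
  have h2p : 2 / p ≤ 1 := (div_le_one hp0).2 hp
  have h2 := rpow_one_add_le_one_add_mul_self (s := 1) (by norm_num) (p := 1 - 2 / p)
    (by linarith) (by linarith [show 0 < 2 / p by positivity])
  calc (2 : ℝ) ^ (p / 2 - 1) = ((2 : ℝ) ^ (1 - 2 / p)) ^ (p / 2) := by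
        rw [← Real.rpow_mul two_pos.le]
        congr 1
        field_simp
    _ ≤ _ := by
        rw [e1]
        refine Real.rpow_le_rpow (by positivity) ?_ (by positivity)
        norm_num at h2
        linarith

theorem one_add_mul_cos_rpow_sub_le {p : ℝ} (hp : 2 ≤ p) {θ r : ℝ} (hθ : θ ∈ Set.Icc 0 Real.pi)
    (hr : r ∈ Set.Icc (0 : ℝ) 1) :
    (1 + r * Real.cos θ) ^ (p / 2) - 2 ^ (p / 2) * (Real.sin (Real.pi / (2 * p)) *
      Real.cos (Real.pi / (2 * p)) ^ (p - 1)) * r ^ (p / 2) *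
        Real.cos (p / 2 * min θ (2 * Real.pi / p)) ≤
      2 ^ (p / 2) * Real.cos (Real.pi / (2 * p)) ^ p := by
  have hpi := Real.pi_pos
  have hp0 : 0 < p := by linarith
  have hq1 : 1 ≤ p / 2 := by linarith
  have hx₀ : 0 < Real.pi / (2 * p) := by positivity
  have hx₀' : Real.pi / (2 * p) ≤ Real.pi / 2 := by gcongr; linarith
  have hc₀ : 0 ≤ Real.cos (Real.pi / (2 * p)) :=
    Real.cos_nonneg_of_mem_Icc ⟨by linarith, hx₀'⟩
  have hs₀ : 0 ≤ Real.sin (Real.pi / (2 * p)) :=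
    Real.sin_nonneg_of_nonneg_of_le_pi hx₀.le (by linarith)
  have hA1 := two_rpow_half_sub_one_le hp
  set A := 2 ^ (p / 2) * Real.cos (Real.pi / (2 * p)) ^ p with hA
  set D := 2 ^ (p / 2) * (Real.sin (Real.pi / (2 * p)) *
      Real.cos (Real.pi / (2 * p)) ^ (p - 1)) with hD
  have hD0 : 0 ≤ D := by positivity
  have hA0 : 1 ≤ A := (Real.one_le_rpow one_le_two (by linarith)).trans hA1
  have hsmall : ∀ θ ∈ Set.Icc 0 (2 * Real.pi / p),
      (1 + Real.cos θ) ^ (p / 2) - D * Real.cos (p / 2 * θ) ≤ A := by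
    intro θ hθ
    have hx : θ / 2 ∈ Set.Icc 0 (Real.pi / p) :=
      ⟨by linarith [hθ.1], by have := hθ.2; rw [mul_div_assoc] at this; linarith⟩
    have h := cos_rpow_sub_le hp hx
    have hc : 0 ≤ Real.cos (θ / 2) := by
      refine Real.cos_nonneg_of_mem_Icc ⟨by linarith [hx.1], hx.2.trans ?_⟩
      gcongr
    have e1 : 1 + Real.cos θ = 2 * Real.cos (θ / 2) ^ 2 := by
      have := Real.cos_two_mul (θ / 2)
      rw [mul_div_cancel₀ _ two_ne_zero] at this
      linarith
    have e2 : p * (θ / 2) = p / 2 * θ := by ring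
    rw [e1, two_mul_sq_rpow_half hc]
    rw [e2] at h
    have := mul_le_mul_of_nonneg_left h (show (0 : ℝ) ≤ 2 ^ (p / 2) by positivity)
    rw [hA, hD]
    linarith
  have hone : (1 + Real.cos θ) ^ (p / 2) - D * Real.cos (p / 2 * min θ (2 * Real.pi / p)) ≤ A := by
    rcases le_total θ (2 * Real.pi / p) with h | h
    · rw [min_eq_left h]; exact hsmall θ ⟨hθ.1, h⟩
    · rw [min_eq_right h]
      refine le_trans ?_ (hsmall _ ⟨by positivity, le_rfl⟩)
      have h1 : Real.cos θ ≤ Real.cos (2 * Real.pi / p) :=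
        Real.cos_le_cos_of_nonneg_of_le_pi (by positivity) hθ.2 h
      have h2 : 0 ≤ 1 + Real.cos θ := by linarith [Real.neg_one_le_cos θ]
      have := Real.rpow_le_rpow h2 (show 1 + Real.cos θ ≤ 1 + Real.cos (2 * Real.pi / p) by linarith)
        (show 0 ≤ p / 2 by linarith)
      linarith
  have hconv := convexOn_rpow hq1
  obtain ⟨hr0, hr1⟩ := hr
  have hrq : 0 ≤ r ^ (p / 2) := Real.rpow_nonneg hr0 _
  have hrq1 : r ^ (p / 2) ≤ 1 := Real.rpow_le_one hr0 hr1 (by linarith)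
  have hc1 : 0 ≤ 1 + Real.cos θ := by linarith [Real.neg_one_le_cos θ]
  set κ := Real.cos (p / 2 * min θ (2 * Real.pi / p)) with hκ
  rcases le_or_gt κ 0 with hκ0 | hκ0
  · have h1 := And.right hconv (show (1 : ℝ) ∈ Set.Ici 0 from zero_le_one' ℝ)
      (show 1 + Real.cos θ ∈ Set.Ici 0 from hc1) (show 0 ≤ 1 - r by linarith) hr0 (by ring)
    simp only [smul_eq_mul, Real.one_rpow] at h1
    have e : (1 - r) * 1 + r * (1 + Real.cos θ) = 1 + r * Real.cos θ := by ring
    rw [e] at h1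
    have h2 : r ^ (p / 2) ≤ r := by
      simpa using Real.rpow_le_rpow_of_exponent_ge' hr0 hr1 zero_le_one hq1
    have h3 : D * (-κ) * r ^ (p / 2) ≤ D * (-κ) * r :=
      mul_le_mul_of_nonneg_left h2 (mul_nonneg hD0 (by linarith))
    have h4 := mul_le_mul_of_nonneg_left hone hr0
    nlinarith
  · have hm : min θ (2 * Real.pi / p) < Real.pi / p := by
      by_contra! hcon
      refine absurd hκ0 (not_lt.2 (Real.cos_nonpos_of_pi_div_two_le_of_le ?_ ?_))
      · rw [div_le_iff₀ hp0] at hcon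
        linarith
      · have := min_le_right θ (2 * Real.pi / p)
        rw [le_div_iff₀ hp0] at this
        linarith
    have hθ' : θ < Real.pi / p := by
      rcases min_lt_iff.1 hm with h | h
      · exact h
      · exfalso
        rw [mul_div_assoc] at h
        linarith [show 0 < Real.pi / p by positivity]
    have hcos : 0 ≤ Real.cos θ := by
      refine Real.cos_nonneg_of_mem_Icc ⟨by linarith [hθ.1], hθ'.le.trans ?_⟩
      gcongr
    have hpos : 0 < 1 + Real.cos θ := by linarith
    have h1 := And.right hconv (show (1 : ℝ) ∈ Set.Ici 0 from zero_le_one' ℝ)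
      (show r ∈ Set.Ici 0 from hr0) (show 0 ≤ 1 / (1 + Real.cos θ) by positivity)
      (show 0 ≤ Real.cos θ / (1 + Real.cos θ) by positivity) (by field_simp)
    simp only [smul_eq_mul, Real.one_rpow] at h1
    have e : 1 / (1 + Real.cos θ) * 1 + Real.cos θ / (1 + Real.cos θ) * r =
      (1 + r * Real.cos θ) / (1 + Real.cos θ) := by field_simp
    rw [e, Real.div_rpow (by positivity) hpos.le, div_le_iff₀ (by positivity)] at h1
    have h5 : (1 + Real.cos θ) ^ (p / 2) = (1 + Real.cos θ) ^ (p / 2 - 1) * (1 + Real.cos θ) := by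
      rw [← Real.rpow_add_one hpos.ne']; ring_nf
    have h6 : (1 + Real.cos θ) ^ (p / 2 - 1) ≤ 2 ^ (p / 2 - 1) :=
      Real.rpow_le_rpow hpos.le (by linarith [Real.cos_le_one θ]) (by linarith)
    have h7 : (1 / (1 + Real.cos θ) * 1 + Real.cos θ / (1 + Real.cos θ) * r ^ (p / 2)) *
        (1 + Real.cos θ) ^ (p / 2) = (1 + Real.cos θ) ^ (p / 2) * r ^ (p / 2) +
          (1 + Real.cos θ) ^ (p / 2 - 1) * (1 - r ^ (p / 2)) := by
      rw [h5]; field_simp; ring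
    rw [h7] at h1
    have h8 := mul_le_mul_of_nonneg_left hone hrq
    have h9 := mul_le_mul_of_nonneg_right (h6.trans hA1) (show 0 ≤ 1 - r ^ (p / 2) by linarith)
    nlinarith

theorem ConcaveOn.add_le_add_of_mem {f : ℝ → ℝ} {s : Set ℝ} (hf : ConcaveOn ℝ s f) {x y u v : ℝ}
    (hx : x ∈ s) (hy : y ∈ s) (hxu : x ≤ u) (huy : u ≤ y) (huv : u + v = x + y) :
    f x + f y ≤ f u + f v := by
  rcases (hxu.trans huy).eq_or_lt with h | h
  · have : u = x := by linarith
    have : v = y := by linarith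
    subst_vars; exact le_rfl
  have hyx : 0 < y - x := by linarith
  have h1 := hf.2 hx hy (show 0 ≤ (y - u) / (y - x) from div_nonneg (by linarith) hyx.le)
    (show 0 ≤ (u - x) / (y - x) from div_nonneg (by linarith) hyx.le) (by field_simp; ring)
  have h2 := hf.2 hx hy (show 0 ≤ (u - x) / (y - x) from div_nonneg (by linarith) hyx.le)
    (show 0 ≤ (y - u) / (y - x) from div_nonneg (by linarith) hyx.le) (by field_simp; ring)
  simp only [smul_eq_mul] at h1 h2
  have e1 : (y - u) / (y - x) * x + (u - x) / (y - x) * y = u := by field_simp; ring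
  have e2 : (u - x) / (y - x) * x + (y - u) / (y - x) * y = v := by
    field_simp; linear_combination (x - y) * huv
  have e3 : (y - u) / (y - x) + (u - x) / (y - x) = 1 := by field_simp; ring
  rw [e1] at h1
  rw [e2] at h2
  linear_combination h1 + h2 + (- f x - f y) * e3

theorem monotoneOn_mul_cos_sub {D q : ℝ} (hD1 : D ≤ 1) (hq0 : 0 ≤ q) (hq1 : q ≤ 1) :
    MonotoneOn (fun y => D * Real.cos (q * y) - q * Real.cos y) (Set.Icc 0 (Real.pi / 2)) := by
  have hd (y : ℝ) : HasDerivAt (fun y => D * Real.cos (q * y) - q * Real.cos y)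
      (q * (Real.sin y - D * Real.sin (q * y))) y := by
    have h2 : HasDerivAt (fun y => Real.cos (q * y)) (-Real.sin (q * y) * q) y := by
      simpa using ((hasDerivAt_id y).const_mul q).cos
    convert! (h2.const_mul D).sub ((Real.hasDerivAt_cos y).const_mul q) using 1
    ring
  refine monotoneOn_of_deriv_nonneg (convex_Icc _ _)
    (fun y _ => (hd y).continuousAt.continuousWithinAt)
    (fun y _ => (hd y).differentiableAt.differentiableWithinAt) fun y hy => ?_
  rw [interior_Icc] at hy
  rw [(hd y).deriv]
  have hy0 := hy.1
  have hqy : 0 ≤ q * y := mul_nonneg hq0 hy0.le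
  have hle : q * y ≤ y := mul_le_of_le_one_left hy0.le hq1
  have hs1 : Real.sin (q * y) ≤ Real.sin y :=
    Real.sin_le_sin_of_le_of_le_pi_div_two (by linarith [Real.pi_pos]) hy.2.le hle
  have hs2 : 0 ≤ Real.sin (q * y) :=
    Real.sin_nonneg_of_nonneg_of_le_pi hqy (by linarith [hy.2, Real.pi_pos])
  exact mul_nonneg hq0 (by linarith [mul_le_of_le_one_left hs2 hD1])

theorem one_sub_mul_cos_rpow_add_le {p : ℝ} (hp1 : 1 < p) (hp : p < 2) {θ r : ℝ}
    (hθ : θ ∈ Set.Icc 0 Real.pi) (hr : r ∈ Set.Icc (0 : ℝ) 1) :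
    (1 - r * Real.cos θ) ^ (p / 2) + 2 ^ (p / 2) * (Real.cos (Real.pi / (2 * p)) *
      Real.sin (Real.pi / (2 * p)) ^ (p - 1)) * r ^ (p / 2) * Real.cos (p / 2 * θ) ≤
      2 ^ (p / 2) * Real.sin (Real.pi / (2 * p)) ^ p := by
  have hpi := Real.pi_pos
  have hp0 : 0 < p := by linarith
  have hx₀ : Real.pi / 4 ≤ Real.pi / (2 * p) := by gcongr; linarith
  have hx₀' : Real.pi / (2 * p) ≤ Real.pi / 2 := by gcongr; linarith
  have hc₀ : 0 ≤ Real.cos (Real.pi / (2 * p)) :=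
    Real.cos_nonneg_of_mem_Icc ⟨by linarith, hx₀'⟩
  have hs₀ : 0 < Real.sin (Real.pi / (2 * p)) :=
    Real.sin_pos_of_pos_of_lt_pi (by linarith) (by linarith)
  set A := 2 ^ (p / 2) * Real.sin (Real.pi / (2 * p)) ^ p with hA
  set D := 2 ^ (p / 2) * (Real.cos (Real.pi / (2 * p)) *
      Real.sin (Real.pi / (2 * p)) ^ (p - 1)) with hD
  have hD0 : 0 ≤ D := by positivity
  have hD1 : D ≤ 1 := by
    have h1 : 1 ≤ 2 * Real.sin (Real.pi / (2 * p)) ^ 2 := by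
      have h := Real.cos_sq' (Real.pi / (2 * p))
      have h2 := Real.cos_two_mul (Real.pi / (2 * p))
      have : Real.cos (2 * (Real.pi / (2 * p))) ≤ 0 :=
        Real.cos_nonpos_of_pi_div_two_le_of_le (by linarith) (by linarith)
      linarith
    have h2 : (2 * Real.sin (Real.pi / (2 * p)) ^ 2) ^ (p / 2 - 1) ≤ 1 :=
      Real.rpow_le_one_of_one_le_of_nonpos h1 (by linarith)
    have h3 : D = Real.sin (2 * (Real.pi / (2 * p))) *
        (2 * Real.sin (Real.pi / (2 * p)) ^ 2) ^ (p / 2 - 1) := by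
      rw [show p / 2 - 1 = (p - 2) / 2 by ring, two_mul_sq_rpow_half hs₀.le, Real.sin_two_mul, hD]
      have e1 : (2 : ℝ) ^ (p / 2) = 2 ^ ((p - 2) / 2) * 2 := by
        rw [← Real.rpow_add_one two_ne_zero]; ring_nf
      have e2 : Real.sin (Real.pi / (2 * p)) ^ (p - 1) =
          Real.sin (Real.pi / (2 * p)) ^ (p - 2) * Real.sin (Real.pi / (2 * p)) := by
        rw [← Real.rpow_add_one hs₀.ne']; ring_nf
      rw [e1, e2]; ring
    rw [h3]
    have h4 : 0 ≤ (2 * Real.sin (Real.pi / (2 * p)) ^ 2) ^ (p / 2 - 1) := by positivity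
    have h5 := Real.sin_le_one (2 * (Real.pi / (2 * p)))
    nlinarith
  have hone : ∀ θ ∈ Set.Icc 0 Real.pi,
      (1 - Real.cos θ) ^ (p / 2) + D * Real.cos (p / 2 * θ) ≤ A := by
    intro θ hθ
    have hx : θ / 2 ∈ Set.Icc 0 (Real.pi / 2) := ⟨by linarith [hθ.1], by linarith [hθ.2]⟩
    have h := sin_rpow_add_le hp1 hp hx
    have hc : 0 ≤ Real.sin (θ / 2) :=
      Real.sin_nonneg_of_nonneg_of_le_pi hx.1 (by linarith [hx.2])
    have e1 : 1 - Real.cos θ = 2 * Real.sin (θ / 2) ^ 2 := by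
      have := Real.cos_two_mul (θ / 2)
      rw [mul_div_cancel₀ _ two_ne_zero, Real.cos_sq'] at this
      linarith
    have e2 : p * (θ / 2) = p / 2 * θ := by ring
    rw [e1, two_mul_sq_rpow_half hc]
    rw [e2] at h
    have := mul_le_mul_of_nonneg_left h (show (0 : ℝ) ≤ 2 ^ (p / 2) by positivity)
    rw [hA, hD]
    linarith
  have hhalf : 1 + D * Real.cos (p / 2 * (Real.pi / 2)) ≤ A := by
    simpa using hone (Real.pi / 2) ⟨by linarith, by linarith⟩
  have hjordan : 1 - p / 2 ≤ Real.cos (p / 2 * (Real.pi / 2)) := by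
    have := Real.one_sub_mul_le_cos (x := p / 2 * (Real.pi / 2)) (by positivity)
      (by nlinarith)
    have e : 2 / Real.pi * (p / 2 * (Real.pi / 2)) = p / 2 := by field_simp
    linarith
  have hA1 : 1 ≤ A := by nlinarith
  obtain ⟨hr0, hr1⟩ := hr
  have hrq : 0 ≤ r ^ (p / 2) := Real.rpow_nonneg hr0 _
  have hrq1 : r ^ (p / 2) ≤ 1 := Real.rpow_le_one hr0 hr1 (by linarith)
  rcases le_total (Real.cos θ) 0 with hc | hc
  · have hconc := Real.concaveOn_rpow (p := p / 2) (by linarith) (by linarith)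
    have hrc : r * Real.cos θ ≤ 0 := mul_nonpos_of_nonneg_of_nonpos hr0 hc
    have h1 := hconc.add_le_add_of_mem (x := r) (y := 1 - r * Real.cos θ) (u := 1)
      (v := r * (1 - Real.cos θ)) hr0 (show (0 : ℝ) ≤ _ by linarith) hr1 (by linarith) (by ring)
    rw [Real.one_rpow, Real.mul_rpow hr0 (by linarith)] at h1
    have h2 := mul_le_mul_of_nonneg_left (hone θ hθ) hrq
    nlinarith
  · have hθ2 : θ ≤ Real.pi / 2 := by
      by_contra! hcon
      linarith [Real.cos_neg_of_pi_div_two_lt_of_lt hcon (by linarith [hθ.2])]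
    set κ := Real.cos (p / 2 * θ) with hκ
    have hκ0 : 0 ≤ κ := Real.cos_nonneg_of_mem_Icc
      ⟨by nlinarith [hθ.1, mul_nonneg hp0.le hθ.1], by nlinarith [hθ.1]⟩
    have hκ1 : κ ≤ 1 := Real.cos_le_one _
    have hc1 := Real.cos_le_one θ
    have hrc : r * Real.cos θ ≤ 1 := mul_le_one₀ hr1 hc hc1
    have h1 : (1 - r * Real.cos θ) ^ (p / 2) ≤ 1 - p / 2 * (r * Real.cos θ) := by
      have := rpow_one_add_le_one_add_mul_self (s := -(r * Real.cos θ)) (by linarith)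
        (p := p / 2) (by linarith) (by linarith)
      simpa [← sub_eq_add_neg] using this
    have h2 : r ^ (p / 2) ≤ 1 + p / 2 * (r - 1) := by
      have := rpow_one_add_le_one_add_mul_self (s := r - 1) (by linarith)
        (p := p / 2) (by linarith) (by linarith)
      simpa using this
    have hDκ : 0 ≤ D * κ := by positivity
    have h3 : D * κ * r ^ (p / 2) ≤ D * κ * (1 + p / 2 * (r - 1)) :=
      mul_le_mul_of_nonneg_left h2 hDκ
    rcases le_total (D * κ) (Real.cos θ) with h | h
    · have h4 : p / 2 * r * (D * κ) ≤ p / 2 * r * Real.cos θ :=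
        mul_le_mul_of_nonneg_left h (by positivity)
      have h5 : (1 - p / 2) * (D * κ) ≤ (1 - p / 2) * D :=
        mul_le_mul_of_nonneg_left (by nlinarith) (by linarith)
      have h6 : D * (1 - p / 2) ≤ D * Real.cos (p / 2 * (Real.pi / 2)) :=
        mul_le_mul_of_nonneg_left hjordan hD0
      linear_combination h1 + h3 + h4 + h5 + h6 + hhalf
    · have hmono := monotoneOn_mul_cos_sub hD1 (show 0 ≤ p / 2 by positivity)
        (show p / 2 ≤ 1 by linarith)
      have h4 := hmono ⟨hθ.1, hθ2⟩ ⟨by linarith, le_rfl⟩ hθ2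
      simp only [Real.cos_pi_div_two, mul_zero, sub_zero] at h4
      have h5 : p / 2 * ((1 - r) * (D * κ - Real.cos θ)) ≥ 0 :=
        mul_nonneg (by linarith) (mul_nonneg (by linarith) (by linarith))
      linear_combination h1 + h3 + h5 + h4 + hhalf

/-- The function of homogeneity degree `q` with angular profile `φ (|arg w|)`. -/
noncomputable def angular (q : ℝ) (φ : ℝ → ℝ) (w : ℂ) : ℝ := ‖w‖ ^ q * φ |w.arg|

theorem continuousAt_abs_arg {w : ℂ} (hw : w ≠ 0) : ContinuousAt (fun z : ℂ => |z.arg|) w := by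
  have h : ContinuousAt (fun z : ℂ => InnerProductGeometry.angle (1 : ℂ) z) w :=
    ContinuousAt.comp (f := fun z : ℂ => ((1 : ℂ), z))
      (InnerProductGeometry.continuousAt_angle one_ne_zero hw) (by fun_prop)
  refine h.congr ?_
  filter_upwards [isOpen_ne.mem_nhds hw] with z hz using Complex.angle_one_left hz

theorem continuous_angular {q : ℝ} (hq : 0 < q) {φ : ℝ → ℝ} (hφ : Continuous φ)
    (hb : ∀ x, |φ x| ≤ 1) : Continuous (angular q φ) := by
  rw [continuous_iff_continuousAt]
  intro w
  have hn : Continuous fun z : ℂ => ‖z‖ ^ q := continuous_norm.rpow_const fun _ => Or.inr hq.le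
  rcases eq_or_ne w 0 with rfl | hw
  · have h0 : angular q φ 0 = 0 := by simp [angular, Real.zero_rpow hq.ne']
    rw [ContinuousAt, h0]
    have h1 : Tendsto (fun z : ℂ => ‖z‖ ^ q) (𝓝 0) (𝓝 0) := by
      simpa [Real.zero_rpow hq.ne'] using hn.tendsto 0
    refine squeeze_zero_norm (fun z => ?_) h1
    rw [angular, Real.norm_eq_abs, abs_mul, abs_of_nonneg (by positivity)]
    exact mul_le_of_le_one_right (by positivity) (hb _)
  · exact hn.continuousAt.mul (hφ.continuousAt.comp (continuousAt_abs_arg hw))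

theorem angular_smul {q : ℝ} {φ : ℝ → ℝ} {c : ℝ} (hc : 0 < c) (w : ℂ) :
    angular q φ (c * w) = c ^ q * angular q φ w := by
  rw [angular, angular, Complex.arg_real_mul _ hc, norm_mul, Complex.norm_real, Real.norm_eq_abs,
    abs_of_pos hc, Real.mul_rpow hc.le (norm_nonneg _), mul_assoc]

theorem differentiableAt_cpow_eventually {q : ℂ} {w : ℂ} (hw : w ∈ Complex.slitPlane) :
    ∀ᶠ z in 𝓝 w, DifferentiableAt ℂ (fun z : ℂ => z ^ q) z := by
  filter_upwards [Complex.isOpen_slitPlane.mem_nhds hw] with z hz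
  exact differentiableAt_id.cpow_const hz

theorem hasHolomorphicSupport_angular_cos_min {q : ℝ} (hq : 1 ≤ q) {w : ℂ} (hw : w ≠ 0) :
    HasHolomorphicSupport (angular q fun θ => -Real.cos (q * min θ (Real.pi / q))) w := by
  have hpi := Real.pi_pos
  have hq0 : 0 < q := by linarith
  have hpq : Real.pi / q ≤ Real.pi := div_le_self hpi.le hq
  rcases lt_or_ge |w.arg| (Real.pi / q) with h | h
  · have key : ∀ z : ℂ, |z.arg| < Real.pi / q → (-(z ^ (q : ℂ))).re =
        angular q (fun θ => -Real.cos (q * min θ (Real.pi / q))) z := by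
      intro z hz
      rw [Complex.neg_re, Complex.cpow_ofReal_re, angular, min_eq_left hz.le,
        ← Real.cos_abs (z.arg * q), abs_mul, abs_of_pos hq0]
      ring_nf
    have hslit : w ∈ Complex.slitPlane := by
      rw [Complex.mem_slitPlane_iff_arg]
      refine ⟨fun h' => ?_, hw⟩
      rw [h', abs_of_pos hpi] at h
      linarith
    refine ⟨fun z => -(z ^ (q : ℂ)), ?_, ?_, key w h⟩
    · filter_upwards [differentiableAt_cpow_eventually hslit] with z hz using hz.neg
    · filter_upwards [(continuousAt_abs_arg hw).eventually (gt_mem_nhds h)] with z hz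
        using (key z hz).le
  · have hdiv : ContinuousAt (fun z : ℂ => z / w) w := continuousAt_id.div_const w
    have h1 : (fun z : ℂ => z / w) w = 1 := div_self hw
    have hre : ∀ z : ℂ, z ≠ 0 → (((‖w‖ ^ q : ℝ) : ℂ) * (z / w) ^ (q : ℂ)).re =
        ‖z‖ ^ q * Real.cos (q * |(z / w).arg|) := by
      intro z hz
      have hwn : 0 < ‖w‖ := norm_pos_iff.2 hw
      rw [Complex.re_ofReal_mul, Complex.cpow_ofReal_re, norm_div,
        Real.div_rpow (norm_nonneg _) (norm_nonneg _), ← Real.cos_abs ((z / w).arg * q), abs_mul,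
        abs_of_pos hq0]
      have : ‖w‖ ^ q ≠ 0 := (Real.rpow_pos_of_pos hwn q).ne'
      field_simp
    refine ⟨fun z => ((‖w‖ ^ q : ℝ) : ℂ) * (z / w) ^ (q : ℂ), ?_, ?_, ?_⟩
    · have hs : ∀ᶠ z in 𝓝 w, z / w ∈ Complex.slitPlane :=
        hdiv.eventually (h1 ▸ Complex.isOpen_slitPlane.mem_nhds Complex.one_mem_slitPlane)
      filter_upwards [hs] with z hz
      exact ((differentiableAt_id.div_const w).cpow_const hz).const_mul _
    · have hA : ContinuousAt (fun z : ℂ => |(z / w).arg|) w :=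
        ContinuousAt.comp (f := fun z : ℂ => z / w) (g := fun z : ℂ => |z.arg|)
          (continuousAt_abs_arg (by simp [hw])) hdiv
      have hA0 : |(w / w).arg| = 0 := by simp [hw]
      have hlt : ∀ᶠ z in 𝓝 w, |(z / w).arg| < Real.pi / q :=
        hA.eventually (gt_mem_nhds (by simp only [hA0]; positivity))
      filter_upwards [hlt, isOpen_ne.mem_nhds hw] with z hz hz0
      rw [hre z hz0, angular]
      refine mul_le_mul_of_nonneg_left ?_ (by positivity)
      have htri := InnerProductGeometry.angle_le_angle_add_angle (1 : ℂ) z w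
      rw [Complex.angle_one_left hw, Complex.angle_one_left hz0, Complex.angle_eq_abs_arg hz0 hw]
        at htri
      have hmin : Real.pi / q - |(z / w).arg| ≤ min |z.arg| (Real.pi / q) :=
        le_min (by linarith) (by linarith [abs_nonneg (z / w).arg])
      have hm1 := mul_le_mul_of_nonneg_left hmin hq0.le
      have hm2 := mul_le_mul_of_nonneg_left (min_le_right |z.arg| (Real.pi / q)) hq0.le
      have e : q * (Real.pi / q) = Real.pi := by field_simp
      rw [e] at hm2
      rw [mul_sub, e] at hm1
      have hm3 : q * |(z / w).arg| ≤ Real.pi := by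
        rw [← e]; exact mul_le_mul_of_nonneg_left hz.le hq0.le
      have := Real.cos_le_cos_of_nonneg_of_le_pi (by linarith) hm2 hm1
      rw [Real.cos_pi_sub] at this
      linarith
    · rw [hre w hw, angular, min_eq_right h]
      have e : q * (Real.pi / q) = Real.pi := by field_simp
      simp [e, hw]

theorem abs_arg_neg_eq {w : ℂ} (hw : w ≠ 0) : |(-w).arg| = Real.pi - |w.arg| := by
  rw [← Complex.angle_one_left (neg_ne_zero.2 hw), InnerProductGeometry.angle_neg_right,
    Complex.angle_one_left hw]

theorem hasHolomorphicSupport_angular_cos_pi_sub {q : ℝ} (hq0 : 0 < q) (hq1 : q < 1) {w : ℂ}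
    (hw : w ≠ 0) :
    HasHolomorphicSupport (angular q fun θ => Real.cos (q * (Real.pi - θ))) w := by
  have hpi := Real.pi_pos
  by_cases hslit : -w ∈ Complex.slitPlane
  · have key : ∀ z : ℂ, z ≠ 0 → ((-z) ^ (q : ℂ)).re =
        angular q (fun θ => Real.cos (q * (Real.pi - θ))) z := by
      intro z hz
      rw [Complex.cpow_ofReal_re, angular, ← abs_arg_neg_eq hz,
        ← Real.cos_abs ((-z).arg * q), abs_mul, abs_of_pos hq0, norm_neg]
      ring_nf
    refine ⟨fun z => (-z) ^ (q : ℂ), ?_, ?_, key w hw⟩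
    · filter_upwards [(continuous_neg.continuousAt (x := w)).eventually
        (Complex.isOpen_slitPlane.mem_nhds hslit)] with z hz
      exact (differentiableAt_id.neg).cpow_const hz
    · filter_upwards [isOpen_ne.mem_nhds hw] with z hz using (key z hz).le
  · have harg : w.arg = 0 := by
      rw [Complex.mem_slitPlane_iff_arg, not_and_or, not_not, not_not] at hslit
      rcases hslit with h | h
      · have := abs_arg_neg_eq hw
        rw [h, abs_of_pos hpi] at this
        exact abs_eq_zero.1 (by linarith)
      · exact absurd (neg_eq_zero.1 h) hw
    have hws : w ∈ Complex.slitPlane := by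
      rw [Complex.mem_slitPlane_iff_arg, harg]
      exact ⟨hpi.ne, hw⟩
    have hre : ∀ z : ℂ, (((Real.cos (q * Real.pi) : ℝ) : ℂ) * z ^ (q : ℂ)).re =
        ‖z‖ ^ q * (Real.cos (q * Real.pi) * Real.cos (q * |z.arg|)) := by
      intro z
      rw [Complex.re_ofReal_mul, Complex.cpow_ofReal_re, ← Real.cos_abs (z.arg * q), abs_mul,
        abs_of_pos hq0]
      ring_nf
    refine ⟨fun z => ((Real.cos (q * Real.pi) : ℝ) : ℂ) * z ^ (q : ℂ), ?_, ?_, ?_⟩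
    · filter_upwards [differentiableAt_cpow_eventually hws] with z hz using hz.const_mul _
    · refine Eventually.of_forall fun z => ?_
      rw [hre, angular]
      refine mul_le_mul_of_nonneg_left ?_ (by positivity)
      rw [mul_sub, Real.cos_sub]
      have h1 : 0 ≤ Real.sin (q * Real.pi) :=
        Real.sin_nonneg_of_nonneg_of_le_pi (by positivity) (by nlinarith)
      have h2 : 0 ≤ Real.sin (q * |z.arg|) :=
        Real.sin_nonneg_of_nonneg_of_le_pi (by positivity)
          (by nlinarith [Complex.abs_arg_le_pi z, abs_nonneg z.arg])
      nlinarith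
    · rw [hre, angular, harg]
      simp

theorem rieszConstant_rpow_of_two_le {p : ℝ} (hp : 2 ≤ p) :
    rieszConstant p ^ p = 2 ^ (p / 2) * Real.cos (Real.pi / (2 * p)) ^ p := by
  have hpi := Real.pi_pos
  have hx : 0 < Real.pi / (2 * p) := by positivity
  have hx' : Real.pi / (2 * p) ≤ Real.pi / 4 := by gcongr; linarith
  have h1 : Real.sin (Real.pi / (2 * p)) ≤ Real.cos (Real.pi / (2 * p)) := by
    rw [← Real.cos_pi_div_two_sub]
    exact Real.cos_le_cos_of_nonneg_of_le_pi hx.le (by linarith) (by linarith)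
  have h2 : 0 ≤ Real.cos (Real.pi / (2 * p)) :=
    Real.cos_nonneg_of_mem_Icc ⟨by linarith, by linarith⟩
  rw [rieszConstant, max_eq_right h1, Real.mul_rpow (Real.sqrt_nonneg _) h2,
    Real.sqrt_eq_rpow, ← Real.rpow_mul two_pos.le]
  ring_nf

theorem rieszConstant_rpow_of_lt_two {p : ℝ} (hp1 : 1 < p) (hp : p < 2) :
    rieszConstant p ^ p = 2 ^ (p / 2) * Real.sin (Real.pi / (2 * p)) ^ p := by
  have hpi := Real.pi_pos
  have hx : Real.pi / 4 ≤ Real.pi / (2 * p) := by gcongr; linarith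
  have hx' : Real.pi / (2 * p) ≤ Real.pi / 2 := by gcongr; linarith
  have h1 : Real.cos (Real.pi / (2 * p)) ≤ Real.sin (Real.pi / (2 * p)) := by
    rw [← Real.cos_pi_div_two_sub]
    exact Real.cos_le_cos_of_nonneg_of_le_pi (by linarith) (by linarith) (by linarith)
  have h2 : 0 ≤ Real.sin (Real.pi / (2 * p)) :=
    Real.sin_nonneg_of_nonneg_of_le_pi (by linarith) (by linarith)
  rw [rieszConstant, max_eq_left h1, Real.mul_rpow (Real.sqrt_nonneg _) h2,
    Real.sqrt_eq_rpow, ← Real.rpow_mul two_pos.le]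
  ring_nf

/-- Homogenization of a two-variable trigonometric inequality. -/
theorem add_two_re_rpow_le_of_profile {q A D : ℝ} (hq : 0 < q) {φ : ℝ → ℝ}
    (h : ∀ θ ∈ Set.Icc 0 Real.pi, ∀ r ∈ Set.Icc (0 : ℝ) 1,
      (1 + r * Real.cos θ) ^ q + D * r ^ q * φ θ ≤ A) {R : ℝ} {w : ℂ} (hR : 2 * ‖w‖ ≤ R) :
    (R + 2 * w.re) ^ q ≤ A * R ^ q - D * 2 ^ q * angular q φ w := by
  have hw := norm_nonneg w
  rcases (show 0 ≤ R by linarith).eq_or_lt with h0 | h0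
  · have : w = 0 := norm_eq_zero.1 (by linarith)
    subst this
    simp [← h0, angular, Real.zero_rpow hq.ne']
  set r := 2 * ‖w‖ / R with hr
  have hr0 : 0 ≤ r := by positivity
  have hr1 : r ≤ 1 := (div_le_one h0).2 hR
  have key := h |w.arg| ⟨abs_nonneg _, Complex.abs_arg_le_pi w⟩ r ⟨hr0, hr1⟩
  rw [Real.cos_abs] at key
  have hre : w.re = ‖w‖ * Real.cos w.arg := (Complex.norm_mul_cos_arg w).symm
  have e1 : R + 2 * w.re = R * (1 + r * Real.cos w.arg) := by
    rw [hre, hr]; field_simp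
  have hnn : 0 ≤ 1 + r * Real.cos w.arg := by
    nlinarith [Real.neg_one_le_cos w.arg]
  have e2 : R ^ q * r ^ q = 2 ^ q * ‖w‖ ^ q := by
    rw [← Real.mul_rpow h0.le hr0, ← Real.mul_rpow two_pos.le hw, hr]
    congr 1
    field_simp
  rw [e1, Real.mul_rpow h0.le hnn, angular]
  have := mul_le_mul_of_nonneg_left key (Real.rpow_nonneg h0.le q)
  linear_combination this - D * φ |w.arg| * e2

/-- The comparison function behind the sharp inequality. -/
theorem exists_comparison_function {p : ℝ} (hp : 1 < p) :
    ∃ (Φ : ℂ → ℝ) (D : ℝ), 0 ≤ D ∧ Continuous Φ ∧ (∀ w ≠ 0, HasHolomorphicSupport Φ w) ∧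
      (∀ c : ℝ, 0 < c → ∀ w : ℂ, Φ (c * w) = c ^ (p / 2) * Φ w) ∧
      (∀ w : ℂ, w.re ≤ 0 → 0 ≤ Φ w) ∧ Φ 0 = 0 ∧ Φ 1 < 0 ∧
      ∀ (R : ℝ) (w : ℂ), 2 * ‖w‖ ≤ R →
        (R + 2 * w.re) ^ (p / 2) ≤ rieszConstant p ^ p * R ^ (p / 2) - D * Φ w := by
  have hpi := Real.pi_pos
  have hp0 : 0 < p := by linarith
  have hq : 0 < p / 2 := by linarith
  have hangle : ∀ w : ℂ, w.re ≤ 0 → w ≠ 0 → Real.pi / 2 ≤ |w.arg| := by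
    intro w hw hw0
    by_contra! hcon
    rcases Complex.abs_arg_lt_pi_div_two_iff.1 hcon with h | h
    · linarith
    · exact hw0 h
  rcases le_or_gt 2 p with h2 | h2
  · set x₀ := Real.pi / (2 * p) with hx₀
    have hx₀0 : 0 < x₀ := by positivity
    have hx₀' : x₀ ≤ Real.pi / 2 := by rw [hx₀]; gcongr; linarith
    have hc₀ : 0 ≤ Real.cos x₀ := Real.cos_nonneg_of_mem_Icc ⟨by linarith, hx₀'⟩
    have hs₀ : 0 ≤ Real.sin x₀ := Real.sin_nonneg_of_nonneg_of_le_pi hx₀0.le (by linarith)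
    refine ⟨angular (p / 2) fun θ => -Real.cos (p / 2 * min θ (Real.pi / (p / 2))),
      2 ^ (p / 2) * (Real.sin x₀ * Real.cos x₀ ^ (p - 1)) * 2 ^ (p / 2), by positivity,
      continuous_angular hq (by fun_prop) (fun x => by rw [abs_neg]; exact Real.abs_cos_le_one _),
      fun w hw => hasHolomorphicSupport_angular_cos_min (by linarith) hw,
      fun c hc w => angular_smul hc w, ?_, ?_, ?_, ?_⟩
    · intro w hw
      rcases eq_or_ne w 0 with rfl | hw0
      · simp [angular, Real.zero_rpow hq.ne']
      have ha := hangle w hw hw0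
      refine mul_nonneg (by positivity) (neg_nonneg.2 ?_)
      refine Real.cos_nonpos_of_pi_div_two_le_of_le ?_ ?_
      · rcases min_choice |w.arg| (Real.pi / (p / 2)) with h | h <;> rw [h]
        · nlinarith
        · field_simp; norm_num
      · have := mul_le_mul_of_nonneg_left (min_le_right |w.arg| (Real.pi / (p / 2))) hq.le
        rw [mul_div_cancel₀ _ hq.ne'] at this
        linarith
    · simp [angular, Real.zero_rpow hq.ne']
    · simp [angular, (show (0 : ℝ) ≤ Real.pi / (p / 2) by positivity)]
    · intro R w hR
      rw [rieszConstant_rpow_of_two_le h2]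
      refine add_two_re_rpow_le_of_profile hq (fun θ hθ r hr => ?_) hR
      have := one_add_mul_cos_rpow_sub_le h2 hθ hr
      rw [show Real.pi / (p / 2) = 2 * Real.pi / p by field_simp]
      linarith
  · set x₀ := Real.pi / (2 * p) with hx₀
    have hx₀0 : 0 < x₀ := by positivity
    have hx₀' : x₀ ≤ Real.pi / 2 := by rw [hx₀]; gcongr; linarith
    have hc₀ : 0 ≤ Real.cos x₀ := Real.cos_nonneg_of_mem_Icc ⟨by linarith, hx₀'⟩
    have hs₀ : 0 ≤ Real.sin x₀ := Real.sin_nonneg_of_nonneg_of_le_pi hx₀0.le (by linarith)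
    refine ⟨angular (p / 2) fun θ => Real.cos (p / 2 * (Real.pi - θ)),
      2 ^ (p / 2) * (Real.cos x₀ * Real.sin x₀ ^ (p - 1)) * 2 ^ (p / 2), by positivity,
      continuous_angular hq (by fun_prop) (fun x => Real.abs_cos_le_one _),
      fun w hw => hasHolomorphicSupport_angular_cos_pi_sub hq (by linarith) hw,
      fun c hc w => angular_smul hc w, ?_, ?_, ?_, ?_⟩
    · intro w hw
      rcases eq_or_ne w 0 with rfl | hw0
      · simp [angular, Real.zero_rpow hq.ne']
      have ha := hangle w hw hw0
      have hb := Complex.abs_arg_le_pi w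
      have h3 : 0 ≤ p / 2 * (Real.pi - |w.arg|) := mul_nonneg hq.le (by linarith)
      refine mul_nonneg (by positivity) (Real.cos_nonneg_of_mem_Icc ⟨by linarith, ?_⟩)
      nlinarith
    · simp [angular, Real.zero_rpow hq.ne']
    · have : Real.cos (p / 2 * Real.pi) < 0 :=
        Real.cos_neg_of_pi_div_two_lt_of_lt (by nlinarith) (by nlinarith)
      simpa [angular] using this
    · intro R w hR
      rw [rieszConstant_rpow_of_lt_two hp h2]
      refine add_two_re_rpow_le_of_profile hq (fun θ hθ r hr => ?_) hR
      have := one_sub_mul_cos_rpow_add_le (θ := Real.pi - θ) hp h2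
        ⟨by linarith [hθ.2], by linarith [hθ.1]⟩ hr
      rw [Real.cos_pi_sub, mul_neg, sub_neg_eq_add] at this
      exact this

theorem HasHolomorphicSupport.comp {Φ : ℂ → ℝ} {u : ℂ → ℂ} {z : ℂ}
    (h : HasHolomorphicSupport Φ (u z)) (hu : ∀ᶠ w in 𝓝 z, DifferentiableAt ℂ u w) :
    HasHolomorphicSupport (fun w => Φ (u w)) z := by
  obtain ⟨H, hd, hle, he⟩ := h
  have hc : ContinuousAt u z := hu.self_of_nhds.continuousAt
  refine ⟨fun w => H (u w), ?_, hc.eventually hle, he⟩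
  filter_upwards [hu, hc.eventually hd] with w hw1 hw2 using hw2.comp w hw1

theorem DifferentiableOn.eventually_differentiableAt_ball {u : ℂ → ℂ}
    (hu : DifferentiableOn ℂ u (Metric.ball 0 1)) {z : ℂ} (hz : z ∈ Metric.ball (0 : ℂ) 1) :
    ∀ᶠ w in 𝓝 z, DifferentiableAt ℂ u w := by
  filter_upwards [Metric.isOpen_ball.mem_nhds hz] with w hw
  exact (hu w hw).differentiableAt (Metric.isOpen_ball.mem_nhds hw)

theorem le_integral_comp_of_hasHolomorphicSupport {Φ : ℂ → ℝ} (hΦ : Continuous Φ)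
    (hs : ∀ w ≠ 0, HasHolomorphicSupport Φ w) {u : ℂ → ℂ}
    (hu : DifferentiableOn ℂ u (Metric.ball 0 1)) {r : ℝ} (hr0 : 0 ≤ r) (hr1 : r < 1) :
    Φ (u 0) ≤ ∫ t, Φ (u (circleMap 0 r t)) ∂circleSigma := by
  by_cases hne : ∃ z ∈ Metric.ball (0 : ℂ) 1, u z ≠ 0
  · have h := integral_circleMap_mono_of_hasHolomorphicSupport (U := fun z => Φ (u z)) le_rfl hr0 hr1
      (hΦ.comp_continuousOn (hu.continuousOn.mono (Metric.closedBall_subset_ball hr1))) hu hne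
      fun z hz hz0 => (hs _ hz0).comp
        (hu.eventually_differentiableAt_ball (Metric.ball_subset_ball hr1.le hz))
    simpa using h
  · push Not at hne
    have h1 : ∀ t, u (circleMap 0 r t) = u 0 := fun t => by
      rw [hne 0 (by simp), hne]
      exact Metric.closedBall_subset_ball hr1
        (Metric.sphere_subset_closedBall (circleMap_mem_sphere 0 hr0 t))
    simp [h1]

theorem norm_add_conj_sq (z w : ℂ) :
    ‖z + conj w‖ ^ 2 = ‖z‖ ^ 2 + ‖w‖ ^ 2 + 2 * (z * w).re := by
  rw [← Complex.normSq_eq_norm_sq, ← Complex.normSq_eq_norm_sq, ← Complex.normSq_eq_norm_sq,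
    Complex.normSq_apply, Complex.normSq_apply, Complex.normSq_apply]
  simp
  ring

theorem sq_rpow_half {x p : ℝ} (hx : 0 ≤ x) : (x ^ 2) ^ (p / 2) = x ^ p := by
  rw [← Real.rpow_natCast x 2, ← Real.rpow_mul hx]
  congr 1
  push_cast; ring

theorem two_mul_norm_mul_le (z w : ℂ) : 2 * ‖z * w‖ ≤ ‖z‖ ^ 2 + ‖w‖ ^ 2 := by
  rw [norm_mul]
  nlinarith [sq_nonneg (‖z‖ - ‖w‖)]

theorem continuousOn_sphere_of_lt_one {E : Type*} [TopologicalSpace E] {F : ℂ → E}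
    (hF : ContinuousOn F (Metric.ball 0 1))
    {r : ℝ} (hr1 : r < 1) : ContinuousOn F (Metric.sphere 0 r) :=
  hF.mono (Metric.sphere_subset_closedBall.trans (Metric.closedBall_subset_ball hr1))

/-- The sharp inequality on circles of radius less than one. -/
theorem integral_norm_rpow_le_sharp {p : ℝ} (hp : 1 < p) {g h : ℂ → ℂ}
    (hg : DifferentiableOn ℂ g (Metric.ball 0 1)) (hh : DifferentiableOn ℂ h (Metric.ball 0 1))
    (h0 : (g 0 * h 0).re ≤ 0) {r : ℝ} (hr0 : 0 ≤ r) (hr1 : r < 1) :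
    ∫ t, ‖g (circleMap 0 r t) + conj (h (circleMap 0 r t))‖ ^ p ∂circleSigma ≤
      rieszConstant p ^ p *
        ∫ t, (‖g (circleMap 0 r t)‖ ^ 2 + ‖h (circleMap 0 r t)‖ ^ 2) ^ (p / 2) ∂circleSigma := by
  obtain ⟨Φ, D, hD, hΦ, hs, -, hpos, -, -, hle⟩ := exists_comparison_function hp
  have hq : 0 ≤ p / 2 := by linarith
  have hgc := hg.continuousOn
  have hhc := hh.continuousOn
  have hΦi := (hpos _ h0).trans (le_integral_comp_of_hasHolomorphicSupport hΦ hs (hg.mul hh) hr0 hr1)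
  have i1 : Integrable (fun t => (‖g (circleMap 0 r t)‖ ^ 2 + ‖h (circleMap 0 r t)‖ ^ 2) ^ (p / 2))
      circleSigma :=
    integrable_circleMap_of_continuousOn (U := fun z => (‖g z‖ ^ 2 + ‖h z‖ ^ 2) ^ (p / 2)) hr0
      (continuousOn_sphere_of_lt_one
        (((hgc.norm.pow 2).add (hhc.norm.pow 2)).rpow_const fun _ _ => Or.inr hq) hr1)
  have i2 : Integrable (fun t => Φ ((g * h) (circleMap 0 r t))) circleSigma :=
    integrable_circleMap_of_continuousOn (U := fun z => Φ ((g * h) z)) hr0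
      (continuousOn_sphere_of_lt_one (hΦ.comp_continuousOn (hgc.mul hhc)) hr1)
  have i3 : Integrable (fun t => ‖g (circleMap 0 r t) + conj (h (circleMap 0 r t))‖ ^ p)
      circleSigma :=
    integrable_circleMap_of_continuousOn (U := fun z => ‖g z + conj (h z)‖ ^ p) hr0
      (continuousOn_sphere_of_lt_one
        ((hgc.add (Complex.continuous_conj.comp_continuousOn hhc)).norm.rpow_const
          fun _ _ => Or.inr (by linarith)) hr1)
  calc _ ≤ ∫ t, (rieszConstant p ^ p *
        (‖g (circleMap 0 r t)‖ ^ 2 + ‖h (circleMap 0 r t)‖ ^ 2) ^ (p / 2) -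
          D * Φ ((g * h) (circleMap 0 r t))) ∂circleSigma := by
        refine integral_mono i3 ((i1.const_mul _).sub (i2.const_mul _)) fun t => ?_
        simp only [Pi.mul_apply]
        rw [← sq_rpow_half (norm_nonneg _), norm_add_conj_sq]
        exact hle _ _ (two_mul_norm_mul_le _ _)
    _ = rieszConstant p ^ p *
        ∫ t, (‖g (circleMap 0 r t)‖ ^ 2 + ‖h (circleMap 0 r t)‖ ^ 2) ^ (p / 2) ∂circleSigma -
        D * ∫ t, Φ ((g * h) (circleMap 0 r t)) ∂circleSigma := by
        rw [integral_sub (i1.const_mul _) (i2.const_mul _), integral_const_mul, integral_const_mul]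
    _ ≤ _ := by
        have := mul_nonneg hD hΦi
        linarith

/-- On a compact set, a positive multiple of a nonnegative function dominates a function that is
positive on its zero set. -/
theorem IsCompact.exists_mul_add_pos {X : Type*} [TopologicalSpace X] [T2Space X] {S : Set X}
    (hS : IsCompact S) {a b : X → ℝ} (ha : ContinuousOn a S) (hb : ContinuousOn b S)
    (ha0 : ∀ x ∈ S, 0 ≤ a x) (hab : ∀ x ∈ S, a x = 0 → 0 < b x) :
    ∃ K ε : ℝ, 0 < ε ∧ 0 ≤ K ∧ ∀ x ∈ S, ε ≤ K * a x + b x := by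
  have key : ∃ K : ℝ, 0 ≤ K ∧ ∀ x ∈ S, 0 < K * a x + b x := by
    obtain ⟨B, hB⟩ := hS.exists_bound_of_continuousOn hb
    have hT : IsCompact {x ∈ S | b x ≤ 0} :=
      hS.of_isClosed_subset (hb.preimage_isClosed_of_isClosed hS.isClosed isClosed_Iic)
        Set.inter_subset_left
    rcases Set.eq_empty_or_nonempty {x ∈ S | b x ≤ 0} with hT0 | hT0
    · refine ⟨0, le_rfl, fun x hx => ?_⟩
      by_contra! hcon
      have : x ∈ {x ∈ S | b x ≤ 0} := ⟨hx, by linarith⟩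
      simp [hT0] at this
    · obtain ⟨y, hy, hmin⟩ := hT.exists_isMinOn hT0 (ha.mono (Set.sep_subset _ _))
      have hay : 0 < a y := by
        refine (ha0 y hy.1).lt_of_ne fun h => ?_
        exact absurd (hab y hy.1 h.symm) (not_lt.2 hy.2)
      have hB0 : 0 ≤ B := (norm_nonneg _).trans (hB y hy.1)
      refine ⟨(B + 1) / a y, by positivity, fun x hx => ?_⟩
      rcases lt_or_ge 0 (b x) with h | h
      · have := mul_nonneg (show 0 ≤ (B + 1) / a y by positivity) (ha0 x hx)
        linarith
      · have h1 : a y ≤ a x := hmin ⟨hx, h⟩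
        have h2 : (B + 1) / a y * a y ≤ (B + 1) / a y * a x :=
          mul_le_mul_of_nonneg_left h1 (by positivity)
        rw [div_mul_cancel₀ _ hay.ne'] at h2
        have h3 := neg_le_of_abs_le (hB x hx)
        linarith
  obtain ⟨K, hK, hpos⟩ := key
  rcases S.eq_empty_or_nonempty with rfl | hne
  · exact ⟨K, 1, one_pos, hK, by simp⟩
  · obtain ⟨y, hy, hmin⟩ := hS.exists_isMinOn hne ((continuousOn_const.mul ha).add hb)
    exact ⟨K, K * a y + b y, hpos y hy, hK, fun x hx => hmin hx⟩

theorem exists_riesz_comparison {p : ℝ} (hp : 1 < p) :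
    ∃ (Φ : ℂ → ℝ) (K : ℝ), Continuous Φ ∧ (∀ w ≠ 0, HasHolomorphicSupport Φ w) ∧ Φ 0 = 0 ∧
      0 ≤ K ∧ ∀ z w : ℂ, ‖z‖ ^ p + ‖w‖ ^ p + Φ (-(z * w)) ≤ K * ‖z + conj w‖ ^ p := by
  have hp0 : 0 < p := by linarith
  obtain ⟨Φ, D, -, hΦ, hs, hhom, -, hΦ0, hΦ1, -⟩ := exists_comparison_function hp
  have hcomp : IsCompact (Metric.sphere (0 : ℂ × ℂ) 1) := isCompact_sphere _ _
  have hac : Continuous fun x : ℂ × ℂ => ‖x.1 + conj x.2‖ ^ p :=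
    (continuous_fst.add (Complex.continuous_conj.comp continuous_snd)).norm.rpow_const
      fun _ => Or.inr hp0.le
  have hbc : Continuous fun x : ℂ × ℂ => -Φ (-(x.1 * x.2)) := by fun_prop
  obtain ⟨K, ε, hε, hK, hKε⟩ := hcomp.exists_mul_add_pos hac.continuousOn hbc.continuousOn
    (fun x _ => by positivity) (by
      rintro ⟨z, w⟩ hx h
      simp only at h ⊢
      have h0 : z + conj w = 0 := norm_eq_zero.1 ((Real.rpow_eq_zero (norm_nonneg _) hp0.ne').1 h)
      have hz : z = -conj w := eq_neg_of_add_eq_zero_left h0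
      have hn : ‖w‖ = 1 := by
        have : ‖((z, w) : ℂ × ℂ)‖ = 1 := by simpa using hx
        rw [Prod.norm_mk, hz, norm_neg, RCLike.norm_conj, max_self] at this
        exact this
      have : -(z * w) = 1 := by
        rw [hz, neg_mul, neg_neg, mul_comm, Complex.mul_conj, Complex.normSq_eq_norm_sq, hn]
        simp
      rw [this]
      linarith)
  have hpt : ∀ z w : ℂ, ‖z‖ ^ p + ‖w‖ ^ p ≤ 2 / ε * (K * ‖z + conj w‖ ^ p - Φ (-(z * w))) := by
    intro z w
    rcases eq_or_ne ((z, w) : ℂ × ℂ) 0 with h0 | h0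
    · obtain ⟨rfl, rfl⟩ := Prod.mk_eq_zero.1 h0
      simp [Real.zero_rpow hp0.ne', hΦ0]
    set c := ‖((z, w) : ℂ × ℂ)‖ with hc
    have hc0 : 0 < c := norm_pos_iff.2 h0
    have hmem : (((c⁻¹ : ℝ) : ℂ) * z, ((c⁻¹ : ℝ) : ℂ) * w) ∈ Metric.sphere (0 : ℂ × ℂ) 1 := by
      have : ((((c⁻¹ : ℝ) : ℂ) * z, ((c⁻¹ : ℝ) : ℂ) * w) : ℂ × ℂ) = c⁻¹ • (z, w) := by
        simp [Prod.smul_mk]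
      rw [mem_sphere_zero_iff_norm, this, norm_smul, ← hc]
      simp [abs_of_pos hc0, hc0.ne']
    have hy := hKε _ hmem
    simp only at hy
    have e1 : ((c⁻¹ : ℝ) : ℂ) * z + conj (((c⁻¹ : ℝ) : ℂ) * w) = ((c⁻¹ : ℝ) : ℂ) * (z + conj w) := by
      rw [map_mul, Complex.conj_ofReal]; ring
    have e2 : -(((c⁻¹ : ℝ) : ℂ) * z * (((c⁻¹ : ℝ) : ℂ) * w)) =
        (((c⁻¹ ^ 2 : ℝ)) : ℂ) * -(z * w) := by push_cast; ring
    have hci : 0 < c⁻¹ := inv_pos.2 hc0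
    rw [e1, e2, hhom _ (by positivity), sq_rpow_half hci.le, norm_mul, Complex.norm_real,
      Real.norm_eq_abs, abs_of_pos hci, Real.mul_rpow hci.le (norm_nonneg _),
      Real.inv_rpow hc0.le] at hy
    have hcp : 0 < c ^ p := Real.rpow_pos_of_pos hc0 p
    have hy2 : ε * c ^ p ≤ K * ‖z + conj w‖ ^ p - Φ (-(z * w)) := by
      have := mul_le_mul_of_nonneg_right hy hcp.le
      have e3 : (K * ((c ^ p)⁻¹ * ‖z + conj w‖ ^ p) + -((c ^ p)⁻¹ * Φ (-(z * w)))) * c ^ p =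
        K * ‖z + conj w‖ ^ p - Φ (-(z * w)) := by field_simp; ring
      rwa [e3] at this
    have h1 : ‖z‖ ^ p ≤ c ^ p := Real.rpow_le_rpow (norm_nonneg _) (norm_fst_le (z, w)) hp0.le
    have h2 : ‖w‖ ^ p ≤ c ^ p := Real.rpow_le_rpow (norm_nonneg _) (norm_snd_le (z, w)) hp0.le
    have h3 : 2 / ε * (ε * c ^ p) ≤ 2 / ε * (K * ‖z + conj w‖ ^ p - Φ (-(z * w))) :=
      mul_le_mul_of_nonneg_left hy2 (by positivity)
    have e4 : 2 / ε * (ε * c ^ p) = 2 * c ^ p := by field_simp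
    linarith
  refine ⟨fun w => 2 / ε * Φ w, 2 / ε * K, by fun_prop, fun w hw => ?_, by simp [hΦ0],
    by positivity, fun z w => ?_⟩
  · obtain ⟨H, hd, hle, he⟩ := hs w hw
    refine ⟨fun z => ((2 / ε : ℝ) : ℂ) * H z, ?_, ?_, ?_⟩
    · filter_upwards [hd] with z hz using hz.const_mul _
    · filter_upwards [hle] with z hz
      rw [Complex.re_ofReal_mul]
      exact mul_le_mul_of_nonneg_left hz (by positivity)
    · rw [Complex.re_ofReal_mul, he]
  · have := hpt z w
    simp only
    linarith

theorem hasHolomorphicSupport_norm_add_conj_rpow {p : ℝ} (hp : 1 < p) {g h : ℂ → ℂ} {z : ℂ}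
    (hg : ∀ᶠ w in 𝓝 z, DifferentiableAt ℂ g w) (hh : ∀ᶠ w in 𝓝 z, DifferentiableAt ℂ h w) :
    HasHolomorphicSupport (fun w => ‖g w + conj (h w)‖ ^ p) z := by
  have hp0 : 0 < p := by linarith
  set f : ℂ → ℂ := fun w => g w + conj (h w) with hf
  rcases eq_or_ne (f z) 0 with h0 | h0
  · refine ⟨fun _ => 0, Eventually.of_forall fun _ => differentiableAt_const _,
      Eventually.of_forall fun w => by simp only [Complex.zero_re]; positivity, ?_⟩
    change (0 : ℂ).re = ‖f z‖ ^ p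
    simp [h0, Real.zero_rpow hp0.ne']
  set a := ‖f z‖ with ha
  have ha0 : 0 < a := norm_pos_iff.2 h0
  set e : ℂ := f z / a with he
  have hac : (a : ℂ) ≠ 0 := by exact_mod_cast ha0.ne'
  have hen : ‖e‖ = 1 := by rw [he, norm_div, ← ha]; simp [abs_of_pos ha0, ha0.ne']
  have hre (w : ℂ) : (conj e * g w + e * h w).re = (conj e * f w).re := by
    simp only [hf, mul_add, Complex.add_re, Complex.mul_re, Complex.conj_re, Complex.conj_im]
    ring
  have hez : (conj e * f z).re = a := by
    have : conj e * f z = a := by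
      rw [he, map_div₀, Complex.conj_ofReal, div_mul_eq_mul_div, mul_comm, Complex.mul_conj,
        Complex.normSq_eq_norm_sq, ← ha]
      field_simp
      push_cast
      rfl
    rw [this, Complex.ofReal_re]
  refine ⟨fun w => ((a ^ p - p * a ^ (p - 1) * a : ℝ) : ℂ) +
    ((p * a ^ (p - 1) : ℝ) : ℂ) * (conj e * g w + e * h w), ?_, ?_, ?_⟩
  · filter_upwards [hg, hh] with w hgw hhw
    exact (((hgw.const_mul _).add (hhw.const_mul _)).const_mul _).const_add _
  · refine Eventually.of_forall fun w => ?_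
    rw [Complex.add_re, Complex.re_ofReal_mul, Complex.ofReal_re, hre]
    have h1 : (conj e * f w).re ≤ ‖f w‖ := by
      refine (Complex.re_le_norm _).trans ?_
      rw [norm_mul, RCLike.norm_conj, hen, one_mul]
    have hap : 0 ≤ p * a ^ (p - 1) := by positivity
    have h2 := mul_le_mul_of_nonneg_left h1 hap
    have h3 : a ^ p + p * a ^ (p - 1) * (‖f w‖ - a) ≤ ‖f w‖ ^ p := by
      have hb := one_add_mul_self_le_rpow_one_add (s := ‖f w‖ / a - 1)
        (by linarith [show 0 ≤ ‖f w‖ / a by positivity]) hp.le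
      rw [add_sub_cancel, Real.div_rpow (norm_nonneg _) ha0.le, le_div_iff₀ (by positivity)] at hb
      have e1 : a ^ p = a ^ (p - 1) * a := by rw [← Real.rpow_add_one ha0.ne']; ring_nf
      have e2 : (1 + p * (‖f w‖ / a - 1)) * a ^ p = a ^ p + p * a ^ (p - 1) * (‖f w‖ - a) := by
        rw [e1]; field_simp
      rwa [e2] at hb
    linarith
  · rw [Complex.add_re, Complex.re_ofReal_mul, Complex.ofReal_re, hre, hez]
    change _ = a ^ p
    ring

theorem integral_norm_rpow_mono {p : ℝ} (hp : 1 < p) {g h : ℂ → ℂ} {R : ℝ}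
    (hg : DifferentiableOn ℂ g (Metric.ball 0 R)) (hh : DifferentiableOn ℂ h (Metric.ball 0 R))
    {s r : ℝ} (hs : 0 ≤ s) (hsr : s ≤ r) (hr : r < R) :
    ∫ t, ‖g (circleMap 0 s t) + conj (h (circleMap 0 s t))‖ ^ p ∂circleSigma ≤
      ∫ t, ‖g (circleMap 0 r t) + conj (h (circleMap 0 r t))‖ ^ p ∂circleSigma := by
  have hsub : Metric.closedBall (0 : ℂ) r ⊆ Metric.ball 0 R := Metric.closedBall_subset_ball hr
  have hd {u : ℂ → ℂ} (hu : DifferentiableOn ℂ u (Metric.ball 0 R)) {z : ℂ}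
      (hz : z ∈ Metric.ball (0 : ℂ) r) : ∀ᶠ w in 𝓝 z, DifferentiableAt ℂ u w := by
    filter_upwards [Metric.isOpen_ball.mem_nhds (hsub (Metric.ball_subset_closedBall hz))] with w hw
    exact (hu w hw).differentiableAt (Metric.isOpen_ball.mem_nhds hw)
  refine integral_circleMap_mono_of_hasHolomorphicSupport
    (U := fun z => ‖g z + conj (h z)‖ ^ p) (u := fun _ => 1) hs hsr hr ?_
    (differentiableOn_const _) ⟨0, by simpa using hs.trans_lt (hsr.trans_lt hr), one_ne_zero⟩ ?_
  · exact (((hg.continuousOn.mono hsub).add (Complex.continuous_conj.comp_continuousOn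
      (hh.continuousOn.mono hsub))).norm.rpow_const fun _ _ => Or.inr (by linarith))
  · exact fun z hz _ => hasHolomorphicSupport_norm_add_conj_rpow hp (hd hg hz) (hd hh hz)

theorem integrable_norm_rpow_circleMap {p : ℝ} (hp : 0 ≤ p) {F : ℂ → ℂ}
    (hF : ContinuousOn F (Metric.ball 0 1)) {r : ℝ} (hr0 : 0 ≤ r) (hr1 : r < 1) :
    Integrable (fun t => ‖F (circleMap 0 r t)‖ ^ p) circleSigma :=
  integrable_circleMap_of_continuousOn (U := fun z => ‖F z‖ ^ p) hr0
    (continuousOn_sphere_of_lt_one (hF.norm.rpow_const fun _ _ => Or.inr hp) hr1)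

theorem norm_add_rpow_le {p : ℝ} (hp : 0 ≤ p) (a b : ℂ) :
    ‖a + b‖ ^ p ≤ 2 ^ p * (‖a‖ ^ p + ‖b‖ ^ p) := by
  have key : ∀ x y : ℝ, 0 ≤ x → x ≤ y → (x + y) ^ p ≤ 2 ^ p * (x ^ p + y ^ p) := by
    intro x y hx hxy
    have hy := hx.trans hxy
    calc (x + y) ^ p ≤ (2 * y) ^ p := Real.rpow_le_rpow (by linarith) (by linarith) hp
      _ = 2 ^ p * y ^ p := Real.mul_rpow two_pos.le hy
      _ ≤ _ := mul_le_mul_of_nonneg_left (by linarith [Real.rpow_nonneg hx p]) (by positivity)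
  refine (Real.rpow_le_rpow (norm_nonneg _) (norm_add_le a b) hp).trans ?_
  rcases le_total ‖a‖ ‖b‖ with h | h
  · exact key _ _ (norm_nonneg _) h
  · rw [add_comm ‖a‖, add_comm (‖a‖ ^ p)]
    exact key _ _ (norm_nonneg _) h

/-- A crude form of the theorem of M. Riesz. -/
theorem exists_integral_norm_rpow_le {p : ℝ} (hp : 1 < p) :
    ∃ K : ℝ, 0 ≤ K ∧ ∀ g h : ℂ → ℂ, DifferentiableOn ℂ g (Metric.ball 0 1) →
      DifferentiableOn ℂ h (Metric.ball 0 1) → g 0 * h 0 = 0 → ∀ r, 0 ≤ r → r < 1 →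
      ∫ t, ‖g (circleMap 0 r t)‖ ^ p ∂circleSigma + ∫ t, ‖h (circleMap 0 r t)‖ ^ p ∂circleSigma ≤
        K * ∫ t, ‖g (circleMap 0 r t) + conj (h (circleMap 0 r t))‖ ^ p ∂circleSigma := by
  obtain ⟨Φ, K, hΦ, hs, hΦ0, hK, hle⟩ := exists_riesz_comparison hp
  have hp0 : 0 ≤ p := by linarith
  refine ⟨K, hK, fun g h hg hh h0 r hr0 hr1 => ?_⟩
  have hu : DifferentiableOn ℂ (fun z => -(g z * h z)) (Metric.ball 0 1) := (hg.mul hh).neg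
  have h1 := le_integral_comp_of_hasHolomorphicSupport hΦ hs hu hr0 hr1
  rw [h0, neg_zero, hΦ0] at h1
  have ig := integrable_norm_rpow_circleMap hp0 hg.continuousOn hr0 hr1
  have ih := integrable_norm_rpow_circleMap hp0 hh.continuousOn hr0 hr1
  have iΦ : Integrable (fun t => Φ (-(g (circleMap 0 r t) * h (circleMap 0 r t)))) circleSigma :=
    integrable_circleMap_of_continuousOn (U := fun z => Φ (-(g z * h z))) hr0
      (continuousOn_sphere_of_lt_one (hΦ.comp_continuousOn hu.continuousOn) hr1)
  have hfc : ContinuousOn (fun z => g z + conj (h z)) (Metric.ball 0 1) :=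
    hg.continuousOn.add (Complex.continuous_conj.comp_continuousOn hh.continuousOn)
  have i3 := integrable_norm_rpow_circleMap hp0 hfc hr0 hr1
  have := integral_mono ((ig.add ih).add iΦ) (i3.const_mul K)
    (fun t => hle (g (circleMap 0 r t)) (h (circleMap 0 r t)))
  rw [integral_add' (ig.add ih) iΦ, integral_add' ig ih, integral_const_mul] at this
  linarith

theorem exists_bound_integral_norm_rpow {p : ℝ} (hp : 1 < p) {g h : ℂ → ℂ}
    (hg : DifferentiableOn ℂ g (Metric.ball 0 1)) (hh : DifferentiableOn ℂ h (Metric.ball 0 1))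
    {M : ℝ} (hM : ∀ r, 0 < r → r < 1 →
      ∫ t, ‖g (circleMap 0 r t) + conj (h (circleMap 0 r t))‖ ^ p ∂circleSigma ≤ M) :
    ∃ M' : ℝ, ∀ r, 0 < r → r < 1 → ∫ t, ‖g (circleMap 0 r t)‖ ^ p ∂circleSigma ≤ M' ∧
      ∫ t, ‖h (circleMap 0 r t)‖ ^ p ∂circleSigma ≤ M' := by
  obtain ⟨K, hK, hle⟩ := exists_integral_norm_rpow_le hp
  have hp0 : 0 ≤ p := by linarith
  have hg' : DifferentiableOn ℂ (fun z => g z - g 0) (Metric.ball 0 1) := hg.sub_const _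
  have hh' : DifferentiableOn ℂ (fun z => h z - h 0) (Metric.ball 0 1) := hh.sub_const _
  have hfc : ContinuousOn (fun z => g z + conj (h z)) (Metric.ball 0 1) :=
    hg.continuousOn.add (Complex.continuous_conj.comp_continuousOn hh.continuousOn)
  set c : ℂ := g 0 + conj (h 0) with hc
  have hsum : ∀ r, 0 < r → r < 1 →
      ∫ t, ‖g (circleMap 0 r t) - g 0‖ ^ p ∂circleSigma +
        ∫ t, ‖h (circleMap 0 r t) - h 0‖ ^ p ∂circleSigma ≤ K * (2 ^ p * (M + ‖c‖ ^ p)) := by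
    intro r hr0 hr1
    refine (hle _ _ hg' hh' (by simp) r hr0.le hr1).trans (mul_le_mul_of_nonneg_left ?_ hK)
    have i1 := integrable_norm_rpow_circleMap hp0 hfc hr0.le hr1
    have i2 : Integrable (fun t => ‖g (circleMap 0 r t) - g 0 + conj (h (circleMap 0 r t) - h 0)‖ ^ p)
        circleSigma := integrable_norm_rpow_circleMap hp0 (F := fun z => g z - g 0 + conj (h z - h 0))
      (hg'.continuousOn.add (Complex.continuous_conj.comp_continuousOn hh'.continuousOn)) hr0.le hr1
    calc _ ≤ ∫ t, 2 ^ p * (‖g (circleMap 0 r t) + conj (h (circleMap 0 r t))‖ ^ p + ‖c‖ ^ p)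
          ∂circleSigma := by
          refine integral_mono i2 ((i1.add (integrable_const _)).const_mul _) fun t => ?_
          have := norm_add_rpow_le hp0 (g (circleMap 0 r t) + conj (h (circleMap 0 r t))) (-c)
          rw [norm_neg] at this
          refine le_trans (le_of_eq ?_) this
          simp only [hc, map_sub]
          congr 2
          ring
      _ ≤ _ := by
          rw [integral_const_mul, integral_add i1 (integrable_const _)]
          refine mul_le_mul_of_nonneg_left ?_ (by positivity)
          have := hM r hr0 hr1
          simpa using this
  have hone {u : ℂ → ℂ} (hu : DifferentiableOn ℂ u (Metric.ball 0 1)) {r B : ℝ} (hr0 : 0 < r)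
      (hr1 : r < 1) (hB : ∫ t, ‖u (circleMap 0 r t) - u 0‖ ^ p ∂circleSigma ≤ B) :
      ∫ t, ‖u (circleMap 0 r t)‖ ^ p ∂circleSigma ≤ 2 ^ p * (B + ‖u 0‖ ^ p) := by
    have i1 := integrable_norm_rpow_circleMap hp0 (hu.sub_const (u 0)).continuousOn hr0.le hr1
    have i2 := integrable_norm_rpow_circleMap hp0 hu.continuousOn hr0.le hr1
    calc _ ≤ ∫ t, 2 ^ p * (‖u (circleMap 0 r t) - u 0‖ ^ p + ‖u 0‖ ^ p) ∂circleSigma := by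
          refine integral_mono i2 ((i1.add (integrable_const _)).const_mul _) fun t => ?_
          have := norm_add_rpow_le hp0 (u (circleMap 0 r t) - u 0) (u 0)
          rwa [sub_add_cancel] at this
      _ ≤ _ := by
          rw [integral_const_mul, integral_add i1 (integrable_const _)]
          refine mul_le_mul_of_nonneg_left ?_ (by positivity)
          simpa using hB
  have hnn (F : ℝ → ℂ) : 0 ≤ ∫ t, ‖F t‖ ^ p ∂circleSigma := integral_nonneg fun t => by positivity
  refine ⟨max (2 ^ p * (K * (2 ^ p * (M + ‖c‖ ^ p)) + ‖g 0‖ ^ p))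
    (2 ^ p * (K * (2 ^ p * (M + ‖c‖ ^ p)) + ‖h 0‖ ^ p)), fun r hr0 hr1 => ⟨?_, ?_⟩⟩
  · refine (hone hg hr0 hr1 ?_).trans (le_max_left _ _)
    have := hsum r hr0 hr1
    have := hnn fun t => h (circleMap 0 r t) - h 0
    linarith
  · refine (hone hh hr0 hr1 ?_).trans (le_max_right _ _)
    have := hsum r hr0 hr1
    have := hnn fun t => g (circleMap 0 r t) - g 0
    linarith

/-- A form of the uniform convexity of `x ↦ ‖x‖ ^ p`. -/
theorem exists_norm_sub_rpow_le {p : ℝ} (hp : 1 < p) {ε : ℝ} (hε : 0 < ε) :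
    ∃ K : ℝ, 0 ≤ K ∧ ∀ a b : ℂ, ‖a - b‖ ^ p ≤ ε * (‖a‖ ^ p + ‖b‖ ^ p) +
      K * (‖a‖ ^ p + ‖b‖ ^ p - 2 * ‖(a + b) / 2‖ ^ p) := by
  have hp0 : 0 < p := by linarith
  have hrp {F : ℂ × ℂ → ℂ} (hF : Continuous F) : Continuous fun x => ‖F x‖ ^ p :=
    hF.norm.rpow_const fun _ => Or.inr hp0.le
  have hA : Continuous fun x : ℂ × ℂ => ‖x.1‖ ^ p + ‖x.2‖ ^ p - 2 * ‖(x.1 + x.2) / 2‖ ^ p :=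
    ((hrp continuous_fst).add (hrp continuous_snd)).sub
      ((hrp ((continuous_fst.add continuous_snd).div_const 2)).const_mul _)
  have hB : Continuous fun x : ℂ × ℂ => ε * (‖x.1‖ ^ p + ‖x.2‖ ^ p) - ‖x.1 - x.2‖ ^ p :=
    (((hrp continuous_fst).add (hrp continuous_snd)).const_mul _).sub
      (hrp (continuous_fst.sub continuous_snd))
  have hmid (a b : ℂ) : ‖(a + b) / 2‖ ≤ (‖a‖ + ‖b‖) / 2 := by
    rw [norm_div, Complex.norm_ofNat]
    have := norm_add_le a b
    linarith
  have hconv (x y : ℝ) (hx : 0 ≤ x) (hy : 0 ≤ y) : 2 * ((x + y) / 2) ^ p ≤ x ^ p + y ^ p := by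
    have := (convexOn_rpow hp.le).2 (show x ∈ Set.Ici 0 from hx) (show y ∈ Set.Ici 0 from hy)
      (show (0 : ℝ) ≤ 1 / 2 by norm_num) (show (0 : ℝ) ≤ 1 / 2 by norm_num) (by norm_num)
    simp only [smul_eq_mul] at this
    rw [show 1 / 2 * x + 1 / 2 * y = (x + y) / 2 by ring] at this
    linarith
  have hmid2 (a b : ℂ) : 2 * ‖(a + b) / 2‖ ^ p ≤ 2 * ((‖a‖ + ‖b‖) / 2) ^ p :=
    mul_le_mul_of_nonneg_left (Real.rpow_le_rpow (norm_nonneg _) (hmid a b) hp0.le) two_pos.le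
  obtain ⟨K, δ, hδ, hK, hKδ⟩ := (isCompact_sphere (0 : ℂ × ℂ) 1).exists_mul_add_pos
    hA.continuousOn hB.continuousOn
    (fun x _ => by
      have := hmid2 x.1 x.2
      have := hconv ‖x.1‖ ‖x.2‖ (norm_nonneg _) (norm_nonneg _)
      linarith)
    (by
      rintro ⟨a, b⟩ hx h
      simp only at h ⊢
      have h1 := hmid2 a b
      have h2 := hconv ‖a‖ ‖b‖ (norm_nonneg _) (norm_nonneg _)
      have hab : ‖a‖ = ‖b‖ := by
        by_contra hne
        have := (strictConvexOn_rpow hp).2 (show ‖a‖ ∈ Set.Ici 0 from norm_nonneg _)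
          (show ‖b‖ ∈ Set.Ici 0 from norm_nonneg _) hne
          (show (0 : ℝ) < 1 / 2 by norm_num) (show (0 : ℝ) < 1 / 2 by norm_num) (by norm_num)
        simp only [smul_eq_mul] at this
        rw [show 1 / 2 * ‖a‖ + 1 / 2 * ‖b‖ = (‖a‖ + ‖b‖) / 2 by ring] at this
        linarith
      have hadd : ‖a + b‖ = ‖a‖ + ‖b‖ := by
        have h3 : ((‖a‖ + ‖b‖) / 2) ^ p ≤ ‖(a + b) / 2‖ ^ p := by linarith
        have h4 := (Real.rpow_le_rpow_iff (by positivity) (norm_nonneg _) hp0).1 h3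
        rw [norm_div, Complex.norm_ofNat] at h4
        linarith [norm_add_le a b]
      have heq : a = b := eq_of_norm_eq_of_norm_add_eq hab hadd
      have hn : ‖b‖ = 1 := by
        have : ‖((a, b) : ℂ × ℂ)‖ = 1 := by simpa using hx
        rwa [Prod.norm_mk, heq, max_self] at this
      rw [heq, hn, sub_self, norm_zero, Real.zero_rpow hp0.ne', Real.one_rpow]
      linarith)
  refine ⟨K, hK, fun a b => ?_⟩
  rcases eq_or_ne ((a, b) : ℂ × ℂ) 0 with h0 | h0
  · obtain ⟨rfl, rfl⟩ := Prod.mk_eq_zero.1 h0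
    simp [Real.zero_rpow hp0.ne']
  set c := ‖((a, b) : ℂ × ℂ)‖ with hc
  have hc0 : 0 < c := norm_pos_iff.2 h0
  have hci : 0 < c⁻¹ := inv_pos.2 hc0
  have hmem : c⁻¹ • ((a, b) : ℂ × ℂ) ∈ Metric.sphere (0 : ℂ × ℂ) 1 := by
    rw [mem_sphere_zero_iff_norm, norm_smul, ← hc]
    simp [abs_of_pos hc0, hc0.ne']
  have hy := hKδ _ hmem
  simp only [Prod.smul_mk] at hy
  have hn (x : ℂ) : ‖c⁻¹ • x‖ ^ p = (c ^ p)⁻¹ * ‖x‖ ^ p := by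
    rw [norm_smul, Real.norm_eq_abs, abs_of_pos hci, Real.mul_rpow hci.le (norm_nonneg _),
      Real.inv_rpow hc0.le]
  have e1 : (c⁻¹ • a + c⁻¹ • b) / 2 = c⁻¹ • ((a + b) / 2) := by
    rw [← smul_add, smul_div_assoc]
  rw [e1, ← smul_sub, hn, hn, hn, hn] at hy
  have hcp : 0 < c ^ p := Real.rpow_pos_of_pos hc0 p
  have := mul_le_mul_of_nonneg_right (hδ.le.trans hy) hcp.le
  field_simp at this
  linarith

theorem ofReal_mul_circleMap (s r t : ℝ) : (s : ℂ) * circleMap 0 r t = circleMap 0 (s * r) t := by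
  simp [circleMap, mul_assoc]

theorem integral_norm_sub_rpow_cauchy {p : ℝ} (hp : 1 < p) {g : ℂ → ℂ}
    (hg : DifferentiableOn ℂ g (Metric.ball 0 1)) {M : ℝ}
    (hM : ∀ r, 0 < r → r < 1 → ∫ t, ‖g (circleMap 0 r t)‖ ^ p ∂circleSigma ≤ M)
    {ρ : ℕ → ℝ} (hρ0 : ∀ n, 0 < ρ n) (hρ1 : ∀ n, ρ n < 1) (hρ : Tendsto ρ atTop (𝓝 1))
    {ε : ℝ} (hε : 0 < ε) :
    ∀ᶠ x : ℕ × ℕ in atTop ×ˢ atTop,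
      ∫ t, ‖g (circleMap 0 (ρ x.1) t) - g (circleMap 0 (ρ x.2) t)‖ ^ p ∂circleSigma ≤ ε := by
  have hp0 : 0 < p := by linarith
  set m : ℝ → ℝ := fun r => ∫ t, ‖g (circleMap 0 r t)‖ ^ p ∂circleSigma with hm
  have hbdd : BddAbove (m '' Set.Ioo 0 1) := ⟨M, by rintro _ ⟨r, hr, rfl⟩; exact hM r hr.1 hr.2⟩
  set L := sSup (m '' Set.Ioo 0 1) with hL
  have hmL : ∀ r, 0 < r → r < 1 → m r ≤ L := fun r h0 h1 => le_csSup hbdd ⟨r, ⟨h0, h1⟩, rfl⟩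
  have hm0 : ∀ r, 0 ≤ m r := fun r => integral_nonneg fun t => by positivity
  have hL0 : 0 ≤ L := (hm0 _).trans (hmL (ρ 0) (hρ0 0) (hρ1 0))
  obtain ⟨K, hK, hKle⟩ := exists_norm_sub_rpow_le hp
    (show 0 < ε / (4 * (L + 1)) by positivity)
  set η := ε / (8 * (K + 1)) with hη
  have hη0 : 0 < η := by positivity
  obtain ⟨_, ⟨s, hs, rfl⟩, hsL⟩ := exists_lt_of_lt_csSup
    (show (m '' Set.Ioo 0 1).Nonempty from ⟨_, 1 / 2, by norm_num, rfl⟩)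
    (show L - η < sSup (m '' Set.Ioo 0 1) by rw [← hL]; linarith)
  have hgc := hg.continuousOn
  have hcball : Metric.closedBall (0 : ℂ) s ⊆ Metric.ball 0 1 := Metric.closedBall_subset_ball hs.2
  obtain ⟨B, hB⟩ := (isCompact_closedBall (0 : ℂ) s).exists_bound_of_continuousOn (hgc.mono hcball)
  have hmem (n : ℕ) (t : ℝ) : (ρ n : ℂ) * circleMap 0 s t ∈ Metric.closedBall (0 : ℂ) s := by
    rw [mem_closedBall_zero_iff, norm_mul, Complex.norm_real, Real.norm_eq_abs, abs_of_pos (hρ0 n),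
      norm_circleMap_zero, abs_of_pos hs.1]
    exact mul_le_of_le_one_left hs.1.le (hρ1 n).le
  have hgr (n : ℕ) : Continuous fun t => g ((ρ n : ℂ) * circleMap 0 s t) :=
    (hgc.mono hcball).comp_continuous (continuous_const.mul (continuous_circleMap 0 s)) (hmem n)
  have hlim : Tendsto (fun x : ℕ × ℕ => ∫ t, ‖(g ((ρ x.1 : ℂ) * circleMap 0 s t) +
      g ((ρ x.2 : ℂ) * circleMap 0 s t)) / 2‖ ^ p ∂circleSigma) (atTop ×ˢ atTop) (𝓝 (m s)) := by
    refine tendsto_integral_filter_of_dominated_convergence (fun _ => B ^ p) ?_ ?_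
      (integrable_const _) ?_
    · refine Eventually.of_forall fun x => Continuous.aestronglyMeasurable ?_
      exact (((hgr x.1).add (hgr x.2)).div_const 2).norm.rpow_const fun _ => Or.inr hp0.le
    · refine Eventually.of_forall fun x => Eventually.of_forall fun t => ?_
      rw [Real.norm_eq_abs, abs_of_nonneg (by positivity)]
      refine Real.rpow_le_rpow (norm_nonneg _) ?_ hp0.le
      rw [norm_div, Complex.norm_ofNat]
      have := norm_add_le (g ((ρ x.1 : ℂ) * circleMap 0 s t)) (g ((ρ x.2 : ℂ) * circleMap 0 s t))
      have := hB _ (hmem x.1 t)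
      have := hB _ (hmem x.2 t)
      linarith
    · refine Eventually.of_forall fun t => ?_
      have hz : circleMap 0 s t ∈ Metric.ball (0 : ℂ) 1 :=
        hcball (Metric.sphere_subset_closedBall (circleMap_mem_sphere 0 hs.1.le t))
      have h1 : Tendsto (fun n => g ((ρ n : ℂ) * circleMap 0 s t)) atTop
          (𝓝 (g (circleMap 0 s t))) := by
        refine (hgc.continuousAt (Metric.isOpen_ball.mem_nhds hz)).tendsto.comp ?_
        have : Tendsto (fun n => (ρ n : ℂ)) atTop (𝓝 ((1 : ℝ) : ℂ)) :=
          (Complex.continuous_ofReal.tendsto 1).comp hρ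
        simpa using this.mul_const (circleMap 0 s t)
      have h2 := ((h1.comp (tendsto_fst (g := (atTop : Filter ℕ)))).add
        (h1.comp (tendsto_snd (f := (atTop : Filter ℕ))))).div_const (2 : ℂ)
      have h3 := (h2.norm).rpow_const (p := p) (Or.inr hp0.le)
      rw [add_self_div_two] at h3
      exact h3
  filter_upwards [hlim.eventually (lt_mem_nhds (show m s - η < m s by linarith))] with x hx
  obtain ⟨a, b⟩ := x
  simp only at hx ⊢
  have hrad : ∃ R > 1, ρ a * R ≤ 1 ∧ ρ b * R ≤ 1 := by
    have hmax : max (ρ a) (ρ b) < 1 := max_lt (hρ1 a) (hρ1 b)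
    have hmax0 : 0 < max (ρ a) (ρ b) := (hρ0 a).trans_le (le_max_left _ _)
    refine ⟨(max (ρ a) (ρ b))⁻¹, (one_lt_inv₀ hmax0).2 hmax, ?_, ?_⟩
    · rw [← div_eq_mul_inv]; exact (div_le_one hmax0).2 (le_max_left _ _)
    · rw [← div_eq_mul_inv]; exact (div_le_one hmax0).2 (le_max_right _ _)
  obtain ⟨R, hR1, hRa, hRb⟩ := hrad
  have hdil {c : ℝ} (hc0 : 0 < c) (hc : c * R ≤ 1) :
      DifferentiableOn ℂ (fun z => g ((c : ℂ) * z)) (Metric.ball 0 R) := by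
    refine hg.comp ((differentiable_id.const_mul (c : ℂ)).differentiableOn) fun z hz => ?_
    rw [mem_ball_zero_iff] at hz ⊢
    rw [norm_mul, Complex.norm_real, Real.norm_eq_abs, abs_of_pos hc0]
    exact (mul_lt_mul_of_pos_left hz hc0).trans_le hc
  have hkd : DifferentiableOn ℂ (fun z => (g ((ρ a : ℂ) * z) + g ((ρ b : ℂ) * z)) / 2)
      (Metric.ball 0 R) := ((hdil (hρ0 a) hRa).add (hdil (hρ0 b) hRb)).div_const 2
  have hmono := integral_norm_rpow_mono hp hkd (differentiableOn_const (0 : ℂ)) hs.1.le hs.2.le hR1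
  simp only [map_zero, add_zero, ofReal_mul_circleMap, mul_one] at hmono
  simp only [ofReal_mul_circleMap] at hx
  have ia := integrable_norm_rpow_circleMap hp0.le hgc (hρ0 a).le (hρ1 a)
  have ib := integrable_norm_rpow_circleMap hp0.le hgc (hρ0 b).le (hρ1 b)
  have hgn (n : ℕ) : Continuous fun t => g (circleMap 0 (ρ n) t) :=
    (continuousOn_sphere_of_lt_one hgc (hρ1 n)).comp_continuous (continuous_circleMap 0 _)
      fun t => circleMap_mem_sphere 0 (hρ0 n).le t
  have hci {F : ℝ → ℂ} (hF : Continuous F) : Integrable (fun t => ‖F t‖ ^ p) circleSigma := by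
    refine Integrable.smul_measure ?_ (by simp [Real.pi_pos])
    exact (hF.norm.rpow_const fun _ => Or.inr hp0.le).integrableOn_Ioc
  have ic := hci (((hgn a).add (hgn b)).div_const 2)
  have id' := hci ((hgn a).sub (hgn b))
  have hfin := integral_mono id' (((ia.add ib).const_mul (ε / (4 * (L + 1)))).add
    (((ia.add ib).sub (ic.const_mul 2)).const_mul K)) fun t => hKle _ _
  rw [integral_add' ((ia.add ib).const_mul _) (((ia.add ib).sub (ic.const_mul 2)).const_mul K),
    integral_const_mul, integral_const_mul, integral_sub' (ia.add ib) (ic.const_mul 2),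
    integral_add' ia ib, integral_const_mul] at hfin
  refine hfin.trans ?_
  have h1 := hmL _ (hρ0 a) (hρ1 a)
  have h2 := hmL _ (hρ0 b) (hρ1 b)
  change ε / (4 * (L + 1)) * (m (ρ a) + m (ρ b)) + K * (m (ρ a) + m (ρ b) -
    2 * ∫ t, ‖(g (circleMap 0 (ρ a) t) + g (circleMap 0 (ρ b) t)) / 2‖ ^ p ∂circleSigma) ≤ ε
  have h3 : ε / (4 * (L + 1)) * (m (ρ a) + m (ρ b)) ≤ ε / (4 * (L + 1)) * (2 * (L + 1)) :=
    mul_le_mul_of_nonneg_left (by linarith) (by positivity)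
  have h4 : K * (m (ρ a) + m (ρ b) - 2 * ∫ t, ‖(g (circleMap 0 (ρ a) t) +
      g (circleMap 0 (ρ b) t)) / 2‖ ^ p ∂circleSigma) ≤ (K + 1) * (4 * η) := by
    refine (mul_le_mul_of_nonneg_left (show _ ≤ 4 * η by linarith) hK).trans ?_
    exact mul_le_mul_of_nonneg_right (by linarith) (by positivity)
  have e3 : ε / (4 * (L + 1)) * (2 * (L + 1)) = ε / 2 := by field_simp; ring
  have e4 : (K + 1) * (4 * η) = ε / 2 := by rw [hη]; field_simp; ring
  linarith

theorem continuous_comp_circleMap {E : Type*} [TopologicalSpace E] {F : ℂ → E}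
    (hF : ContinuousOn F (Metric.ball 0 1)) {r : ℝ} (hr0 : 0 ≤ r) (hr1 : r < 1) :
    Continuous fun t => F (circleMap 0 r t) :=
  (continuousOn_sphere_of_lt_one hF hr1).comp_continuous (continuous_circleMap 0 _)
    fun t => circleMap_mem_sphere 0 hr0 t

theorem memLp_circleMap {F : ℂ → ℂ} (hF : ContinuousOn F (Metric.ball 0 1)) {r : ℝ} (hr0 : 0 ≤ r)
    (hr1 : r < 1) (P : ℝ≥0∞) : MemLp (fun t => F (circleMap 0 r t)) P circleSigma := by
  obtain ⟨B, hB⟩ := (isCompact_sphere (0 : ℂ) r).exists_bound_of_continuousOn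
    (continuousOn_sphere_of_lt_one hF hr1)
  exact MemLp.of_bound (continuous_comp_circleMap hF hr0 hr1).aestronglyMeasurable B
    (Eventually.of_forall fun t => hB _ (circleMap_mem_sphere 0 hr0 t))

/-- Convergence in `L^p` of a holomorphic function with bounded means to a boundary function. -/
theorem exists_Lp_boundary_function {p : ℝ} (hp : 1 < p) {g : ℂ → ℂ}
    (hg : DifferentiableOn ℂ g (Metric.ball 0 1)) {M : ℝ}
    (hM : ∀ r, 0 < r → r < 1 → ∫ t, ‖g (circleMap 0 r t)‖ ^ p ∂circleSigma ≤ M)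
    {ρ : ℕ → ℝ} (hρ0 : ∀ n, 0 < ρ n) (hρ1 : ∀ n, ρ n < 1) (hρ : Tendsto ρ atTop (𝓝 1)) :
    ∃ G : ℝ → ℂ, MemLp G (ENNReal.ofReal p) circleSigma ∧
      Tendsto (fun n => eLpNorm (fun t => g (circleMap 0 (ρ n) t) - G t) (ENNReal.ofReal p)
        circleSigma) atTop (𝓝 0) := by
  have hp0 : 0 < p := by linarith
  have hP0 : ENNReal.ofReal p ≠ 0 := by simpa using hp0
  have : Fact (1 ≤ ENNReal.ofReal p) := ⟨by simpa using hp.le⟩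
  have hmem (n : ℕ) := memLp_circleMap hg.continuousOn (hρ0 n).le (hρ1 n) (ENNReal.ofReal p)
  set F : ℕ → Lp ℂ (ENNReal.ofReal p) circleSigma := fun n => (hmem n).toLp _ with hF
  have hdist (a b : ℕ) : dist (F a) (F b) =
      (∫ t, ‖g (circleMap 0 (ρ a) t) - g (circleMap 0 (ρ b) t)‖ ^ p ∂circleSigma) ^ p⁻¹ := by
    rw [dist_eq_norm, hF, ← MemLp.toLp_sub, Lp.norm_toLp,
      MemLp.eLpNorm_eq_integral_rpow_norm hP0 ENNReal.ofReal_ne_top ((hmem a).sub (hmem b)),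
      ENNReal.toReal_ofReal hp0.le, ENNReal.toReal_ofReal]
    · simp only [Pi.sub_apply]
    · positivity
  have hcau : CauchySeq F := by
    rw [Metric.cauchySeq_iff]
    intro ε hε
    have h := integral_norm_sub_rpow_cauchy hp hg hM hρ0 hρ1 hρ
      (show 0 < (ε / 2) ^ p by positivity)
    rw [prod_atTop_atTop_eq, eventually_atTop] at h
    obtain ⟨⟨N₁, N₂⟩, hN⟩ := h
    refine ⟨max N₁ N₂, fun a ha b hb => ?_⟩
    rw [hdist]
    have := hN (a, b) ⟨(le_max_left _ _).trans ha, (le_max_right _ _).trans hb⟩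
    calc _ ≤ ((ε / 2) ^ p) ^ p⁻¹ :=
          Real.rpow_le_rpow (integral_nonneg fun t => by positivity) this (by positivity)
      _ = ε / 2 := by rw [← Real.rpow_mul (by positivity), mul_inv_cancel₀ hp0.ne', Real.rpow_one]
      _ < ε := by linarith
  obtain ⟨G, hG⟩ := cauchySeq_tendsto_of_complete hcau
  refine ⟨G, Lp.memLp G, ?_⟩
  rw [Lp.tendsto_Lp_iff_tendsto_eLpNorm'] at hG
  refine hG.congr fun n => eLpNorm_congr_ae ?_
  filter_upwards [(hmem n).coeFn_toLp] with t ht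
  simp only [Pi.sub_apply, hF]
  rw [ht]

theorem poissonKernel_zero_nonneg {z ζ : ℂ} (hz : ‖z‖ < 1) (hζ : ‖ζ‖ = 1) :
    0 ≤ poissonKernel 0 z ζ := by
  rw [poissonKernel_def, sub_zero, sub_zero, hζ]
  refine div_nonneg ?_ (sq_nonneg _)
  nlinarith [norm_nonneg z]

theorem poissonKernel_zero_le {z ζ : ℂ} (hz : ‖z‖ < 1) (hζ : ‖ζ‖ = 1) {d : ℝ} (hd0 : 0 < d)
    (hd : d ≤ ‖ζ - z‖) : poissonKernel 0 z ζ ≤ 2 * (1 - ‖z‖) / d ^ 2 := by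
  rw [poissonKernel_def, sub_zero, sub_zero, hζ]
  have := norm_nonneg z
  gcongr
  nlinarith

theorem continuous_poissonKernel_circleMap {z : ℂ} (hz : ‖z‖ < 1) :
    Continuous fun s => poissonKernel 0 z (circleMap 0 1 s) := by
  simp only [poissonKernel_def, sub_zero]
  refine Continuous.div (by fun_prop) (by fun_prop) fun s h => ?_
  have h1 : circleMap 0 1 s = z := by
    rw [← sub_eq_zero, ← norm_eq_zero]
    exact pow_eq_zero_iff two_ne_zero |>.1 h
  rw [← h1] at hz
  simp at hz

/-- The Poisson integral of the boundary function dominates the values in the disk. -/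
theorem enorm_sub_le_lintegral_poissonKernel {g : ℂ → ℂ}
    (hg : DifferentiableOn ℂ g (Metric.ball 0 1)) {G : ℝ → ℂ}
    (hG : AEStronglyMeasurable G circleSigma) {ρ : ℕ → ℝ} (hρ0 : ∀ n, 0 < ρ n)
    (hρ1 : ∀ n, ρ n < 1) (hρ : Tendsto ρ atTop (𝓝 1))
    (hlim : Tendsto (fun n => ∫⁻ t, ‖g (circleMap 0 (ρ n) t) - G t‖ₑ ∂circleSigma) atTop (𝓝 0))
    {z : ℂ} (hz : ‖z‖ < 1) (a : ℂ) :
    ‖g z - a‖ₑ ≤ ∫⁻ s, ENNReal.ofReal (poissonKernel 0 z (circleMap 0 1 s)) * ‖G s - a‖ₑ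
      ∂circleSigma := by
  set k : ℝ → ℝ≥0∞ := fun s => ENNReal.ofReal (poissonKernel 0 z (circleMap 0 1 s)) with hk
  have hkm : Measurable k :=
    (ENNReal.continuous_ofReal.comp (continuous_poissonKernel_circleMap hz)).measurable
  set C : ℝ := 2 * (1 - ‖z‖) / (1 - ‖z‖) ^ 2 with hC
  have hkC : ∀ s, k s ≤ ENNReal.ofReal C := by
    intro s
    refine ENNReal.ofReal_le_ofReal (poissonKernel_zero_le hz (by simp) (by linarith) ?_)
    have := norm_sub_norm_le (circleMap 0 1 s) z
    simpa using this
  have hzb : z ∈ Metric.ball (0 : ℂ) 1 := by simpa using hz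
  have hstep (n : ℕ) : ‖g ((ρ n : ℂ) * z) - a‖ₑ ≤ ∫⁻ s, k s * ‖G s - a‖ₑ ∂circleSigma +
      ENNReal.ofReal C * ∫⁻ t, ‖g (circleMap 0 (ρ n) t) - G t‖ₑ ∂circleSigma := by
    have hd : DiffContOnCl ℂ (fun ζ => g ((ρ n : ℂ) * ζ) - a) (Metric.ball 0 1) := by
      refine DifferentiableOn.diffContOnCl ?_
      rw [closure_ball _ one_ne_zero]
      refine (hg.comp ((differentiable_id.const_mul (ρ n : ℂ)).differentiableOn) fun w hw => ?_).sub_const a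
      rw [mem_closedBall_zero_iff] at hw
      rw [mem_ball_zero_iff, norm_mul, Complex.norm_real, Real.norm_eq_abs, abs_of_pos (hρ0 n)]
      exact (mul_le_of_le_one_right (hρ0 n).le hw).trans_lt (hρ1 n)
    have h1 := hd.circleAverage_poissonKernel_smul hzb
    rw [← circleSigma_eq_circleAverage] at h1
    rw [← h1]
    refine (enorm_integral_le_lintegral_enorm _).trans ?_
    have h2 : ∀ s, ‖(poissonKernel 0 z • fun ζ => g ((ρ n : ℂ) * ζ) - a) (circleMap 0 1 s)‖ₑ ≤
        k s * ‖G s - a‖ₑ + ENNReal.ofReal C * ‖g (circleMap 0 (ρ n) s) - G s‖ₑ := by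
      intro s
      simp only [Pi.smul_apply', enorm_smul]
      rw [Real.enorm_eq_ofReal (poissonKernel_zero_nonneg hz (by simp)), ofReal_mul_circleMap, mul_one]
      calc _ ≤ k s * (‖G s - a‖ₑ + ‖g (circleMap 0 (ρ n) s) - G s‖ₑ) := by
            refine mul_le_mul_right ?_ _
            have := enorm_add_le (G s - a) (g (circleMap 0 (ρ n) s) - G s)
            rwa [show G s - a + (g (circleMap 0 (ρ n) s) - G s) = g (circleMap 0 (ρ n) s) - a by ring]
              at this
        _ ≤ _ := by
            rw [mul_add]
            exact add_le_add le_rfl (mul_le_mul_left (hkC s) _)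
    refine (lintegral_mono h2).trans ?_
    have hm : AEMeasurable (fun s => k s * ‖G s - a‖ₑ) circleSigma :=
      hkm.aemeasurable.mul (hG.sub aestronglyMeasurable_const).enorm
    rw [lintegral_add_left' hm,
      lintegral_const_mul' _ _ ENNReal.ofReal_ne_top]
  have hl : Tendsto (fun n => ‖g ((ρ n : ℂ) * z) - a‖ₑ) atTop (𝓝 ‖g z - a‖ₑ) := by
    have h1 : Tendsto (fun n => (ρ n : ℂ) * z) atTop (𝓝 z) := by
      have : Tendsto (fun n => (ρ n : ℂ)) atTop (𝓝 ((1 : ℝ) : ℂ)) :=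
        (Complex.continuous_ofReal.tendsto 1).comp hρ
      simpa using this.mul_const z
    have h2 := (hg.continuousOn.continuousAt (Metric.isOpen_ball.mem_nhds hzb)).tendsto.comp h1
    exact (h2.sub_const a).enorm
  have hr : Tendsto (fun n => ∫⁻ s, k s * ‖G s - a‖ₑ ∂circleSigma +
      ENNReal.ofReal C * ∫⁻ t, ‖g (circleMap 0 (ρ n) t) - G t‖ₑ ∂circleSigma) atTop
      (𝓝 (∫⁻ s, k s * ‖G s - a‖ₑ ∂circleSigma)) := by
    simpa using (ENNReal.Tendsto.const_mul hlim (Or.inr ENNReal.ofReal_ne_top)).const_add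
      (∫⁻ s, k s * ‖G s - a‖ₑ ∂circleSigma)
  exact le_of_tendsto_of_tendsto' hl hr hstep

theorem norm_circleMap_one_sub (s t : ℝ) :
    ‖circleMap 0 1 s - circleMap 0 1 t‖ = 2 * |Real.sin ((s - t) / 2)| := by
  have h : circleMap 0 1 s - circleMap 0 1 t =
      circleMap 0 1 t * (Complex.exp (Complex.I * ((s - t : ℝ) : ℂ)) - 1) := by
    simp only [circleMap, Complex.ofReal_one, one_mul, zero_add, mul_sub, mul_one, ← Complex.exp_add]
    congr 2
    push_cast; ring
  rw [h, norm_mul, Complex.norm_exp_I_mul_ofReal_sub_one]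
  simp

theorem norm_circleMap_sub_le_two_mul (s t : ℝ) {r : ℝ} (hr0 : 0 ≤ r) (hr1 : r ≤ 1) :
    ‖circleMap 0 1 s - circleMap 0 1 t‖ ≤ 2 * ‖circleMap 0 1 s - circleMap 0 r t‖ := by
  have h1 : ‖circleMap 0 r t - circleMap 0 1 t‖ = 1 - r := by
    have : circleMap 0 r t - circleMap 0 1 t = ((r - 1 : ℝ) : ℂ) * circleMap 0 1 t := by
      simp [circleMap]; ring
    rw [this, norm_mul, Complex.norm_real, Real.norm_eq_abs, abs_of_nonpos (by linarith)]
    simp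
  have h2 := norm_sub_norm_le (circleMap 0 1 s) (circleMap 0 r t)
  have h3 := norm_add_le (circleMap 0 1 s - circleMap 0 r t) (circleMap 0 r t - circleMap 0 1 t)
  rw [sub_add_sub_cancel, h1] at h3
  simp only [norm_circleMap_zero, abs_one, abs_of_nonneg hr0] at h2
  linarith

theorem exists_mul_max_le_norm_circleMap_sub {t : ℝ} (ht : t ∈ Set.Ioo 0 (2 * Real.pi)) :
    ∃ κ > 0, ∀ r, 0 ≤ r → r < 1 → ∀ s ∈ Set.Ioc 0 (2 * Real.pi),
      κ * max (1 - r) |s - t| ≤ ‖circleMap 0 1 s - circleMap 0 r t‖ := by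
  set d := max t (2 * Real.pi - t) with hd
  have hd0 : 0 < d := ht.1.trans_le (le_max_left _ _)
  have hd1 : d < 2 * Real.pi := max_lt ht.2 (by linarith [ht.1])
  have hs0 : 0 < Real.sin (d / 2) := Real.sin_pos_of_pos_of_lt_pi (by linarith) (by linarith)
  set c := Real.sin (d / 2) / d with hc
  have hc0 : 0 < c := by positivity
  refine ⟨min 1 c, lt_min one_pos hc0, fun r hr0 hr1 s hs => ?_⟩
  have h1 : 1 - r ≤ ‖circleMap 0 1 s - circleMap 0 r t‖ := by
    have := norm_sub_norm_le (circleMap 0 1 s) (circleMap 0 r t)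
    simpa [abs_of_nonneg hr0] using this
  have h2 := norm_circleMap_sub_le_two_mul s t hr0 hr1.le
  rw [norm_circleMap_one_sub] at h2
  have hst : |s - t| ≤ d := by
    rw [abs_le]
    constructor
    · linarith [hs.1, le_max_left t (2 * Real.pi - t)]
    · linarith [hs.2, le_max_right t (2 * Real.pi - t)]
  have h3 : c * |s - t| ≤ |Real.sin ((s - t) / 2)| := by
    have hab : |Real.sin ((s - t) / 2)| = Real.sin (|s - t| / 2) := by
      rw [Real.abs_sin_eq_sin_abs_of_abs_le_pi]
      · rw [abs_div, abs_two]
      · rw [abs_div, abs_two]; linarith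
    rw [hab]
    have hconc := And.right strictConcaveOn_sin_Icc.concaveOn
      (⟨le_rfl, Real.pi_pos.le⟩ : (0 : ℝ) ∈ Set.Icc 0 Real.pi)
      (⟨by linarith, by linarith⟩ : d / 2 ∈ Set.Icc 0 Real.pi)
      (show 0 ≤ 1 - |s - t| / d by rw [sub_nonneg]; exact (div_le_one hd0).2 hst)
      (show 0 ≤ |s - t| / d by positivity) (by ring)
    simp only [smul_eq_mul, mul_zero, Real.sin_zero, zero_add] at hconc
    rw [show |s - t| / d * (d / 2) = |s - t| / 2 by field_simp] at hconc
    refine le_trans (le_of_eq ?_) hconc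
    rw [hc]; ring
  rw [mul_max_of_nonneg _ _ (lt_min one_pos hc0).le]
  refine max_le ?_ ?_
  · exact (mul_le_of_le_one_left (by linarith) (min_le_left _ _)).trans h1
  · have := mul_le_mul_of_nonneg_right (min_le_right 1 c) (abs_nonneg (s - t))
    linarith

theorem ofReal_div_max_sq_le_tsum {δ : ℝ} (hδ : 0 < δ) (s t : ℝ) :
    ENNReal.ofReal (δ / max δ |s - t| ^ 2) ≤
      ∑' k : ℕ, (Metric.closedBall t (2 ^ k * δ)).indicator
        (fun _ => ENNReal.ofReal (4 * (1 / 4) ^ k / δ)) s := by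
  rcases le_or_gt |s - t| δ with h | h
  · refine le_trans ?_ (ENNReal.le_tsum 0)
    rw [Set.indicator_of_mem (by simpa [Real.dist_eq] using h)]
    refine ENNReal.ofReal_le_ofReal ?_
    rw [max_eq_left h, pow_zero, mul_one, div_le_div_iff₀ (by positivity) hδ]
    nlinarith [sq_nonneg δ]
  · obtain ⟨n, hn1, hn2⟩ := exists_nat_pow_near (show 1 ≤ |s - t| / δ from (one_le_div hδ).2 h.le)
      (one_lt_two : (1 : ℝ) < 2)
    rw [le_div_iff₀ hδ] at hn1
    rw [div_lt_iff₀ hδ] at hn2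
    refine le_trans ?_ (ENNReal.le_tsum (n + 1))
    rw [Set.indicator_of_mem (by simpa [Real.dist_eq] using hn2.le)]
    refine ENNReal.ofReal_le_ofReal ?_
    rw [max_eq_right h.le, div_le_div_iff₀ (pow_pos (hδ.trans h) 2) hδ]
    have e : (4 : ℝ) * (1 / 4) ^ (n + 1) * 4 ^ n = 1 := by
      rw [pow_succ, one_div, inv_pow]; field_simp
    have h2 : (2 ^ n * δ) ^ 2 ≤ |s - t| ^ 2 := by gcongr
    have h3 : ((2 : ℝ) ^ n) ^ 2 = 4 ^ n := by rw [← pow_mul, mul_comm, pow_mul]; norm_num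
    rw [mul_pow, h3] at h2
    calc δ * δ = 4 * (1 / 4) ^ (n + 1) * (4 ^ n * δ ^ 2) := by
          linear_combination (- δ ^ 2) * e
      _ ≤ _ := mul_le_mul_of_nonneg_left h2 (by positivity)

theorem lintegral_div_max_sq_le_tsum {δ : ℝ} (hδ : 0 < δ) (t : ℝ) {F : ℝ → ℝ≥0∞}
    (hF : AEMeasurable F) :
    ∫⁻ s, ENNReal.ofReal (δ / max δ |s - t| ^ 2) * F s ≤
      ∑' k : ℕ, ENNReal.ofReal (4 * (1 / 4) ^ k / δ) *
        ∫⁻ s in Metric.closedBall t (2 ^ k * δ), F s := by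
  calc _ ≤ ∫⁻ s, ∑' k : ℕ, (Metric.closedBall t (2 ^ k * δ)).indicator
        (fun s => ENNReal.ofReal (4 * (1 / 4) ^ k / δ) * F s) s := by
        refine lintegral_mono fun s => ?_
        refine (mul_le_mul_left (ofReal_div_max_sq_le_tsum hδ s t) _).trans ?_
        rw [← ENNReal.tsum_mul_right]
        refine ENNReal.tsum_le_tsum fun k => ?_
        by_cases h : s ∈ Metric.closedBall t (2 ^ k * δ)
        · simp only [Set.indicator_of_mem h]; exact le_rfl
        · simp only [Set.indicator_of_notMem h, zero_mul]; exact le_rfl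
    _ = _ := by
        rw [lintegral_tsum fun k => (hF.const_mul _).indicator Metric.isClosed_closedBall.measurableSet]
        refine tsum_congr fun k => ?_
        rw [lintegral_indicator Metric.isClosed_closedBall.measurableSet,
          lintegral_const_mul' _ _ ENNReal.ofReal_ne_top]

theorem tendsto_tsum_dyadic_average {A : ℝ → ℝ≥0∞} (hA : Tendsto A (𝓝[>] 0) (𝓝 0)) {B : ℝ≥0∞}
    (hB : B ≠ ∞) (hAB : ∀ x, 0 < x → A x ≤ B) :
    Tendsto (fun δ : ℝ => ∑' k : ℕ, ENNReal.ofReal (8 * (1 / 2) ^ k) * A (2 ^ k * δ))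
      (𝓝[>] 0) (𝓝 0) := by
  have hsum : ∑' k : ℕ, ENNReal.ofReal (8 * (1 / 2) ^ k) * B ≠ ∞ := by
    rw [ENNReal.tsum_mul_right]
    refine ENNReal.mul_ne_top ?_ hB
    have : Summable fun k : ℕ => (8 : ℝ) * (1 / 2) ^ k := summable_geometric_two.mul_left 8
    exact this.tsum_ofReal_ne_top
  simp only [← lintegral_count] at hsum ⊢
  have := tendsto_lintegral_filter_of_dominated_convergence (μ := (Measure.count : Measure ℕ))
    (l := 𝓝[>] (0 : ℝ)) (F := fun δ k => ENNReal.ofReal (8 * (1 / 2) ^ k) * A (2 ^ k * δ))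
    (f := fun _ => 0) (fun k => ENNReal.ofReal (8 * (1 / 2) ^ k) * B)
    (Eventually.of_forall fun δ => measurable_of_countable _) ?_ hsum ?_
  · simpa using this
  · filter_upwards [self_mem_nhdsWithin] with δ hδ
    exact Eventually.of_forall fun k => mul_le_mul_right (hAB _ (mul_pos (by positivity) hδ)) _
  · refine Eventually.of_forall fun k => ?_
    have h1 : Tendsto (fun δ : ℝ => 2 ^ k * δ) (𝓝[>] 0) (𝓝[>] 0) := by
      refine tendsto_nhdsWithin_iff.2 ⟨?_, ?_⟩
      · have : Tendsto (fun δ : ℝ => 2 ^ k * δ) (𝓝 0) (𝓝 (2 ^ k * 0)) :=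
          (continuous_const.mul continuous_id).tendsto 0
        rw [mul_zero] at this
        exact this.mono_left nhdsWithin_le_nhds
      · filter_upwards [self_mem_nhdsWithin] with δ hδ
        exact mul_pos (pow_pos two_pos k) (Set.mem_Ioi.1 hδ)
    have h2 := ENNReal.Tendsto.const_mul (a := ENNReal.ofReal (8 * (1 / 2) ^ k)) (hA.comp h1)
      (Or.inr ENNReal.ofReal_ne_top)
    rw [mul_zero] at h2
    exact h2

/-- Fatou's theorem on radial limits, for holomorphic functions converging to `G` in `L¹`. -/
theorem ae_tendsto_radial {g : ℂ → ℂ}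
    (hg : DifferentiableOn ℂ g (Metric.ball 0 1)) {G : ℝ → ℂ}
    (hG : Integrable G circleSigma) {ρ : ℕ → ℝ} (hρ0 : ∀ n, 0 < ρ n)
    (hρ1 : ∀ n, ρ n < 1) (hρ : Tendsto ρ atTop (𝓝 1))
    (hlim : Tendsto (fun n => ∫⁻ t, ‖g (circleMap 0 (ρ n) t) - G t‖ₑ ∂circleSigma) atTop (𝓝 0)) :
    ∀ᵐ t ∂circleSigma, Tendsto (fun r => g (circleMap 0 r t)) (𝓝[<] 1) (𝓝 (G t)) := by
  have hpi := Real.pi_pos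
  set S := Set.Ioc 0 (2 * Real.pi) with hS
  have hc0 : (ENNReal.ofReal (2 * Real.pi))⁻¹ ≠ 0 := ENNReal.inv_ne_zero.2 ENNReal.ofReal_ne_top
  have hGS : IntegrableOn G S := by
    have := hG
    rw [circleSigma, integrable_smul_measure hc0 (by simp [hpi])] at this
    exact this
  set H : ℝ → ℂ := S.indicator G with hH
  have hHi : Integrable H := (integrable_indicator_iff measurableSet_Ioc).2 hGS
  have hleb := (IsUnifLocDoublingMeasure.vitaliFamily (volume : Measure ℝ) 1).ae_tendsto_lintegral_enorm_sub_div
    hHi.locallyIntegrable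
  have hac : circleSigma ≪ volume := by
    refine (Measure.smul_absolutelyContinuous).trans ?_
    exact Measure.absolutelyContinuous_of_le Measure.restrict_le_self
  have hS_ae : ∀ᵐ t ∂circleSigma, t ∈ Set.Ioo 0 (2 * Real.pi) := by
    have h1 : ∀ᵐ t ∂circleSigma, t ∈ S :=
      Measure.smul_absolutelyContinuous.ae_le (ae_restrict_mem measurableSet_Ioc)
    have h2 : ∀ᵐ t ∂circleSigma, t ≠ 2 * Real.pi := hac.ae_le (Measure.ae_ne volume _)
    filter_upwards [h1, h2] with t h1 h2 using ⟨h1.1, lt_of_le_of_ne h1.2 h2⟩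
  filter_upwards [hac.ae_le hleb, hS_ae] with t hlt htS
  have hHt : H t = G t := Set.indicator_of_mem (Set.Ioo_subset_Ioc_self htS) _
  set F : ℝ → ℝ≥0∞ := fun s => ‖H s - H t‖ₑ with hF
  have hFm : AEMeasurable F := (hHi.aestronglyMeasurable.sub aestronglyMeasurable_const).enorm
  set A : ℝ → ℝ≥0∞ := fun x => (∫⁻ s in Metric.closedBall t x, F s) / ENNReal.ofReal (2 * x) with hA
  have hA0 : Tendsto A (𝓝[>] 0) (𝓝 0) := by
    have h1 : Tendsto (fun x : ℝ => Metric.closedBall t x) (𝓝[>] 0)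
        ((IsUnifLocDoublingMeasure.vitaliFamily (volume : Measure ℝ) 1).filterAt t) := by
      refine IsUnifLocDoublingMeasure.tendsto_closedBall_filterAt volume (K := 1) (fun _ => t)
        (fun x => x) tendsto_id ?_
      filter_upwards [self_mem_nhdsWithin] with x hx
      rw [Metric.mem_closedBall, dist_self, one_mul]
      exact le_of_lt hx
    refine (hlt.comp h1).congr fun x => ?_
    simp [hA, hF, Real.volume_closedBall]
  obtain ⟨B, hB, hAB⟩ : ∃ B : ℝ≥0∞, B ≠ ∞ ∧ ∀ x, 0 < x → A x ≤ B := by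
    have hev := hA0.eventually (ge_mem_nhds (zero_lt_one : (0 : ℝ≥0∞) < 1))
    rw [eventually_nhdsWithin_iff, Metric.eventually_nhds_iff] at hev
    obtain ⟨x₀, hx₀, hsmall⟩ := hev
    refine ⟨1 + ((∫⁻ s, ‖H s‖ₑ) / ENNReal.ofReal (2 * x₀) + ‖H t‖ₑ), ?_, fun x hx => ?_⟩
    · have h1 : (∫⁻ s, ‖H s‖ₑ) ≠ ∞ := hHi.hasFiniteIntegral.ne
      have h2 : (∫⁻ s, ‖H s‖ₑ) / ENNReal.ofReal (2 * x₀) ≠ ∞ :=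
        ENNReal.div_ne_top h1 (by simpa using hx₀)
      exact ENNReal.add_ne_top.2 ⟨ENNReal.one_ne_top, ENNReal.add_ne_top.2 ⟨h2, enorm_ne_top⟩⟩
    · rcases lt_or_ge x x₀ with h | h
      · refine (hsmall ?_ hx).trans le_self_add
        rwa [Real.dist_eq, sub_zero, abs_of_pos hx]
      · refine le_trans ?_ le_add_self
        have hx2 : ENNReal.ofReal (2 * x) ≠ 0 := by simpa using hx
        calc A x ≤ (∫⁻ s in Metric.closedBall t x, (‖H s‖ₑ + ‖H t‖ₑ)) / ENNReal.ofReal (2 * x) := by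
              refine ENNReal.div_le_div_right (lintegral_mono fun s => ?_) _
              exact enorm_sub_le
          _ = (∫⁻ s in Metric.closedBall t x, ‖H s‖ₑ) / ENNReal.ofReal (2 * x) + ‖H t‖ₑ := by
              rw [lintegral_add_right _ measurable_const, ENNReal.add_div]
              congr 1
              rw [lintegral_const, Measure.restrict_apply_univ, Real.volume_closedBall]
              exact ENNReal.mul_div_cancel_right hx2 ENNReal.ofReal_ne_top
          _ ≤ _ := by
              refine add_le_add ?_ le_rfl
              exact ENNReal.div_le_div (setLIntegral_le_lintegral _ _)
                (ENNReal.ofReal_le_ofReal (by linarith))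
  have hdy := tendsto_tsum_dyadic_average hA0 hB hAB
  obtain ⟨κ, hκ, hκle⟩ := exists_mul_max_le_norm_circleMap_sub htS
  have hbound : ∀ r, 0 ≤ r → r < 1 → ‖g (circleMap 0 r t) - G t‖ₑ ≤ ENNReal.ofReal (2 / κ ^ 2) *
      ∑' k : ℕ, ENNReal.ofReal (8 * (1 / 2) ^ k) * A (2 ^ k * (1 - r)) := by
    intro r hr0 hr1
    have hδ : 0 < 1 - r := by linarith
    have hzn : ‖circleMap 0 r t‖ = r := by simp [abs_of_nonneg hr0]
    refine (enorm_sub_le_lintegral_poissonKernel hg hG.aestronglyMeasurable hρ0 hρ1 hρ hlim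
      (by rw [hzn]; exact hr1) (G t)).trans ?_
    calc _ ≤ ∫⁻ s in S, ENNReal.ofReal (poissonKernel 0 (circleMap 0 r t) (circleMap 0 1 s)) *
          ‖G s - G t‖ₑ := by
          rw [circleSigma, lintegral_smul_measure]
          refine mul_le_of_le_one_left zero_le (ENNReal.inv_le_one.2 ?_)
          rw [ENNReal.one_le_ofReal]
          linarith [Real.two_le_pi]
      _ ≤ ∫⁻ s in S, ENNReal.ofReal (2 / κ ^ 2) *
          (ENNReal.ofReal ((1 - r) / max (1 - r) |s - t| ^ 2) * F s) := by
          refine setLIntegral_mono' measurableSet_Ioc fun s hs => ?_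
          have hHs : H s = G s := Set.indicator_of_mem hs _
          rw [← mul_assoc, ← ENNReal.ofReal_mul (by positivity), hF]
          simp only
          rw [hHs, hHt]
          refine mul_le_mul_left (ENNReal.ofReal_le_ofReal ?_) _
          have hm : 0 < max (1 - r) |s - t| := lt_max_of_lt_left hδ
          refine (poissonKernel_zero_le (by rw [hzn]; exact hr1) (by simp) (mul_pos hκ hm)
            (hκle r hr0 hr1 s hs)).trans (le_of_eq ?_)
          rw [hzn, mul_pow]
          field_simp
      _ ≤ ∫⁻ s, ENNReal.ofReal (2 / κ ^ 2) *
          (ENNReal.ofReal ((1 - r) / max (1 - r) |s - t| ^ 2) * F s) :=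
          setLIntegral_le_lintegral _ _
      _ = ENNReal.ofReal (2 / κ ^ 2) *
          ∫⁻ s, ENNReal.ofReal ((1 - r) / max (1 - r) |s - t| ^ 2) * F s :=
          lintegral_const_mul' _ _ ENNReal.ofReal_ne_top
      _ ≤ _ := by
          refine mul_le_mul_right ((lintegral_div_max_sq_le_tsum hδ t hFm).trans (le_of_eq ?_)) _
          refine tsum_congr fun k => ?_
          simp only [hA]
          have h2 : 0 < 2 * (2 ^ k * (1 - r)) := by positivity
          rw [ENNReal.div_eq_inv_mul, ← mul_assoc, ← div_eq_mul_inv (ENNReal.ofReal _),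
            ← ENNReal.ofReal_div_of_pos h2]
          congr 2
          rw [show (1 / 4 : ℝ) = 1 / 2 * (1 / 2) by norm_num, mul_pow, one_div, inv_pow]
          field_simp
          ring
  have hδ0 : Tendsto (fun r : ℝ => 1 - r) (𝓝[<] 1) (𝓝[>] 0) := by
    refine tendsto_nhdsWithin_iff.2 ⟨?_, ?_⟩
    · have : Tendsto (fun r : ℝ => 1 - r) (𝓝 1) (𝓝 (1 - 1)) :=
        (continuous_const.sub continuous_id).tendsto 1
      rw [sub_self] at this
      exact this.mono_left nhdsWithin_le_nhds
    · filter_upwards [self_mem_nhdsWithin] with r hr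
      exact sub_pos.2 (Set.mem_Iio.1 hr)
  have hfin := ENNReal.Tendsto.const_mul (a := ENNReal.ofReal (2 / κ ^ 2)) (hdy.comp hδ0)
    (Or.inr ENNReal.ofReal_ne_top)
  rw [mul_zero] at hfin
  rw [tendsto_iff_edist_tendsto_0]
  refine tendsto_of_tendsto_of_tendsto_of_le_of_le' tendsto_const_nhds hfin
    (Eventually.of_forall fun _ => zero_le) ?_
  filter_upwards [Ioo_mem_nhdsLT (show (0 : ℝ) < 1 from one_pos)] with r hr
  rw [edist_eq_enorm_sub]
  exact hbound r hr.1.le hr.2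

theorem integralMean_eq_eLpNorm {p : ℝ} (hp : 0 < p) (f : ℂ → ℂ) (r : ℝ) :
    integralMean p f r = eLpNorm (fun t => f (circleMap 0 r t)) (ENNReal.ofReal p) circleSigma := by
  rw [eLpNorm_eq_lintegral_rpow_enorm_toReal (by simpa using hp) ENNReal.ofReal_ne_top,
    ENNReal.toReal_ofReal hp.le, integralMean]

theorem enorm_sq_add_sq_rpow_half {p : ℝ} (hp : 0 ≤ p) (a b : ℂ) :
    (‖a‖ₑ ^ 2 + ‖b‖ₑ ^ 2) ^ (p / 2) = ‖√(‖a‖ ^ 2 + ‖b‖ ^ 2)‖ₑ ^ p := by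
  rw [Real.enorm_eq_ofReal (Real.sqrt_nonneg _), ← ofReal_norm, ← ofReal_norm,
    ← ENNReal.ofReal_pow (norm_nonneg _), ← ENNReal.ofReal_pow (norm_nonneg _),
    ← ENNReal.ofReal_add (by positivity) (by positivity),
    ENNReal.ofReal_rpow_of_nonneg (by positivity) (by linarith),
    ENNReal.ofReal_rpow_of_nonneg (Real.sqrt_nonneg _) hp, Real.sqrt_eq_rpow,
    ← Real.rpow_mul (by positivity)]
  ring_nf

theorem boundaryNorm_eq_eLpNorm {p : ℝ} (hp : 0 < p) {g h : ℂ → ℂ} {G H : ℝ → ℂ}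
    (hG : ∀ᵐ t ∂circleSigma, boundaryValue g t = G t)
    (hH : ∀ᵐ t ∂circleSigma, boundaryValue h t = H t) :
    boundaryNorm p g h =
      eLpNorm (fun t => √(‖G t‖ ^ 2 + ‖H t‖ ^ 2)) (ENNReal.ofReal p) circleSigma := by
  rw [eLpNorm_eq_lintegral_rpow_enorm_toReal (by simpa using hp) ENNReal.ofReal_ne_top,
    ENNReal.toReal_ofReal hp.le, boundaryNorm]
  congr 1
  refine lintegral_congr_ae ?_
  filter_upwards [hG, hH] with t hGt hHt
  rw [hGt, hHt, enorm_sq_add_sq_rpow_half hp.le]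

theorem rieszConstant_pos {p : ℝ} (hp : 1 < p) : 0 < rieszConstant p := by
  have hpi := Real.pi_pos
  refine mul_pos (by positivity) (lt_max_of_lt_right (Real.cos_pos_of_mem_Ioo
    ⟨by linarith [show 0 < Real.pi / (2 * p) by positivity], ?_⟩))
  gcongr
  linarith

theorem sqrt_sq_add_sq_le_of_le {a b x y d e : ℝ} (ha : 0 ≤ a) (hb : 0 ≤ b)
    (hd : 0 ≤ d) (he : 0 ≤ e) (hax : a ≤ x + d) (hby : b ≤ y + e) :
    √(a ^ 2 + b ^ 2) ≤ √(x ^ 2 + y ^ 2) + (d + e) := by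
  have hN := Real.sqrt_nonneg (x ^ 2 + y ^ 2)
  have hN2 := Real.sq_sqrt (show 0 ≤ x ^ 2 + y ^ 2 by positivity)
  have hxN : x ≤ √(x ^ 2 + y ^ 2) := Real.le_sqrt_of_sq_le (by nlinarith)
  have hyN : y ≤ √(x ^ 2 + y ^ 2) := Real.le_sqrt_of_sq_le (by nlinarith)
  rw [Real.sqrt_le_left (by positivity)]
  have h1 : a ^ 2 ≤ (x + d) ^ 2 := by gcongr
  have h2 : b ^ 2 ≤ (y + e) ^ 2 := by gcongr
  nlinarith [mul_nonneg hd (sub_nonneg.2 hxN), mul_nonneg he (sub_nonneg.2 hyN), mul_nonneg hd he]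

/-- The sharp inequality on circles of radius less than one, for `L^p` norms. -/
theorem integralMean_le_rieszConstant_mul {p : ℝ} (hp : 1 < p) {f g h : ℂ → ℂ}
    (hf : IsHarmonicDecomposition f g h) (h0 : (g 0 * h 0).re ≤ 0) {r : ℝ} (hr0 : 0 ≤ r)
    (hr1 : r < 1) :
    integralMean p f r ≤ ENNReal.ofReal (rieszConstant p) *
      eLpNorm (fun t => √(‖g (circleMap 0 r t)‖ ^ 2 + ‖h (circleMap 0 r t)‖ ^ 2))
        (ENNReal.ofReal p) circleSigma := by
  have hp0 : 0 < p := by linarith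
  have hP0 : ENNReal.ofReal p ≠ 0 := by simpa using hp0
  have hC := (rieszConstant_pos hp).le
  have hgc := hf.holo_left.continuousOn
  have hhc := hf.holo_right.continuousOn
  have hfc : ContinuousOn f (Metric.ball 0 1) :=
    (hgc.add (Complex.continuous_conj.comp_continuousOn hhc)).congr hf.eq_on
  have hNc : ContinuousOn (fun z => ((√(‖g z‖ ^ 2 + ‖h z‖ ^ 2) : ℝ) : ℂ)) (Metric.ball 0 1) :=
    Complex.continuous_ofReal.comp_continuousOn
      (((hgc.norm.pow 2).add (hhc.norm.pow 2)).sqrt)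
  have hN := (memLp_circleMap hNc hr0 hr1 (ENNReal.ofReal p)).norm
  simp only [Complex.norm_real, Real.norm_eq_abs, abs_of_nonneg (Real.sqrt_nonneg _)] at hN
  rw [integralMean_eq_eLpNorm hp0, MemLp.eLpNorm_eq_integral_rpow_norm hP0 ENNReal.ofReal_ne_top
    (memLp_circleMap hfc hr0 hr1 _), MemLp.eLpNorm_eq_integral_rpow_norm hP0 ENNReal.ofReal_ne_top hN,
    ENNReal.toReal_ofReal hp0.le, ← ENNReal.ofReal_mul hC]
  refine ENNReal.ofReal_le_ofReal ?_
  have key := integral_norm_rpow_le_sharp hp hf.holo_left hf.holo_right h0 hr0 hr1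
  have e1 : ∀ t, g (circleMap 0 r t) + conj (h (circleMap 0 r t)) = f (circleMap 0 r t) := fun t =>
    (hf.eq_on _ (Metric.closedBall_subset_ball hr1
      (Metric.sphere_subset_closedBall (circleMap_mem_sphere 0 hr0 t)))).symm
  have e2 : ∀ t, (‖g (circleMap 0 r t)‖ ^ 2 + ‖h (circleMap 0 r t)‖ ^ 2) ^ (p / 2) =
      ‖√(‖g (circleMap 0 r t)‖ ^ 2 + ‖h (circleMap 0 r t)‖ ^ 2)‖ ^ p := fun t => by
    rw [Real.norm_eq_abs, abs_of_nonneg (Real.sqrt_nonneg _), ← sq_rpow_half (Real.sqrt_nonneg _),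
      Real.sq_sqrt (by positivity)]
  simp only [e1, e2] at key
  calc _ ≤ (rieszConstant p ^ p * ∫ t, ‖√(‖g (circleMap 0 r t)‖ ^ 2 +
        ‖h (circleMap 0 r t)‖ ^ 2)‖ ^ p ∂circleSigma) ^ p⁻¹ :=
        Real.rpow_le_rpow (integral_nonneg fun t => by positivity) key (by positivity)
    _ = _ := by
        rw [Real.mul_rpow (by positivity) (integral_nonneg fun t => by positivity),
          ← Real.rpow_mul hC, mul_inv_cancel₀ hp0.ne', Real.rpow_one]

theorem integralMean_mono {p : ℝ} (hp : 1 < p) {f g h : ℂ → ℂ}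
    (hf : IsHarmonicDecomposition f g h) {s r : ℝ} (hs : 0 ≤ s) (hsr : s ≤ r) (hr : r < 1) :
    integralMean p f s ≤ integralMean p f r := by
  have hp0 : 0 < p := by linarith
  have hP0 : ENNReal.ofReal p ≠ 0 := by simpa using hp0
  have hfc : ContinuousOn f (Metric.ball 0 1) :=
    (hf.holo_left.continuousOn.add
      (Complex.continuous_conj.comp_continuousOn hf.holo_right.continuousOn)).congr hf.eq_on
  have key := integral_norm_rpow_mono hp hf.holo_left hf.holo_right hs hsr hr
  have e1 {r : ℝ} (hr0 : 0 ≤ r) (hr1 : r < 1) :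
      ∀ t, g (circleMap 0 r t) + conj (h (circleMap 0 r t)) = f (circleMap 0 r t) := fun t =>
    (hf.eq_on _ (Metric.closedBall_subset_ball hr1
      (Metric.sphere_subset_closedBall (circleMap_mem_sphere 0 hr0 t)))).symm
  simp only [e1 hs (hsr.trans_lt hr), e1 (hs.trans hsr) hr] at key
  rw [integralMean_eq_eLpNorm hp0, integralMean_eq_eLpNorm hp0,
    MemLp.eLpNorm_eq_integral_rpow_norm hP0 ENNReal.ofReal_ne_top
      (memLp_circleMap hfc hs (hsr.trans_lt hr) _),
    MemLp.eLpNorm_eq_integral_rpow_norm hP0 ENNReal.ofReal_ne_top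
      (memLp_circleMap hfc (hs.trans hsr) hr _), ENNReal.toReal_ofReal hp0.le]
  exact ENNReal.ofReal_le_ofReal
    (Real.rpow_le_rpow (integral_nonneg fun t => by positivity) key (by positivity))

theorem exists_bound_of_hardyNorm_lt_top {p : ℝ} (hp : 1 < p) {f g h : ℂ → ℂ}
    (hf : IsHarmonicDecomposition f g h) (hfin : hardyNorm p f < ∞) :
    ∃ M : ℝ, ∀ r, 0 < r → r < 1 →
      ∫ t, ‖g (circleMap 0 r t) + conj (h (circleMap 0 r t))‖ ^ p ∂circleSigma ≤ M := by
  have hp0 : 0 < p := by linarith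
  have hP0 : ENNReal.ofReal p ≠ 0 := by simpa using hp0
  have hfc : ContinuousOn f (Metric.ball 0 1) :=
    (hf.holo_left.continuousOn.add
      (Complex.continuous_conj.comp_continuousOn hf.holo_right.continuousOn)).congr hf.eq_on
  refine ⟨(hardyNorm p f).toReal ^ p, fun r hr0 hr1 => ?_⟩
  have e1 : ∀ t, g (circleMap 0 r t) + conj (h (circleMap 0 r t)) = f (circleMap 0 r t) := fun t =>
    (hf.eq_on _ (Metric.closedBall_subset_ball hr1
      (Metric.sphere_subset_closedBall (circleMap_mem_sphere 0 hr0.le t)))).symm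
  simp only [e1]
  have h1 : integralMean p f r ≤ hardyNorm p f := le_iSup₂_of_le r ⟨hr0, hr1⟩ le_rfl
  have hI : 0 ≤ ∫ t, ‖f (circleMap 0 r t)‖ ^ p ∂circleSigma :=
    integral_nonneg fun t => by positivity
  rw [integralMean_eq_eLpNorm hp0, MemLp.eLpNorm_eq_integral_rpow_norm hP0 ENNReal.ofReal_ne_top
      (memLp_circleMap hfc hr0.le hr1 _), ENNReal.toReal_ofReal hp0.le,
      ENNReal.ofReal_le_iff_le_toReal hfin.ne] at h1
  have h2 := Real.rpow_le_rpow (by positivity) h1 hp0.le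
  rwa [← Real.rpow_mul hI, inv_mul_cancel₀ hp0.ne', Real.rpow_one] at h2

/-- The existence of boundary values and the sharp inequality. -/
theorem hardyNorm_le_rieszConstant_mul_boundaryNorm {p : ℝ} (hp : 1 < p) {f g h : ℂ → ℂ}
    (hf : IsHarmonicDecomposition f g h) (hfin : hardyNorm p f < ∞) (h0 : (g 0 * h 0).re ≤ 0) :
    (∀ᵐ t ∂circleSigma, HasRadialLimit g t ∧ HasRadialLimit h t) ∧ boundaryNorm p g h < ∞ ∧
      hardyNorm p f ≤ ENNReal.ofReal (rieszConstant p) * boundaryNorm p g h := by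
  have hp0 : 0 < p := by linarith
  have hP1 : 1 ≤ ENNReal.ofReal p := by simpa using hp.le
  obtain ⟨M, hM⟩ := exists_bound_of_hardyNorm_lt_top hp hf hfin
  obtain ⟨M', hM'⟩ := exists_bound_integral_norm_rpow hp hf.holo_left hf.holo_right hM
  obtain ⟨ρ, -, hρmem, hρ⟩ := exists_seq_strictMono_tendsto' (show (0 : ℝ) < 1 from one_pos)
  have hρ0 : ∀ n, 0 < ρ n := fun n => (hρmem n).1
  have hρ1 : ∀ n, ρ n < 1 := fun n => (hρmem n).2
  have hbd {u : ℂ → ℂ} (hu : DifferentiableOn ℂ u (Metric.ball 0 1))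
      (hb : ∀ r, 0 < r → r < 1 → ∫ t, ‖u (circleMap 0 r t)‖ ^ p ∂circleSigma ≤ M') :
      ∃ U : ℝ → ℂ, MemLp U (ENNReal.ofReal p) circleSigma ∧
      Tendsto (fun n => eLpNorm (fun t => u (circleMap 0 (ρ n) t) - U t) (ENNReal.ofReal p)
        circleSigma) atTop (𝓝 0) ∧
      ∀ᵐ t ∂circleSigma, Tendsto (fun r => u (circleMap 0 r t)) (𝓝[<] 1) (𝓝 (U t)) := by
    obtain ⟨U, hU, hlim⟩ := exists_Lp_boundary_function hp hu hb hρ0 hρ1 hρ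
    refine ⟨U, hU, hlim, ae_tendsto_radial hu (hU.integrable hP1) hρ0 hρ1 hρ ?_⟩
    refine tendsto_of_tendsto_of_tendsto_of_le_of_le tendsto_const_nhds hlim (fun _ => zero_le)
      fun n => ?_
    simp only
    rw [← eLpNorm_one_eq_lintegral_enorm]
    exact eLpNorm_le_eLpNorm_of_exponent_le hP1
      ((memLp_circleMap hu.continuousOn (hρ0 n).le (hρ1 n) (ENNReal.ofReal p)).sub hU).aestronglyMeasurable
  obtain ⟨G, hG, hGlim, hGae⟩ := hbd hf.holo_left fun r hr0 hr1 => (hM' r hr0 hr1).1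
  obtain ⟨H, hH, hHlim, hHae⟩ := hbd hf.holo_right fun r hr0 hr1 => (hM' r hr0 hr1).2
  have hbn := boundaryNorm_eq_eLpNorm hp0 (hGae.mono fun t ht => ht.limUnder_eq)
    (hHae.mono fun t ht => ht.limUnder_eq)
  have hNm : AEStronglyMeasurable (fun t => √(‖G t‖ ^ 2 + ‖H t‖ ^ 2)) circleSigma :=
    Real.continuous_sqrt.comp_aestronglyMeasurable
      ((hG.aestronglyMeasurable.norm.pow 2).add (hH.aestronglyMeasurable.norm.pow 2))
  refine ⟨?_, ?_, ?_⟩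
  · filter_upwards [hGae, hHae] with t h1 h2 using ⟨⟨_, h1⟩, ⟨_, h2⟩⟩
  · rw [hbn]
    have : MemLp (fun t => ‖G t‖ + ‖H t‖) (ENNReal.ofReal p) circleSigma := hG.norm.add hH.norm
    refine (this.mono' hNm (Eventually.of_forall fun t => ?_)).2
    rw [Real.norm_eq_abs, abs_of_nonneg (Real.sqrt_nonneg _)]
    have := sqrt_sq_add_sq_le_of_le (x := 0) (y := 0) (norm_nonneg (G t)) (norm_nonneg (H t))
      (norm_nonneg (G t)) (norm_nonneg (H t)) (by simp) (by simp)
    simpa using this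
  · rw [hbn]
    refine iSup₂_le fun r hr => ?_
    have hup : Tendsto (fun n => ENNReal.ofReal (rieszConstant p) *
        (eLpNorm (fun t => √(‖G t‖ ^ 2 + ‖H t‖ ^ 2)) (ENNReal.ofReal p) circleSigma +
          (eLpNorm (fun t => g (circleMap 0 (ρ n) t) - G t) (ENNReal.ofReal p) circleSigma +
          eLpNorm (fun t => h (circleMap 0 (ρ n) t) - H t) (ENNReal.ofReal p) circleSigma))) atTop
        (𝓝 (ENNReal.ofReal (rieszConstant p) *
          eLpNorm (fun t => √(‖G t‖ ^ 2 + ‖H t‖ ^ 2)) (ENNReal.ofReal p) circleSigma)) := by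
      refine ENNReal.Tendsto.const_mul ?_ (Or.inr ENNReal.ofReal_ne_top)
      simpa using (hGlim.add hHlim).const_add
        (eLpNorm (fun t => √(‖G t‖ ^ 2 + ‖H t‖ ^ 2)) (ENNReal.ofReal p) circleSigma)
    refine ge_of_tendsto hup ?_
    filter_upwards [hρ.eventually (lt_mem_nhds hr.2)] with n hn
    refine (integralMean_mono hp hf hr.1.le hn.le (hρ1 n)).trans
      ((integralMean_le_rieszConstant_mul hp hf h0 (hρ0 n).le (hρ1 n)).trans ?_)
    refine mul_le_mul_right ?_ _
    have m1 := (memLp_circleMap hf.holo_left.continuousOn (hρ0 n).le (hρ1 n) (ENNReal.ofReal p)).sub hG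
    have m2 := (memLp_circleMap hf.holo_right.continuousOn (hρ0 n).le (hρ1 n) (ENNReal.ofReal p)).sub hH
    calc _ ≤ eLpNorm ((fun t => √(‖G t‖ ^ 2 + ‖H t‖ ^ 2)) + ((fun t => ‖g (circleMap 0 (ρ n) t) - G t‖) +
          fun t => ‖h (circleMap 0 (ρ n) t) - H t‖)) (ENNReal.ofReal p) circleSigma := by
          refine eLpNorm_mono_real fun t => ?_
          rw [Real.norm_eq_abs, abs_of_nonneg (Real.sqrt_nonneg _)]
          refine sqrt_sq_add_sq_le_of_le (norm_nonneg _) (norm_nonneg _) (norm_nonneg _)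
            (norm_nonneg _) ?_ ?_
          · simpa using norm_add_le (G t) (g (circleMap 0 (ρ n) t) - G t)
          · simpa using norm_add_le (H t) (h (circleMap 0 (ρ n) t) - H t)
      _ ≤ _ := by
          refine (eLpNorm_add_le hNm (m1.norm.add m2.norm).aestronglyMeasurable hP1).trans
            (add_le_add le_rfl ?_)
          refine (eLpNorm_add_le m1.norm.aestronglyMeasurable m2.norm.aestronglyMeasurable hP1).trans ?_
          exact (add_le_add (eLpNorm_norm _).le (eLpNorm_norm _).le)

theorem norm_one_sub_circleMap (t : ℝ) : ‖1 - circleMap 0 1 t‖ = 2 * |Real.sin (t / 2)| := by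
  have := norm_circleMap_one_sub t 0
  rw [sub_zero, norm_sub_rev] at this
  simpa [circleMap] using this

theorem min_le_mul_norm_one_sub_circleMap {t : ℝ} (ht : t ∈ Set.Icc 0 (2 * Real.pi)) :
    min t (2 * Real.pi - t) ≤ Real.pi / 2 * ‖1 - circleMap 0 1 t‖ := by
  have hpi := Real.pi_pos
  rw [norm_one_sub_circleMap, ← mul_assoc, div_mul_cancel₀ _ two_ne_zero]
  rcases le_total t Real.pi with h | h
  · have := Real.mul_le_sin (x := t / 2) (by linarith [ht.1]) (by linarith)
    refine (min_le_left _ _).trans ?_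
    calc t = Real.pi * (2 / Real.pi * (t / 2)) := by field_simp
      _ ≤ Real.pi * |Real.sin (t / 2)| := by gcongr; exact this.trans (le_abs_self _)
  · have := Real.mul_le_sin (x := Real.pi - t / 2) (by linarith [ht.2]) (by linarith)
    rw [Real.sin_pi_sub] at this
    refine (min_le_right _ _).trans ?_
    calc 2 * Real.pi - t = Real.pi * (2 / Real.pi * (Real.pi - t / 2)) := by field_simp
      _ ≤ Real.pi * |Real.sin (t / 2)| := by gcongr; exact this.trans (le_abs_self _)

theorem norm_one_sub_circleMap_pos {t : ℝ} (ht : t ∈ Set.Ioo 0 (2 * Real.pi)) :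
    0 < ‖1 - circleMap 0 1 t‖ := by
  have h1 := min_le_mul_norm_one_sub_circleMap (Set.Ioo_subset_Icc_self ht)
  have h2 : 0 < min t (2 * Real.pi - t) := lt_min ht.1 (by linarith [ht.2])
  exact (pos_iff_pos_of_mul_pos (h2.trans_le h1)).1 (by positivity)

theorem ae_mem_Ioo_circleSigma : ∀ᵐ t ∂circleSigma, t ∈ Set.Ioo 0 (2 * Real.pi) := by
  have h1 : ∀ᵐ t ∂circleSigma, t ∈ Set.Ioc 0 (2 * Real.pi) :=
    Measure.smul_absolutelyContinuous.ae_le (ae_restrict_mem measurableSet_Ioc)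
  have hac : circleSigma ≪ volume := Measure.smul_absolutelyContinuous.trans
    (Measure.absolutelyContinuous_of_le Measure.restrict_le_self)
  filter_upwards [h1, hac.ae_le (Measure.ae_ne volume (2 * Real.pi))] with t h1 h2
    using ⟨h1.1, lt_of_le_of_ne h1.2 h2⟩

theorem integrable_circleSigma_iff {f : ℝ → ℝ} :
    Integrable f circleSigma ↔ IntegrableOn f (Set.Ioc 0 (2 * Real.pi)) := by
  rw [circleSigma, integrable_smul_measure (ENNReal.inv_ne_zero.2 ENNReal.ofReal_ne_top)
    (by simp [Real.pi_pos])]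
  rfl

theorem integrable_norm_one_sub_circleMap_rpow {a : ℝ} (ha0 : 0 ≤ a) (ha1 : a < 1) :
    Integrable (fun t => ‖1 - circleMap 0 1 t‖ ^ (-a)) circleSigma := by
  have hpi := Real.pi_pos
  have h1 : IntegrableOn (fun t : ℝ => t ^ (-a)) (Set.Ioc 0 (2 * Real.pi)) :=
    (intervalIntegrable_iff_integrableOn_Ioc_of_le (by positivity)).1
      (intervalIntegral.intervalIntegrable_rpow' (by linarith))
  have h2 : IntegrableOn (fun t : ℝ => (2 * Real.pi - t) ^ (-a)) (Set.Ioc 0 (2 * Real.pi)) := by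
    have := (intervalIntegral.intervalIntegrable_rpow' (a := 0) (b := 2 * Real.pi)
      (r := -a) (by linarith)).comp_sub_left (2 * Real.pi)
    rw [sub_zero, sub_self] at this
    exact (intervalIntegrable_iff_integrableOn_Ioc_of_le (by positivity)).1 this.symm
  have h3 := ((integrable_circleSigma_iff.2 h1).add (integrable_circleSigma_iff.2 h2)).const_mul
    ((Real.pi / 2) ^ a)
  have hm : Measurable fun t => ‖1 - circleMap 0 1 t‖ ^ (-a) := by
    have : Measurable fun t => ‖1 - circleMap 0 1 t‖ :=
      (continuous_const.sub (continuous_circleMap 0 1)).norm.measurable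
    exact this.pow_const _
  refine h3.mono' hm.aestronglyMeasurable ?_
  filter_upwards [ae_mem_Ioo_circleSigma] with t ht
  have hq := norm_one_sub_circleMap_pos ht
  have hmin : 0 < min t (2 * Real.pi - t) := lt_min ht.1 (by linarith [ht.2])
  have hle := min_le_mul_norm_one_sub_circleMap (Set.Ioo_subset_Icc_self ht)
  rw [Real.norm_eq_abs, abs_of_pos (Real.rpow_pos_of_pos hq _)]
  have e1 : ‖1 - circleMap 0 1 t‖ ^ (-a) =
      (Real.pi / 2) ^ a * (Real.pi / 2 * ‖1 - circleMap 0 1 t‖) ^ (-a) := by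
    rw [Real.mul_rpow (by positivity) hq.le, ← mul_assoc, ← Real.rpow_add (by positivity),
      add_neg_cancel, Real.rpow_zero, one_mul]
  rw [e1]
  refine mul_le_mul_of_nonneg_left ?_ (by positivity)
  refine (Real.rpow_le_rpow_of_nonpos hmin hle (by linarith)).trans ?_
  have p1 : 0 ≤ t ^ (-a) := Real.rpow_nonneg ht.1.le _
  have p2 : 0 ≤ (2 * Real.pi - t) ^ (-a) := Real.rpow_nonneg (by linarith [ht.2]) _
  simp only [Pi.add_apply]
  rcases min_choice t (2 * Real.pi - t) with h | h <;> rw [h] <;> linarith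

theorem le_setIntegral_norm_one_sub_circleMap_rpow {s δ : ℝ} (hs0 : 0 < s) (hs1 : s < 1)
    (hδ0 : 0 < δ) (hδ1 : δ ≤ 1) :
    δ / (2 * Real.pi * s) ≤
      ∫ t in {t | ‖1 - circleMap 0 1 t‖ < δ}, ‖1 - circleMap 0 1 t‖ ^ (-(1 - s)) ∂circleSigma := by
  have hpi := Real.pi_pos
  have hint := integrable_norm_one_sub_circleMap_rpow (a := 1 - s) (by linarith) (by linarith)
  have hsub : Set.Ioo 0 δ ⊆ {t | ‖1 - circleMap 0 1 t‖ < δ} := by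
    intro t ht
    have h1 : Real.sin (t / 2) < t / 2 := Real.sin_lt (by linarith [ht.1])
    have h2 : 0 ≤ Real.sin (t / 2) :=
      Real.sin_nonneg_of_nonneg_of_le_pi (by linarith [ht.1])
        (by linarith [ht.2, Real.pi_gt_three])
    rw [Set.mem_ofPred_eq, norm_one_sub_circleMap, abs_of_nonneg h2]
    linarith [ht.2]
  refine le_trans ?_ (setIntegral_mono_set hint.integrableOn
    (Eventually.of_forall fun t => by positivity) hsub.eventuallyLE)
  have hinter : Set.Ioo 0 δ ∩ Set.Ioc 0 (2 * Real.pi) = Set.Ioo 0 δ :=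
    Set.inter_eq_left.2 fun t ht => ⟨ht.1, by linarith [ht.2, Real.pi_gt_three]⟩
  rw [circleSigma, Measure.restrict_smul, Measure.restrict_restrict measurableSet_Ioo, hinter,
    integral_smul_measure, ENNReal.toReal_inv, ENNReal.toReal_ofReal (by positivity), smul_eq_mul]
  have h1 : δ / s ≤ ∫ t in Set.Ioo 0 δ, t ^ (-(1 - s)) := by
    rw [← integral_Ioc_eq_integral_Ioo, ← intervalIntegral.integral_of_le hδ0.le,
      integral_rpow (Or.inl (by linarith)), show -(1 - s) + 1 = s by ring,
      Real.zero_rpow hs0.ne', sub_zero]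
    gcongr
    exact Real.self_le_rpow_of_le_one hδ0.le hδ1 hs1.le
  have hi1 : IntegrableOn (fun t : ℝ => t ^ (-(1 - s))) (Set.Ioo 0 δ) :=
    ((intervalIntegrable_iff_integrableOn_Ioc_of_le hδ0.le).1
      (intervalIntegral.intervalIntegrable_rpow' (by linarith))).mono_set Set.Ioo_subset_Ioc_self
  have hi2 : IntegrableOn (fun t => ‖1 - circleMap 0 1 t‖ ^ (-(1 - s))) (Set.Ioo 0 δ) :=
    (integrable_circleSigma_iff.1 hint).mono_set (Set.inter_eq_left.1 hinter)
  have h2 : ∫ t in Set.Ioo 0 δ, t ^ (-(1 - s)) ≤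
      ∫ t in Set.Ioo 0 δ, ‖1 - circleMap 0 1 t‖ ^ (-(1 - s)) := by
    refine setIntegral_mono_on hi1 hi2 measurableSet_Ioo fun t ht => ?_
    have hq := norm_one_sub_circleMap_pos (t := t) ⟨ht.1, by linarith [ht.2, Real.pi_gt_three]⟩
    refine Real.rpow_le_rpow_of_nonpos hq ?_ (by linarith)
    rw [norm_one_sub_circleMap]
    have := Real.abs_sin_le_abs (x := t / 2)
    rw [abs_of_nonneg (show 0 ≤ t / 2 by linarith [ht.1])] at this
    linarith
  calc δ / (2 * Real.pi * s) = (2 * Real.pi)⁻¹ * (δ / s) := by field_simp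
    _ ≤ _ := by gcongr; exact h1.trans h2

/-- As `s → 0` the mass of `|1 - ζ| ^ (s - 1)` concentrates at `ζ = 1`. -/
theorem eventually_mul_integral_lt_mul_setIntegral {c d δ : ℝ} (hc : 0 ≤ c) (hcd : c < d)
    (hδ0 : 0 < δ) (hδ1 : δ ≤ 1) :
    ∀ᶠ s in 𝓝[>] (0 : ℝ), c * ∫ t, ‖1 - circleMap 0 1 t‖ ^ (-(1 - s)) ∂circleSigma <
      d * ∫ t in {t | ‖1 - circleMap 0 1 t‖ < δ}, ‖1 - circleMap 0 1 t‖ ^ (-(1 - s))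
        ∂circleSigma := by
  have hpi := Real.pi_pos
  set s₀ := (d - c) * δ ^ 2 / (2 * Real.pi * (c + 1)) with hs₀
  have hs₀0 : 0 < s₀ := by
    have : 0 < d - c := sub_pos.2 hcd
    positivity
  filter_upwards [Ioo_mem_nhdsGT (show (0 : ℝ) < min 1 s₀ from lt_min one_pos hs₀0)] with s hs
  have hs0 := hs.1
  have hs1 : s < 1 := hs.2.trans_le (min_le_left _ _)
  have hss : s < s₀ := hs.2.trans_le (min_le_right _ _)
  have hint := integrable_norm_one_sub_circleMap_rpow (a := 1 - s) (by linarith) (by linarith)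
  have hN : MeasurableSet {t | ‖1 - circleMap 0 1 t‖ < δ} :=
    (isOpen_lt (continuous_const.sub (continuous_circleMap 0 1)).norm continuous_const).measurableSet
  have hnear := le_setIntegral_norm_one_sub_circleMap_rpow hs0 hs1 hδ0 hδ1
  have hfar : ∫ t in {t | ‖1 - circleMap 0 1 t‖ < δ}ᶜ, ‖1 - circleMap 0 1 t‖ ^ (-(1 - s))
      ∂circleSigma ≤ δ⁻¹ := by
    calc _ ≤ ∫ t in {t | ‖1 - circleMap 0 1 t‖ < δ}ᶜ, δ⁻¹ ∂circleSigma := by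
          refine setIntegral_mono_on hint.integrableOn (integrable_const _).integrableOn hN.compl
            fun t ht => ?_
          have ht : δ ≤ ‖1 - circleMap 0 1 t‖ := by simpa using ht
          refine (Real.rpow_le_rpow_of_nonpos hδ0 ht (by linarith)).trans ?_
          rw [← Real.rpow_neg_one]
          exact Real.rpow_le_rpow_of_exponent_ge hδ0 hδ1 (by linarith)
      _ ≤ δ⁻¹ := by
          rw [setIntegral_const, smul_eq_mul]
          exact mul_le_of_le_one_left (by positivity) measureReal_le_one
  rw [← integral_add_compl hN hint]
  set I := ∫ t in {t | ‖1 - circleMap 0 1 t‖ < δ}, ‖1 - circleMap 0 1 t‖ ^ (-(1 - s)) ∂circleSigma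
  have h1 : (c + 1) * δ⁻¹ < (d - c) * I := by
    refine lt_of_lt_of_le ?_ (mul_le_mul_of_nonneg_left hnear (sub_nonneg.2 hcd.le))
    rw [hs₀, lt_div_iff₀ (by positivity)] at hss
    rw [← div_eq_mul_inv, mul_div_assoc', div_lt_div_iff₀ hδ0 (by positivity)]
    linarith
  have h2 := mul_le_mul_of_nonneg_left hfar hc
  have h3 : 0 < δ⁻¹ := by positivity
  linarith

theorem exists_rieszConstant_sq (p : ℝ) :
    ∃ ε : ℝ, |ε| = 1 ∧ rieszConstant p ^ 2 = 1 + ε * Real.cos (Real.pi / p) := by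
  have e : Real.pi / p = 2 * (Real.pi / (2 * p)) := by
    rw [mul_comm 2 p, ← div_div]; ring
  rcases max_choice (Real.sin (Real.pi / (2 * p))) (Real.cos (Real.pi / (2 * p))) with h | h
  · refine ⟨-1, by simp, ?_⟩
    rw [rieszConstant, h, mul_pow, Real.sq_sqrt zero_le_two, e, Real.cos_two_mul, Real.cos_sq']
    ring
  · refine ⟨1, by simp, ?_⟩
    rw [rieszConstant, h, mul_pow, Real.sq_sqrt zero_le_two, e, Real.cos_two_mul]
    ring

theorem one_sub_circleMap_mem_slitPlane {r t : ℝ} (hr0 : 0 ≤ r) (hr1 : r ≤ 1)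
    (ht : t ∈ Set.Ioo 0 (2 * Real.pi)) : 1 - circleMap 0 r t ∈ Complex.slitPlane := by
  have h1 : circleMap 0 r t ≠ 1 := by
    intro h
    have hr : r = 1 := by
      have := congrArg norm h
      simpa [abs_of_nonneg hr0] using this
    have := norm_one_sub_circleMap_pos ht
    rw [← hr, h] at this
    simp at this
  rw [Complex.mem_slitPlane_iff]
  by_contra! hcon
  refine h1 (Complex.ext ?_ ?_)
  · have := Complex.re_le_norm (circleMap 0 r t)
    simp only [norm_circleMap_zero, abs_of_nonneg hr0] at this
    have h2 := hcon.1
    simp only [Complex.sub_re, Complex.one_re] at h2 ⊢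
    linarith
  · have h2 := hcon.2
    simp only [Complex.sub_im, Complex.one_im] at h2 ⊢
    linarith

theorem arg_one_sub_circleMap {t : ℝ} (ht : t ∈ Set.Ioo 0 (2 * Real.pi)) :
    (1 - circleMap 0 1 t).arg = (t - Real.pi) / 2 := by
  have hs : 0 < Real.sin (t / 2) :=
    Real.sin_pos_of_pos_of_lt_pi (by linarith [ht.1]) (by linarith [ht.2])
  have h : 1 - circleMap 0 1 t = ((2 * Real.sin (t / 2) : ℝ) : ℂ) *
      (Complex.cos (((t - Real.pi) / 2 : ℝ) : ℂ) + Complex.sin (((t - Real.pi) / 2 : ℝ) : ℂ) *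
        Complex.I) := by
    have c1 : Real.cos ((t - Real.pi) / 2) = Real.sin (t / 2) := by
      rw [sub_div, Real.cos_sub_pi_div_two]
    have c2 : Real.sin ((t - Real.pi) / 2) = -Real.cos (t / 2) := by
      rw [sub_div, Real.sin_sub_pi_div_two]
    have d1 : Real.cos t = 1 - 2 * Real.sin (t / 2) ^ 2 := by
      have := Real.cos_two_mul (t / 2)
      rw [Real.cos_sq', mul_div_cancel₀ _ two_ne_zero] at this
      linarith
    have d2 : Real.sin t = 2 * Real.sin (t / 2) * Real.cos (t / 2) := by
      have := Real.sin_two_mul (t / 2)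
      rwa [mul_div_cancel₀ _ two_ne_zero] at this
    rw [← Complex.ofReal_cos, ← Complex.ofReal_sin, c1, c2, circleMap, Complex.exp_mul_I,
      ← Complex.ofReal_cos, ← Complex.ofReal_sin, d1, d2]
    push_cast
    ring
  rw [h, Complex.arg_mul_cos_add_sin_mul_I (by positivity)]
  exact ⟨by linarith [ht.1, Real.pi_pos], by linarith [ht.2, Real.pi_pos]⟩

theorem re_circleMap_mul_cpow_sq (γ : ℝ) {t : ℝ} (ht : t ∈ Set.Ioo 0 (2 * Real.pi)) :
    (circleMap 0 1 t * (1 - circleMap 0 1 t) ^ (-γ : ℂ) * (1 - circleMap 0 1 t) ^ (-γ : ℂ)).re =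
      (‖1 - circleMap 0 1 t‖ ^ (-γ)) ^ 2 * Real.cos (t + γ * (Real.pi - t)) := by
  have hq := norm_one_sub_circleMap_pos ht
  have hne : 1 - circleMap 0 1 t ≠ 0 := norm_pos_iff.1 hq
  have hr : (‖1 - circleMap 0 1 t‖ ^ (-γ)) ^ 2 =
      Real.exp (-(2 * γ) * Real.log ‖1 - circleMap 0 1 t‖) := by
    rw [Real.rpow_def_of_pos hq, ← Real.exp_nat_mul]
    congr 1; push_cast; ring
  have h : circleMap 0 1 t * (1 - circleMap 0 1 t) ^ (-γ : ℂ) * (1 - circleMap 0 1 t) ^ (-γ : ℂ) =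
      ((‖1 - circleMap 0 1 t‖ ^ (-γ)) ^ 2 : ℝ) *
        Complex.exp ((t + γ * (Real.pi - t) : ℝ) * Complex.I) := by
    rw [hr, Complex.cpow_def_of_ne_zero hne, Complex.log, arg_one_sub_circleMap ht]
    nth_rw 1 [circleMap]
    rw [Complex.ofReal_one, one_mul, zero_add, Complex.ofReal_exp, ← Complex.exp_add,
      ← Complex.exp_add, ← Complex.exp_add]
    congr 1
    push_cast
    ring
  rw [h, Complex.re_ofReal_mul, Complex.exp_ofReal_mul_I_re]

theorem abs_cos_sub_cos_pi_mul_le {γ a t : ℝ} (hγ0 : 0 ≤ γ) (hγ1 : γ ≤ 1)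
    (ht : t ∈ Set.Icc 0 (2 * Real.pi)) :
    |Real.cos (t + γ * (Real.pi - t)) - Real.cos (Real.pi * a)| ≤
      min t (2 * Real.pi - t) + Real.pi * |a - γ| := by
  have hpi := Real.pi_pos
  have key : ∀ x, 0 ≤ x → |Real.cos (x + γ * (Real.pi - x)) - Real.cos (Real.pi * a)| ≤
      x + Real.pi * |a - γ| := by
    intro x hx
    refine (Real.abs_cos_sub_cos_le _ _).trans ?_
    rw [show x + γ * (Real.pi - x) - Real.pi * a = (1 - γ) * x - Real.pi * (a - γ) by ring]
    refine (abs_sub _ _).trans ?_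
    rw [abs_mul, abs_mul, abs_of_nonneg hx, abs_of_pos hpi, abs_of_nonneg (sub_nonneg.2 hγ1)]
    nlinarith
  rcases min_choice t (2 * Real.pi - t) with h | h <;> rw [h]
  · exact key t ht.1
  · have := key (2 * Real.pi - t) (by linarith [ht.2])
    rwa [show 2 * Real.pi - t + γ * (Real.pi - (2 * Real.pi - t)) =
      2 * Real.pi - (t + γ * (Real.pi - t)) by ring, Real.cos_two_pi_sub] at this

theorem eLpNorm_le_hardyNorm {p : ℝ} (hp : 0 < p) {f : ℂ → ℂ}
    (hf : ContinuousOn f (Metric.ball 0 1)) {F : ℝ → ℂ}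
    (hF : ∀ᵐ t ∂circleSigma, Tendsto (fun r : ℝ => f (circleMap 0 r t)) (𝓝[<] 1) (𝓝 (F t))) :
    eLpNorm F (ENNReal.ofReal p) circleSigma ≤ hardyNorm p f := by
  obtain ⟨ρ, -, hρmem, hρ⟩ := exists_seq_strictMono_tendsto' (show (0 : ℝ) < 1 from one_pos)
  have hρ' : Tendsto ρ atTop (𝓝[<] 1) :=
    tendsto_nhdsWithin_iff.2 ⟨hρ, Eventually.of_forall fun n => (hρmem n).2⟩
  refine (Lp.eLpNorm_lim_le_liminf_eLpNorm (f := fun n t => f (circleMap 0 (ρ n) t))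
    (fun n => (memLp_circleMap hf (hρmem n).1.le (hρmem n).2
      (ENNReal.ofReal p)).aestronglyMeasurable) F (hF.mono fun t ht => ht.comp hρ')).trans ?_
  refine liminf_le_of_le (by isBoundedDefault) fun b hb => ?_
  obtain ⟨n, hn⟩ := hb.exists
  rw [← integralMean_eq_eLpNorm hp] at hn
  exact hn.trans (le_iSup₂_of_le (ρ n) (hρmem n) le_rfl)

theorem tendsto_one_sub_cpow_circleMap (γ : ℂ) {t : ℝ} (ht : t ∈ Set.Ioo 0 (2 * Real.pi)) :
    Tendsto (fun r : ℝ => (1 - circleMap 0 r t) ^ γ) (𝓝[<] 1)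
      (𝓝 ((1 - circleMap 0 1 t) ^ γ)) := by
  have h1 : Continuous fun r : ℝ => 1 - circleMap 0 r t := by
    unfold circleMap
    fun_prop
  exact ((h1.tendsto 1).mono_left nhdsWithin_le_nhds).cpow tendsto_const_nhds
    (one_sub_circleMap_mem_slitPlane zero_le_one le_rfl ht)

/-- The extremal mapping `ε z (1 - z) ^ (-γ) + conj ((1 - z) ^ (-γ))`. -/
noncomputable def extremalMap (ε γ : ℝ) (z : ℂ) : ℂ :=
  ε * z * (1 - z) ^ (-γ : ℂ) + conj ((1 - z) ^ (-γ : ℂ))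

theorem isHarmonicDecomposition_extremalMap (ε γ : ℝ) :
    IsHarmonicDecomposition (extremalMap ε γ) (fun z => ε * z * (1 - z) ^ (-γ : ℂ))
      (fun z => (1 - z) ^ (-γ : ℂ)) := by
  have hu : DifferentiableOn ℂ (fun z : ℂ => (1 - z) ^ (-γ : ℂ)) (Metric.ball 0 1) := by
    intro z hz
    have hz' : 1 - z ∈ Complex.slitPlane := by
      rw [sub_eq_add_neg]
      exact Complex.mem_slitPlane_of_norm_lt_one (by simpa using hz)
    exact ((differentiableAt_id.const_sub 1).cpow (differentiableAt_const _)
      hz').differentiableWithinAt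
  exact ⟨(differentiableOn_id.const_mul _).mul hu, hu, fun z _ => rfl⟩

theorem norm_cpow_neg_ofReal (γ : ℝ) (z : ℂ) : ‖z ^ (-γ : ℂ)‖ = ‖z‖ ^ (-γ) := by
  rw [← Complex.ofReal_neg, Complex.norm_cpow_real]

theorem norm_extremalMap_le {ε γ : ℝ} (hε : |ε| = 1) {z : ℂ} (hz : ‖z‖ ≤ 1) :
    ‖extremalMap ε γ z‖ ≤ 2 * ‖1 - z‖ ^ (-γ) := by
  refine (norm_add_le _ _).trans ?_
  rw [RCLike.norm_conj, norm_mul, norm_mul, Complex.norm_real, Real.norm_eq_abs, hε, one_mul,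
    norm_cpow_neg_ofReal, two_mul]
  gcongr
  exact mul_le_of_le_one_left (by positivity) hz

theorem norm_extremalMap_sq {ε : ℝ} (hε : |ε| = 1) (γ : ℝ) {t : ℝ}
    (ht : t ∈ Set.Ioo 0 (2 * Real.pi)) :
    ‖extremalMap ε γ (circleMap 0 1 t)‖ ^ 2 = 2 * (‖1 - circleMap 0 1 t‖ ^ (-γ)) ^ 2 *
      (1 + ε * Real.cos (t + γ * (Real.pi - t))) := by
  rw [extremalMap, norm_add_conj_sq, norm_mul, norm_mul, Complex.norm_real, Real.norm_eq_abs, hε,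
    one_mul, norm_cpow_neg_ofReal, norm_circleMap_zero, abs_one, one_mul, mul_assoc (ε : ℂ),
    mul_assoc (ε : ℂ), Complex.re_ofReal_mul, re_circleMap_mul_cpow_sq γ ht]
  ring

theorem memLp_norm_one_sub_circleMap_rpow {p γ : ℝ} (hp : 0 < p) (hγ0 : 0 ≤ γ) (hγ : γ * p < 1) :
    MemLp (fun t => ‖1 - circleMap 0 1 t‖ ^ (-γ)) (ENNReal.ofReal p) circleSigma := by
  have hm : Measurable fun t => ‖1 - circleMap 0 1 t‖ ^ (-γ) := by
    have : Measurable fun t => ‖1 - circleMap 0 1 t‖ :=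
      (continuous_const.sub (continuous_circleMap 0 1)).norm.measurable
    exact this.pow_const _
  rw [← integrable_norm_rpow_iff hm.aestronglyMeasurable (by simpa using hp) ENNReal.ofReal_ne_top,
    ENNReal.toReal_ofReal hp.le]
  refine (integrable_norm_one_sub_circleMap_rpow (mul_nonneg hγ0 hp.le) hγ).congr
    (Eventually.of_forall fun t => ?_)
  simp only
  rw [Real.norm_eq_abs, abs_of_nonneg (by positivity), ← Real.rpow_mul (norm_nonneg _), neg_mul]

theorem hardyNorm_extremalMap_lt_top {p ε γ : ℝ} (hp : 0 < p) (hε : |ε| = 1) (hγ0 : 0 ≤ γ)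
    (hγ : γ * p < 1) : hardyNorm p (extremalMap ε γ) < ∞ := by
  have hw := (memLp_norm_one_sub_circleMap_rpow hp hγ0 hγ).const_mul (2 * (2⁻¹ : ℝ) ^ (-γ))
  refine lt_of_le_of_lt (iSup₂_le fun r hr => ?_) hw.2
  rw [integralMean_eq_eLpNorm hp]
  refine eLpNorm_mono_ae_real ?_
  filter_upwards [ae_mem_Ioo_circleSigma] with t ht
  refine (norm_extremalMap_le hε (by simpa [abs_of_pos hr.1] using hr.2.le)).trans ?_
  rw [mul_assoc, ← Real.mul_rpow (by norm_num) (norm_nonneg _)]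
  have h1 := norm_circleMap_sub_le_two_mul 0 t hr.1.le hr.2.le
  have h2 : circleMap 0 1 0 = 1 := by simp [circleMap]
  rw [h2] at h1
  have := norm_one_sub_circleMap_pos ht
  gcongr 2 * ?_
  exact Real.rpow_le_rpow_of_nonpos (by positivity) (by linarith) (by linarith)

theorem hardyNorm_extremalMap_ge {p ε γ : ℝ} (hp : 0 < p) (hε : |ε| = 1) (hγ0 : 0 ≤ γ)
    (hγ : γ * p < 1) :
    MemLp (fun t => extremalMap ε γ (circleMap 0 1 t)) (ENNReal.ofReal p) circleSigma ∧
    eLpNorm (fun t => extremalMap ε γ (circleMap 0 1 t)) (ENNReal.ofReal p) circleSigma ≤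
      hardyNorm p (extremalMap ε γ) := by
  have hdec := isHarmonicDecomposition_extremalMap ε γ
  constructor
  · refine ((memLp_norm_one_sub_circleMap_rpow hp hγ0 hγ).const_mul 2).mono' ?_
      (Eventually.of_forall fun t => norm_extremalMap_le hε (by simp))
    have h1 : Measurable (circleMap 0 1) := (continuous_circleMap 0 1).measurable
    have h2 : Measurable fun t => (1 - circleMap 0 1 t) ^ (-γ : ℂ) :=
      (measurable_const.sub h1).pow_const _
    exact (((measurable_const.mul h1).mul h2).add
      (Complex.continuous_conj.measurable.comp h2)).aestronglyMeasurable
  · refine eLpNorm_le_hardyNorm hp ((hdec.holo_left.continuousOn.add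
      (Complex.continuous_conj.comp_continuousOn hdec.holo_right.continuousOn)).congr hdec.eq_on) ?_
    filter_upwards [ae_mem_Ioo_circleSigma] with t ht
    have h1 := tendsto_one_sub_cpow_circleMap (-γ : ℂ) ht
    have h2 : Continuous fun r : ℝ => (ε : ℂ) * circleMap 0 r t := by
      unfold circleMap
      fun_prop
    exact (((h2.tendsto 1).mono_left nhdsWithin_le_nhds).mul h1).add
      ((Complex.continuous_conj.tendsto _).comp h1)

theorem boundaryNorm_extremalMap {p ε γ : ℝ} (hp : 0 < p) (hε : |ε| = 1) (hγ0 : 0 ≤ γ)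
    (hγ : γ * p < 1) :
    boundaryNorm p (fun z => ε * z * (1 - z) ^ (-γ : ℂ)) (fun z => (1 - z) ^ (-γ : ℂ)) =
      ENNReal.ofReal ((2 ^ (p / 2) * ∫ t, ‖1 - circleMap 0 1 t‖ ^ (-(γ * p)) ∂circleSigma) ^
        p⁻¹) := by
  have hw := (memLp_norm_one_sub_circleMap_rpow hp hγ0 hγ).const_mul (√2)
  rw [boundaryNorm_eq_eLpNorm hp
    (G := fun t => ε * circleMap 0 1 t * (1 - circleMap 0 1 t) ^ (-γ : ℂ))
    (H := fun t => (1 - circleMap 0 1 t) ^ (-γ : ℂ))]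
  · have e1 : (fun t => √(‖(ε : ℂ) * circleMap 0 1 t * (1 - circleMap 0 1 t) ^ (-γ : ℂ)‖ ^ 2 +
        ‖(1 - circleMap 0 1 t) ^ (-γ : ℂ)‖ ^ 2)) =
        fun t => √2 * ‖1 - circleMap 0 1 t‖ ^ (-γ) := by
      funext t
      rw [norm_mul, norm_mul, Complex.norm_real, Real.norm_eq_abs, hε, norm_circleMap_zero, abs_one,
        one_mul, one_mul, norm_cpow_neg_ofReal, ← two_mul, Real.sqrt_mul zero_le_two,
        Real.sqrt_sq (by positivity)]
    rw [e1, MemLp.eLpNorm_eq_integral_rpow_norm (by simpa using hp) ENNReal.ofReal_ne_top hw,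
      ENNReal.toReal_ofReal hp.le, ← integral_const_mul]
    congr 3
    funext t
    rw [Real.norm_eq_abs, abs_of_nonneg (by positivity),
      Real.mul_rpow (by positivity) (by positivity), ← Real.rpow_mul (norm_nonneg _), neg_mul,
      Real.sqrt_eq_rpow, ← Real.rpow_mul zero_le_two]
    ring_nf
  · filter_upwards [ae_mem_Ioo_circleSigma] with t ht
    have h2 : Continuous fun r : ℝ => (ε : ℂ) * circleMap 0 r t := by
      unfold circleMap
      fun_prop
    exact (((h2.tendsto 1).mono_left nhdsWithin_le_nhds).mul
      (tendsto_one_sub_cpow_circleMap (-γ : ℂ) ht)).limUnder_eq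
  · filter_upwards [ae_mem_Ioo_circleSigma] with t ht
    exact (tendsto_one_sub_cpow_circleMap (-γ : ℂ) ht).limUnder_eq

theorem exists_mul_boundaryNorm_lt_hardyNorm {p : ℝ} (hp : 1 < p) {C : ℝ} (hC0 : 0 ≤ C)
    (hC : C < rieszConstant p) :
    ∃ ε γ : ℝ, hardyNorm p (extremalMap ε γ) < ∞ ∧
      ENNReal.ofReal C * boundaryNorm p (fun z => ε * z * (1 - z) ^ (-γ : ℂ))
        (fun z => (1 - z) ^ (-γ : ℂ)) < hardyNorm p (extremalMap ε γ) := by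
  have hpi := Real.pi_pos
  have hp0 : 0 < p := by linarith
  obtain ⟨D, hCD, hDR⟩ := exists_between hC
  have hD0 : 0 ≤ D := hC0.trans hCD.le
  obtain ⟨ε, hε, hR⟩ := exists_rieszConstant_sq p
  set η := (rieszConstant p ^ 2 - D ^ 2) / 2 with hη
  have hη0 : 0 < η := half_pos (sub_pos.2 (by gcongr))
  set δ := min (η / Real.pi) 1 with hδ
  have hδ0 : 0 < δ := lt_min (by positivity) one_pos
  obtain ⟨s, hs, hsmem⟩ := ((eventually_mul_integral_lt_mul_setIntegral (by positivity)
    (Real.rpow_lt_rpow hC0 hCD hp0) hδ0 (min_le_right _ _)).and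
    (Ioo_mem_nhdsGT (show (0 : ℝ) < min 1 (η / Real.pi) from lt_min one_pos (by positivity)))).exists
  have hs0 : 0 < s := hsmem.1
  have hs1 : s < 1 := hsmem.2.trans_le (min_le_left _ _)
  have hsη : Real.pi * s ≤ η := by
    have := hsmem.2.le.trans (min_le_right _ _)
    rw [le_div_iff₀ hpi] at this
    linarith
  set γ := (1 - s) / p with hγ
  have hγp : γ * p = 1 - s := div_mul_cancel₀ _ hp0.ne'
  have hγ0 : 0 ≤ γ := div_nonneg (by linarith) hp0.le
  have hγ1 : γ ≤ 1 := (div_le_one hp0).2 (by linarith)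
  have hγp1 : γ * p < 1 := by linarith
  obtain ⟨hF, hFle⟩ := hardyNorm_extremalMap_ge (ε := ε) hp0 hε hγ0 hγp1
  refine ⟨ε, γ, hardyNorm_extremalMap_lt_top hp0 hε hγ0 hγp1, lt_of_lt_of_le ?_ hFle⟩
  have hP0 : ENNReal.ofReal p ≠ 0 := by simpa using hp0
  rw [boundaryNorm_extremalMap hp0 hε hγ0 hγp1, hγp,
    MemLp.eLpNorm_eq_integral_rpow_norm hP0 ENNReal.ofReal_ne_top hF, ENNReal.toReal_ofReal hp0.le,
    ← ENNReal.ofReal_mul hC0]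
  set A := ∫ t, ‖1 - circleMap 0 1 t‖ ^ (-(1 - s)) ∂circleSigma with hA
  have hA0 : 0 ≤ A := integral_nonneg fun t => by positivity
  have hFi := hF.integrable_norm_rpow hP0 ENNReal.ofReal_ne_top
  rw [ENNReal.toReal_ofReal hp0.le] at hFi
  have hNm : MeasurableSet {t | ‖1 - circleMap 0 1 t‖ < δ} :=
    (isOpen_lt (continuous_const.sub (continuous_circleMap 0 1)).norm continuous_const).measurableSet
  have hlow : 2 ^ (p / 2) * (D ^ p *
      ∫ t in {t | ‖1 - circleMap 0 1 t‖ < δ}, ‖1 - circleMap 0 1 t‖ ^ (-(1 - s)) ∂circleSigma) ≤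
      ∫ t, ‖extremalMap ε γ (circleMap 0 1 t)‖ ^ p ∂circleSigma := by
    rw [← integral_const_mul, ← integral_const_mul]
    refine le_trans (setIntegral_mono_on_ae ?_ hFi.integrableOn hNm ?_)
      (setIntegral_le_integral hFi (Eventually.of_forall fun t => by positivity))
    · exact (((integrable_norm_one_sub_circleMap_rpow (by linarith) (by linarith)).const_mul
        _).const_mul _).integrableOn
    filter_upwards [ae_mem_Ioo_circleSigma] with t ht htδ
    have htδ : ‖1 - circleMap 0 1 t‖ < δ := htδ
    have hcos : D ^ 2 ≤ 1 + ε * Real.cos (t + γ * (Real.pi - t)) := by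
      have h1 := abs_cos_sub_cos_pi_mul_le (a := 1 / p) hγ0 hγ1 (Set.Ioo_subset_Icc_self ht)
      have h2 := min_le_mul_norm_one_sub_circleMap (Set.Ioo_subset_Icc_self ht)
      have h3 : |1 / p - γ| ≤ s := by
        rw [hγ, ← sub_div, sub_sub_cancel, abs_of_pos (by positivity)]
        exact div_le_self hs0.le hp.le
      have h4 : Real.pi * |1 / p - γ| ≤ η := (mul_le_mul_of_nonneg_left h3 hpi.le).trans hsη
      have h5 : Real.pi / 2 * ‖1 - circleMap 0 1 t‖ ≤ η := by
        have : ‖1 - circleMap 0 1 t‖ ≤ η / Real.pi := htδ.le.trans (min_le_left _ _)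
        rw [le_div_iff₀ hpi] at this
        linarith
      have h6 := neg_abs_le (ε * (Real.cos (t + γ * (Real.pi - t)) - Real.cos (Real.pi * (1 / p))))
      rw [abs_mul, hε, one_mul, mul_one_div] at h6
      rw [mul_one_div] at h1
      linarith
    have hw : 0 ≤ ‖1 - circleMap 0 1 t‖ ^ (-γ) := by positivity
    calc _ = (2 * (‖1 - circleMap 0 1 t‖ ^ (-γ)) ^ 2 * D ^ 2) ^ (p / 2) := by
          rw [Real.mul_rpow (by positivity) (by positivity), sq_rpow_half hD0,
            Real.mul_rpow zero_le_two (by positivity), sq_rpow_half hw,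
            ← Real.rpow_mul (norm_nonneg _), neg_mul, hγp]
          ring
      _ ≤ (‖extremalMap ε γ (circleMap 0 1 t)‖ ^ 2) ^ (p / 2) := by
          rw [norm_extremalMap_sq hε γ ht]
          gcongr
      _ = _ := sq_rpow_half (norm_nonneg _)
  have hlt : C ^ p * (2 ^ (p / 2) * A) <
      ∫ t, ‖extremalMap ε γ (circleMap 0 1 t)‖ ^ p ∂circleSigma := by
    refine lt_of_lt_of_le ?_ hlow
    rw [mul_left_comm]
    exact mul_lt_mul_of_pos_left hs (by positivity)
  have hCA : C * (2 ^ (p / 2) * A) ^ p⁻¹ = (C ^ p * (2 ^ (p / 2) * A)) ^ p⁻¹ := by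
    rw [Real.mul_rpow (x := C ^ p) (by positivity) (by positivity), ← Real.rpow_mul hC0,
      mul_inv_cancel₀ hp0.ne', Real.rpow_one]
  rw [hCA]
  have hlt' := Real.rpow_lt_rpow (by positivity) hlt (inv_pos.2 hp0)
  exact (ENNReal.ofReal_lt_ofReal_iff_of_nonneg (by positivity)).2 hlt'

theorem theorem2p3 (p : ℝ) (hp : 1 < p) :
    (∀ f g h : ℂ → ℂ, IsHarmonicDecomposition f g h → MemHarmonicHardy p f →
      (g 0 * h 0).re ≤ 0 →
      (∀ᵐ t ∂circleSigma, HasRadialLimit g t ∧ HasRadialLimit h t) ∧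
      boundaryNorm p g h < ∞ ∧
      hardyNorm p f ≤ ENNReal.ofReal (rieszConstant p) * boundaryNorm p g h) ∧
    (∀ C : ℝ, C < rieszConstant p →
      ∃ f g h : ℂ → ℂ, IsHarmonicDecomposition f g h ∧ MemHarmonicHardy p f ∧
        (g 0 * h 0).re ≤ 0 ∧
        ENNReal.ofReal C * boundaryNorm p g h < hardyNorm p f) := by
  refine ⟨fun f g h hf hmem h0 => hardyNorm_le_rieszConstant_mul_boundaryNorm hp hf hmem.2 h0,
    fun C hC => ?_⟩
  obtain ⟨ε, γ, hfin, hlt⟩ := exists_mul_boundaryNorm_lt_hardyNorm hp (le_max_right C 0)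
    (max_lt hC (rieszConstant_pos hp))
  have hdec := isHarmonicDecomposition_extremalMap ε γ
  refine ⟨_, _, _, hdec, ⟨⟨_, _, hdec⟩, hfin⟩, by simp, lt_of_le_of_lt ?_ hlt⟩
  exact mul_le_mul_left (ENNReal.ofReal_le_ofReal (le_max_left C 0)) _
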